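/- Let $M$ be a smooth surface with a smooth Riemannian metric $g$, and let $I$ be a smooth quadratic integral of its geodesic flow (a smooth field of symmetric bilinear forms $I_x$ on the tangent planes such that $I(\xi,\xi)$, as a function of the velocity $\xi$, is a first integral of the geodesic flow). Suppose that 1. on a connected open set $\Omega\subset M$ the form $I_x$ is nonzero and has two distinct real zero directions (so that the zero directions form a geodesic net $\mathcal G$ on $\Omega$, and the directions bisecting the angles between them form the orthogonal bisector net $\mathcal N$); 2. the net $\mathcal G$ has a closed simple smooth envelope $\mathfrak E$: at each point of $\mathfrak E$ a geodesic is tangent to $\mathfrak E$ which near the point of contact, but not at it, lies in $\Omega\setminus\mathfrak E$ and runs along zero directions of $I$; 3. the foliation $\mathcal F$ of $\mathcal N$ that goes along $\mathfrak E$ (its tangent line field extends continuously to $\mathfrak E$ and is tangent to $\mathfrak E$ there) has a closed simple smooth leaf $\mathfrak B\subset\Omega$, equipped with a continuous unit normal field $\nu$ along $\mathfrak B$ that points to the side on which the billiard table lies. Seen from this side, $\mathfrak B$ is convex with respect to the geodesics: its geodesic curvature with respect to $\nu$ is nonnegative and no arc of $\mathfrak B$ is a geodesic. Consider the billiard with the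 wall $\mathfrak B$ in the table on the side $\nu$: a trajectory is a sequence of geodesic arcs, each of which leaves $\mathfrak B$ transversally into the table, does not meet $\mathfrak B$ until it arrives at $\mathfrak B$ transversally from the table, and is there reflected by the law $\xi\mapsto\xi-2g(\xi,\nu)\nu$. Then this billiard is locally integrable: (i) There are $\delta>0$ and a function $f$ on the set of nonzero tangent vectors of $M$, smooth and positively homogeneous of degree $0$, that is constant along every trajectory starting at an angle less than $\delta$ with the wall, and that is nonconstant in the following sense: at each point of $\mathfrak B$ and for each unit vector $w$ tangent to $\mathfrak B$ there, $\theta\mapsto f(\cos\theta\, w+\sin\theta\,\nu)$ is strictly increasing on $[0,\delta]$. (ii) There are $\varepsilon>0$ and a diffeomorphism $\Phi$ of $(\mathbb R/\mathbb Z)\times(-\varepsilon,\varepsilon)$ onto a neighbourhood of $\mathfrak B$ in $M$ such that $\Phi(\cdot,0)$ parametrizes $\mathfrak B$, the part $s>0$ lies on the side of $\nu$, and for every $s\in(0,\varepsilon)$ the closed curve $C_s=\Phi((\mathbb R/\mathbb Z)\times\{s\})$ is a caustic: if one arc of a trajectory is tangent to $C_s$, then so is every arc of this trajectory. Moreover,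 for some $\delta'>0$, every trajectory that starts at an angle less than $\delta'$ with the wall has all its arcs tangent to one of the curves $C_s$, $0<s<\varepsilon$. -/

import Mathlib

open scoped Manifold ContDiff
open Set

noncomputable section

namespace GeodesicBilliard

/-- The model plane. -/
abbrev Plane : Type := EuclideanSpace ℝ (Fin 2)

/-- A smooth Riemannian metric on the surface `M`. -/
abbrev Metric (M : Type*) [TopologicalSpace M] [ChartedSpace Plane M] [IsManifold (𝓡 2) ∞ M] :=
  Bundle.ContMDiffRiemannianMetric (𝓡 2) ∞ Plane (fun x : M => TangentSpace (𝓡 2) x)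

/-- A smooth field of symmetric bilinear forms on the tangent planes of `M`; equivalently a smooth
function on the tangent bundle which is a homogeneous quadratic polynomial in the velocities. -/
structure QuadraticField (M : Type*) [TopologicalSpace M] [ChartedSpace Plane M]
    [IsManifold (𝓡 2) ∞ M] where
  /-- the bilinear form at a point -/
  form (x : M) : TangentSpace (𝓡 2) x →L[ℝ] TangentSpace (𝓡 2) x →L[ℝ] ℝ
  symm (x : M) (v w : TangentSpace (𝓡 2) x) : form x v w = form x w v
  contMDiff : ContMDiff (𝓡 2) ((𝓡 2).prod 𝓘(ℝ, Plane →L[ℝ] Plane →L[ℝ] ℝ)) ∞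
    (fun x => Bundle.TotalSpace.mk' (Plane →L[ℝ] Plane →L[ℝ] ℝ) x (form x))

section

variable {M : Type*} [TopologicalSpace M] [ChartedSpace Plane M] [IsManifold (𝓡 2) ∞ M]

/-! ### Geodesics and quadratic integrals -/

/-- The expression in the chart `e` of a field `B` of bilinear forms: the value at the point with
coordinates `y` on the vectors with components `v`, `w`. -/
def localForm (B : ∀ x : M, TangentSpace (𝓡 2) x →L[ℝ] TangentSpace (𝓡 2) x →L[ℝ] ℝ)
    (e : OpenPartialHomeomorph M Plane) (v w y : Plane) : ℝ :=
  B (e.symm y) (mfderiv (𝓡 2) (𝓡 2) e.symm y v) (mfderiv (𝓡 2) (𝓡 2) e.symm y w)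

/-- Let a curve have, in the chart `e`, position `y`, velocity `v` and second derivative `a`.
This is `g (D/dt γ', w)`, the scalar product of its covariant acceleration with `w`, i.e. the
Euler-Lagrange expression `d/dt (∂L/∂v) w - (∂L/∂y) w` of the Lagrangian `L = g (v, v) / 2`. -/
def covAcc (g : Metric M) (e : OpenPartialHomeomorph M Plane) (y v a w : Plane) : ℝ :=
  localForm g.inner e a w y + fderiv ℝ (localForm g.inner e v w) y v
    - (1 / 2) * fderiv ℝ (localForm g.inner e v v) y w

/-- `γ` is a (possibly constant) affinely parametrized geodesic at all times in `J`:
it is smooth there and solves the Euler-Lagrange equations of `g (v, v) / 2` in every chart. -/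
def IsGeodesicOn (g : Metric M) (γ : ℝ → M) (J : Set ℝ) : Prop :=
  ∀ t ∈ J, ContMDiffAt 𝓘(ℝ, ℝ) (𝓡 2) ∞ γ t ∧
    ∀ e ∈ IsManifold.maximalAtlas (𝓡 2) ∞ M, γ t ∈ e.source →
      ∀ w : Plane, covAcc g e (e (γ t)) (deriv (e ∘ γ) t) (deriv (deriv (e ∘ γ)) t) w = 0

/-- `S` is a first integral of the geodesic flow: the derivative of `(y, v) ↦ S_y (v, v)` along the
geodesic vector field `y' = v`, `v' = a(y, v)` on the tangent bundle vanishes. -/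
def IsFirstIntegral (g : Metric M) (S : QuadraticField M) : Prop :=
  ∀ e ∈ IsManifold.maximalAtlas (𝓡 2) ∞ M, ∀ y ∈ e.target, ∀ v a : Plane,
    (∀ w : Plane, covAcc g e y v a w = 0) →
      fderiv ℝ (localForm S.form e v v) y v + 2 * localForm S.form e a v y = 0

/-! ### Curves -/

/-- The velocity of a curve, as a point of the tangent bundle. -/
def velocity (γ : ℝ → M) (t : ℝ) : TangentBundle (𝓡 2) M :=
  ⟨γ t, mfderiv 𝓘(ℝ, ℝ) (𝓡 2) γ t (1 : ℝ)⟩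

/-- `c` is a regular smooth parametrization, with period `1`, of a closed simple smooth curve. -/
structure IsSimpleClosedCurve (c : ℝ → M) : Prop where
  smooth : ContMDiff 𝓘(ℝ, ℝ) (𝓡 2) ∞ c
  regular : ∀ t, (velocity c t).2 ≠ 0
  periodic : ∀ t, c (t + 1) = c t
  simple : ∀ s t, c s = c t → ∃ n : ℤ, t = s + n

/-! ### The geodesic net of a quadratic integral, its envelope and its bisector net -/

/-- `S` is not zero at `x` and has two distinct real zero directions there. -/
def HasRealZeroDirections (S : QuadraticField M) (x : M) : Prop :=
  S.form x ≠ 0 ∧ ∃ ξ η : TangentSpace (𝓡 2) x, LinearIndependent ℝ ![ξ, η] ∧ S.form x ξ ξ = 0 ∧ S.form x η η = 0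

/-- `w` bisects one of the angles formed by the two zero directions of `S` at `x`. -/
def IsBisector (g : Metric M) (S : QuadraticField M) (x : M) (w : TangentSpace (𝓡 2) x) : Prop :=
  ∃ ξ η : TangentSpace (𝓡 2) x, LinearIndependent ℝ ![ξ, η] ∧
    S.form x ξ ξ = 0 ∧ S.form x η η = 0 ∧ g.inner x ξ ξ = g.inner x η η ∧ w = ξ + η

/-- The vector field `X` is continuous on `V`. -/
def ContinuousFieldOn (X : ∀ x : M, TangentSpace (𝓡 2) x) (V : Set M) : Prop :=
  ContinuousOn (fun x => (⟨x, X x⟩ : TangentBundle (𝓡 2) M)) V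

/-- The line field `F` is tangent to one of the two bisector foliations on `Ω`: it is spanned
locally by a continuous field of bisectors. -/
def IsBisectorFoliation (g : Metric M) (S : QuadraticField M) (Ω : Set M)
    (F : ∀ x : M, Submodule ℝ (TangentSpace (𝓡 2) x)) : Prop :=
  ∀ p ∈ Ω, ∃ V : Set M, IsOpen V ∧ p ∈ V ∧ V ⊆ Ω ∧
    ∃ X : ∀ x : M, TangentSpace (𝓡 2) x, ContinuousFieldOn X V ∧
      ∀ x ∈ V, IsBisector g S x (X x) ∧ F x = Submodule.span ℝ {X x}

/-- The curve `E` is an envelope of the geodesic net formed on `Ω` by the zero directions of `S`: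
at each of its points it is touched by a geodesic whose other points near the point of contact lie
in `Ω` but not on `E` and at which the geodesic runs along a zero direction of `S`. -/
def IsEnvelope (g : Metric M) (S : QuadraticField M) (Ω : Set M) (E : ℝ → M) : Prop :=
  ∀ t : ℝ, ∃ (γ : ℝ → M) (r : ℝ), 0 < r ∧ IsGeodesicOn g γ (Ioo (-r) r) ∧
    velocity γ 0 = velocity E t ∧
    ∀ τ ∈ Ioo (-r) r, τ ≠ 0 → γ τ ∈ Ω ∧ γ τ ∉ range E ∧
      S.form (γ τ) (velocity γ τ).2 (velocity γ τ).2 = 0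

/-- The line field `F`, given on `Ω`, goes along the curve `E`: near each point of `E` it extends
continuously to `E`, and on `E` the extension is tangent to `E`. -/
def GoesAlong (F : ∀ x : M, Submodule ℝ (TangentSpace (𝓡 2) x)) (Ω : Set M) (E : ℝ → M) : Prop :=
  ∀ p ∈ range E, ∃ V : Set M, IsOpen V ∧ p ∈ V ∧
    ∃ X : ∀ x : M, TangentSpace (𝓡 2) x, ContinuousFieldOn X (V ∩ (Ω ∪ range E)) ∧
      (∀ x ∈ V ∩ Ω, F x = Submodule.span ℝ {X x}) ∧
      ∀ t : ℝ, E t ∈ V → X (E t) ≠ 0 ∧ X (E t) ∈ Submodule.span ℝ {(velocity E t).2}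

/-- `c` runs in `Ω` and is tangent to the line field `F`. -/
def IsLeaf (F : ∀ x : M, Submodule ℝ (TangentSpace (𝓡 2) x)) (Ω : Set M) (c : ℝ → M) : Prop :=
  ∀ t : ℝ, c t ∈ Ω ∧ (velocity c t).2 ∈ F (c t)

/-! ### Walls -/

/-- `ν` is a continuous field of unit normals along the curve `c` (the values of `ν` elsewhere are
irrelevant). It points to the side of `c` on which the billiard table lies. -/
structure IsUnitNormal (g : Metric M) (c : ℝ → M) (ν : ∀ x : M, TangentSpace (𝓡 2) x) :
    Prop where
  continuous : ContinuousFieldOn ν (range c)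
  unit : ∀ t, g.inner (c t) (ν (c t)) (ν (c t)) = 1
  normal : ∀ t, g.inner (c t) (velocity c t).2 (ν (c t)) = 0

/-- The geodesic curvature of the regular curve `c` with respect to its unit normal field `ν`,
computed in a chart at `c t` (it does not depend on the chart). -/
def geodesicCurvature (g : Metric M) (c : ℝ → M) (ν : ∀ x : M, TangentSpace (𝓡 2) x) (t : ℝ) : ℝ :=
  covAcc g (chartAt Plane (c t)) (chartAt Plane (c t) (c t))
      (deriv (chartAt Plane (c t) ∘ c) t) (deriv (deriv (chartAt Plane (c t) ∘ c)) t)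
      (mfderiv (𝓡 2) (𝓡 2) (chartAt Plane (c t)) (c t) (ν (c t)))
    / g.inner (c t) (velocity c t).2 (velocity c t).2

/-- The wall `c` is convex with respect to the geodesics, seen from the side of `ν`: its geodesic
curvature towards this side is nowhere negative, and no arc of the wall is a geodesic. -/
def IsConvexWall (g : Metric M) (c : ℝ → M) (ν : ∀ x : M, TangentSpace (𝓡 2) x) : Prop :=
  (∀ t, 0 ≤ geodesicCurvature g c ν t) ∧
    ∀ a b : ℝ, a < b → ∃ t ∈ Ioo a b, geodesicCurvature g c ν t ≠ 0

/-! ### The billiard -/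

/-- Reflection of a tangent vector in the wall with unit normal `ν`. -/
def reflect (g : Metric M) (ν : ∀ x : M, TangentSpace (𝓡 2) x) (z : TangentBundle (𝓡 2) M) :
    TangentBundle (𝓡 2) M :=
  ⟨z.1, z.2 - (2 * g.inner z.1 z.2 (ν z.1)) • ν z.1⟩

/-- The angle, between `-π/2` and `π/2`, that a nonzero tangent vector at a point of the wall forms
with the wall; it is positive if the vector points to the side of `ν`. -/
def wallAngle (g : Metric M) (ν : ∀ x : M, TangentSpace (𝓡 2) x) (z : TangentBundle (𝓡 2) M) : ℝ :=
  Real.arcsin (g.inner z.1 z.2 (ν z.1) / Real.sqrt (g.inner z.1 z.2 z.2))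

/-- A piece, consisting of `N` consecutive arcs, of a billiard trajectory in the table which lies on
the side `ν` of the wall `c`. For `i < N` the `i`-th arc is a geodesic that leaves the wall at time
`time i` into the table, does not meet the wall until it arrives from the table at time
`time (i + 1)`, and is then reflected. -/
structure Trajectory (g : Metric M) (c : ℝ → M) (ν : ∀ x : M, TangentSpace (𝓡 2) x) (N : ℕ) where
  /-- the times of the collisions -/
  time : ℕ → ℝ
  /-- the geodesic arcs between the collisions -/
  arc : ℕ → ℝ → M
  time_lt : ∀ i < N, time i < time (i + 1)
  geodesic : ∀ i < N, IsGeodesicOn g (arc i) (Icc (time i) (time (i + 1)))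
  start_mem : ∀ i < N, arc i (time i) ∈ range c
  end_mem : ∀ i < N, arc i (time (i + 1)) ∈ range c
  start_inward : ∀ i < N,
    0 < g.inner (arc i (time i)) (velocity (arc i) (time i)).2 (ν (arc i (time i)))
  end_outward : ∀ i < N,
    g.inner (arc i (time (i + 1))) (velocity (arc i) (time (i + 1))).2
      (ν (arc i (time (i + 1)))) < 0
  interior : ∀ i < N, ∀ t ∈ Ioo (time i) (time (i + 1)), arc i t ∉ range c
  reflection : ∀ i, i + 1 < N →
    velocity (arc (i + 1)) (time (i + 1)) = reflect g ν (velocity (arc i) (time (i + 1)))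

/-- The angle with the wall at which the trajectory starts. -/
def Trajectory.angle {g : Metric M} {c : ℝ → M} {ν : ∀ x : M, TangentSpace (𝓡 2) x} {N : ℕ}
    (T : Trajectory g c ν N) : ℝ :=
  wallAngle g ν (velocity (T.arc 0) (T.time 0))

/-- The `i`-th arc of the trajectory touches the curve `k` at some moment between the collisions. -/
def Trajectory.TangentTo {g : Metric M} {c : ℝ → M} {ν : ∀ x : M, TangentSpace (𝓡 2) x} {N : ℕ}
    (T : Trajectory g c ν N) (i : ℕ) (k : ℝ → M) : Prop :=
  ∃ t ∈ Ioo (T.time i) (T.time (i + 1)), ∃ r l : ℝ,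
    velocity (T.arc i) t = ⟨k r, l • (velocity k r).2⟩

/-- The closed simple smooth curve `k` is a caustic of the billiard: if one arc of a trajectory is
tangent to `k`, then every arc of the trajectory, before and after it, is tangent to `k`. -/
def IsCaustic (g : Metric M) (c : ℝ → M) (ν : ∀ x : M, TangentSpace (𝓡 2) x) (k : ℝ → M) : Prop :=
  IsSimpleClosedCurve k ∧
    ∀ (N : ℕ) (T : Trajectory g c ν N), ∀ i < N, ∀ j < N, T.TangentTo i k → T.TangentTo j k

/-- `f` is an integral of motion for the trajectories that start at an angle less than `δ` with the
wall. It is a function on the phase space of nonzero velocities, smooth, dependent only on the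
direction of motion (in particular it is no function of the kinetic energy), nonconstant in the
strong sense that at each point of the wall it is strictly monotone in the angle of motion
in `[0, δ]`, and constant along every such trajectory, across the collisions. -/
structure IsIntegralOfMotion (g : Metric M) (c : ℝ → M) (ν : ∀ x : M, TangentSpace (𝓡 2) x)
    (δ : ℝ) (f : TangentBundle (𝓡 2) M → ℝ) : Prop where
  smooth : ContMDiffOn (𝓡 2).tangent 𝓘(ℝ, ℝ) ∞ f {z | z.2 ≠ 0}
  homogeneous : ∀ (x : M) (v : TangentSpace (𝓡 2) x) (r : ℝ), v ≠ 0 → 0 < r →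
    f ⟨x, r • v⟩ = f ⟨x, v⟩
  nonconstant : ∀ (t : ℝ) (w : TangentSpace (𝓡 2) (c t)), g.inner (c t) w w = 1 →
    g.inner (c t) w (ν (c t)) = 0 →
      StrictMonoOn (fun θ : ℝ => f ⟨c t, Real.cos θ • w + Real.sin θ • ν (c t)⟩) (Icc 0 δ)
  conserved : ∀ (N : ℕ) (T : Trajectory g c ν N), T.angle < δ → ∀ i < N, ∀ j < N,
    ∀ t ∈ Icc (T.time i) (T.time (i + 1)), ∀ t' ∈ Icc (T.time j) (T.time (j + 1)),
      f (velocity (T.arc i) t) = f (velocity (T.arc j) t')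

/-- `Φ` is a collar of the closed curve `c` of width `ε`: a diffeomorphism of
`(ℝ/ℤ) × (-ε, ε)` onto a neighbourhood of `c`, written as a map periodic in the first variable, with
`Φ (t, 0) = c t`, such that the points `Φ (t, s)` with `s > 0` are on the side of `ν`.
The curves `s = const` foliate the neighbourhood. -/
structure IsCollar (g : Metric M) (c : ℝ → M) (ν : ∀ x : M, TangentSpace (𝓡 2) x) (ε : ℝ)
    (Φ : ℝ × ℝ → M) : Prop where
  smooth : ContMDiffOn 𝓘(ℝ, ℝ × ℝ) (𝓡 2) ∞ Φ (univ ×ˢ Ioo (-ε) ε)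
  bijective_mfderiv : ∀ t : ℝ, ∀ s ∈ Ioo (-ε) ε,
    Function.Bijective (mfderiv 𝓘(ℝ, ℝ × ℝ) (𝓡 2) Φ (t, s))
  periodic : ∀ t : ℝ, ∀ s ∈ Ioo (-ε) ε, Φ (t + 1, s) = Φ (t, s)
  injective : ∀ t t' : ℝ, ∀ s ∈ Ioo (-ε) ε, ∀ s' ∈ Ioo (-ε) ε, Φ (t, s) = Φ (t', s') →
    s = s' ∧ ∃ n : ℤ, t' = t + n
  core : ∀ t : ℝ, Φ (t, 0) = c t
  inward : ∀ t : ℝ, 0 < g.inner (Φ (t, 0)) (velocity (fun s => Φ (t, s)) 0).2 (ν (Φ (t, 0)))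

/-- A neighbourhood of the wall `c` in the table is foliated by caustics of the billiard, and these
are the caustics of the trajectories forming small angles with the wall. -/
def IsFoliatedByCaustics (g : Metric M) (c : ℝ → M) (ν : ∀ x : M, TangentSpace (𝓡 2) x) : Prop :=
  ∃ ε > 0, ∃ Φ : ℝ × ℝ → M, IsCollar g c ν ε Φ ∧
    (∀ s ∈ Ioo 0 ε, IsCaustic g c ν (fun t => Φ (t, s))) ∧
    ∃ δ > 0, ∀ (N : ℕ) (T : Trajectory g c ν N), T.angle < δ →
      ∃ s ∈ Ioo 0 ε, ∀ i < N, T.TangentTo i (fun t => Φ (t, s))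

end

end GeodesicBilliard

end

/-!
Let `m` be the lowest eigenvalue of the quadratic integral `S` with respect to the metric `g`. Where
the zero directions of `S` are real and distinct, `m` is a simple eigenvalue, hence smooth, and the
bisectors of the zero directions are the eigenvectors of `S`. The wall is tangent to a continuous
field of bisectors, so that, possibly after replacing `S` by `-S`, its tangents are eigenvectors for
`m` (`IsLeaf.exists_isEigenWall`).

Since `S` is an integral, `m` is constant in the direction of its own eigenvectors (`deigen_eq_zero`);
in particular `m` is constant on the wall, with value `m₀`. Differentiating the eigenvector equation
along the wall and using the polarized Killing equation, one finds that the derivative of `m` along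
the normal `ν` is `2 k (S (ν, ν) - m)`, with `k` the geodesic curvature of the wall
(`IsEigenWall.deigen_normal`). It is nonnegative. If it vanished at one point, then the differential of
`m` would vanish there; as `m` is constant along a smooth field of eigenvectors, its differential obeys
a linear differential equation along the wall, so it would vanish on an arc of the wall, which would be
a geodesic. Hence `m` has no critical points on the wall and increases towards the table
(`IsEigenWall.deigen_normal_pos`), so a collar of the wall is foliated by closed curves `m = m₀ + s`
(`IsSimpleClosedCurve.exists_collar`), which are again tangent to the eigenvectors.

The integral of motion is the ratio `S (v, v) / g (v, v)`. It is conserved along geodesics. On the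
wall `S (v, v) - m₀ g (v, v)` is a positive multiple of `g (v, ν) ^ 2`, so the ratio is conserved by
reflections and increases with the angle (`IsEigenWall.isIntegralOfMotion`). Consider an arc on which
the ratio is `m₀ + κ` with small `κ > 0`. Since `m` is at most the ratio, the arc remains between the
wall and the curve `m = m₀ + κ`. By Rolle's theorem `m` has a critical point along the arc, where the
velocity is annihilated by the differential of `m` and so is an eigenvector; there `m` equals the
ratio, and the arc touches the curve `m = m₀ + κ` (`IsLevelCollar.exists_touching`). Conversely an arc
tangent to this curve has ratio `m₀ + κ`. Therefore these curves are caustics.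
-/

set_option linter.unusedSectionVars false

namespace GeodesicBilliard

/-! ### The lowest eigenvalue of a quadratic form -/

/-- The lower root `m` of `det (A - m G) = 0` for symmetric `2 × 2` matrices `G > 0` and `A`, given by
their entries. -/
noncomputable def lowRoot (g₁₁ g₁₂ g₂₂ a₁₁ a₁₂ a₂₂ : ℝ) : ℝ :=
  ((a₁₁ * g₂₂ + a₂₂ * g₁₁ - 2 * a₁₂ * g₁₂)
    - Real.sqrt ((a₁₁ * g₂₂ + a₂₂ * g₁₁ - 2 * a₁₂ * g₁₂) ^ 2
      - 4 * (g₁₁ * g₂₂ - g₁₂ ^ 2) * (a₁₁ * a₂₂ - a₁₂ ^ 2))) / (2 * (g₁₁ * g₂₂ - g₁₂ ^ 2))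

/-- The matrix `A - m G` for the lower root `m` is singular and positive semidefinite. -/
theorem lowRoot_spec {g₁₁ g₁₂ g₂₂ a₁₁ a₁₂ a₂₂ : ℝ} (hg : 0 < g₁₁) (hG : 0 < g₁₁ * g₂₂ - g₁₂ ^ 2) :
    let m := lowRoot g₁₁ g₁₂ g₂₂ a₁₁ a₁₂ a₂₂
    0 ≤ a₁₁ - m * g₁₁ ∧ 0 ≤ a₂₂ - m * g₂₂ ∧
      (a₁₁ - m * g₁₁) * (a₂₂ - m * g₂₂) = (a₁₂ - m * g₁₂) ^ 2 := by
  intro m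
  set G := g₁₁ * g₂₂ - g₁₂ ^ 2 with hGdef
  set T := a₁₁ * g₂₂ + a₂₂ * g₁₁ - 2 * a₁₂ * g₁₂ with hT
  set D := a₁₁ * a₂₂ - a₁₂ ^ 2 with hD
  have hg2 : 0 < g₂₂ := by
    by_contra h
    nlinarith [sq_nonneg g₁₂, mul_nonneg hg.le (neg_nonneg.2 (not_lt.1 h))]
  have hdisc : 0 ≤ T ^ 2 - 4 * G * D := by
    -- at `m = a₁₁ / g₁₁` the determinant of `A - m G` is not positive
    have h1 : g₁₁ ^ 2 * (T ^ 2 - 4 * G * D) =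
        (2 * G * a₁₁ - T * g₁₁) ^ 2 + 4 * G * (a₁₂ * g₁₁ - a₁₁ * g₁₂) ^ 2 := by
      rw [hGdef, hT, hD]; ring
    have h2 : 0 ≤ g₁₁ ^ 2 * (T ^ 2 - 4 * G * D) := by
      rw [h1]; positivity
    exact nonneg_of_mul_nonneg_right h2 (by positivity)
  have hm : 2 * G * m = T - Real.sqrt (T ^ 2 - 4 * G * D) := by
    change 2 * G * ((T - Real.sqrt (T ^ 2 - 4 * G * D)) / (2 * G)) = _
    field_simp
  have hs := Real.sq_sqrt hdisc
  set s := Real.sqrt (T ^ 2 - 4 * G * D) with hsdef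
  have hs0 : 0 ≤ s := Real.sqrt_nonneg _
  clear_value s
  have hroot : G * m ^ 2 - T * m + D = 0 := by
    have h4 : 4 * G * (G * m ^ 2 - T * m + D) = 0 := by
      have : s = T - 2 * G * m := by linarith
      rw [this] at hs
      linear_combination hs
    have : (4 * G) ≠ 0 := by positivity
    exact (mul_eq_zero.1 h4).resolve_left this
  set b₁₁ := a₁₁ - m * g₁₁ with hb11
  set b₁₂ := a₁₂ - m * g₁₂ with hb12
  set b₂₂ := a₂₂ - m * g₂₂ with hb22
  have hdet : b₁₁ * b₂₂ = b₁₂ ^ 2 := by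
    rw [hb11, hb12, hb22]; rw [hGdef, hT, hD] at hroot; linear_combination hroot
  have htr : b₁₁ * g₂₂ + b₂₂ * g₁₁ - 2 * b₁₂ * g₁₂ = s := by
    rw [hb11, hb12, hb22]; rw [hGdef, hT] at hm; linear_combination -hm
  clear_value b₁₁ b₁₂ b₂₂ G
  -- a singular `2 × 2` matrix with nonnegative trace with respect to `G` is positive semidefinite
  have key : ∀ x y z g h : ℝ, x * y = z ^ 2 → 0 < g → 0 < g * h - g₁₂ ^ 2 →
      x * h + y * g - 2 * z * g₁₂ = s → 0 ≤ x := by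
    intro x y z g h hxy hg hgh hs'
    by_contra hx
    push Not at hx
    have h1 : g * (x * s) = (g * z - x * g₁₂) ^ 2 + x ^ 2 * (g * h - g₁₂ ^ 2) := by
      rw [← hs']; linear_combination g ^ 2 * hxy
    have h2 : 0 < x ^ 2 * (g * h - g₁₂ ^ 2) := mul_pos (sq_pos_of_neg hx) hgh
    have h3 : g * (x * s) ≤ 0 :=
      mul_nonpos_of_nonneg_of_nonpos hg.le (mul_nonpos_of_nonpos_of_nonneg hx.le hs0)
    nlinarith [sq_nonneg (g * z - x * g₁₂)]
  refine ⟨key b₁₁ b₂₂ b₁₂ g₁₁ g₂₂ hdet hg (by linarith) htr,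
    key b₂₂ b₁₁ b₁₂ g₂₂ g₁₁ (by linarith) hg2 (by linarith) (by linarith), hdet⟩

/-- The `i`-th vector of the standard basis of the plane. -/
noncomputable abbrev basisVec (i : Fin 2) : Plane := EuclideanSpace.single i (1 : ℝ)

theorem plane_eq (v : Plane) : v = v 0 • basisVec 0 + v 1 • basisVec 1 := by
  ext i; fin_cases i <;> simp

theorem form_apply_eq (B : Plane →L[ℝ] Plane →L[ℝ] ℝ) (v w : Plane) :
    B v w = v 0 * w 0 * B (basisVec 0) (basisVec 0) + v 0 * w 1 * B (basisVec 0) (basisVec 1)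
      + v 1 * w 0 * B (basisVec 1) (basisVec 0) + v 1 * w 1 * B (basisVec 1) (basisVec 1) := by
  conv_lhs => rw [plane_eq v, plane_eq w]
  simp only [map_add, map_smul, add_apply, smul_apply,
    smul_eq_mul]
  ring

/-- The lowest eigenvalue of the symmetric form `A` with respect to the scalar product `G`. -/
noncomputable def lowEig (G A : Plane →L[ℝ] Plane →L[ℝ] ℝ) : ℝ :=
  lowRoot (G (basisVec 0) (basisVec 0)) (G (basisVec 0) (basisVec 1)) (G (basisVec 1) (basisVec 1))
    (A (basisVec 0) (basisVec 0)) (A (basisVec 0) (basisVec 1)) (A (basisVec 1) (basisVec 1))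

section

variable {G A : Plane →L[ℝ] Plane →L[ℝ] ℝ}

theorem gram_pos (hG : ∀ v w, G v w = G w v) (hpos : ∀ v, v ≠ 0 → 0 < G v v) :
    0 < G (basisVec 0) (basisVec 0) * G (basisVec 1) (basisVec 1)
      - G (basisVec 0) (basisVec 1) ^ 2 := by
  have h0 : 0 < G (basisVec 0) (basisVec 0) := hpos _ (by simp)
  have h1 := hpos (G (basisVec 0) (basisVec 0) • basisVec 1 - G (basisVec 0) (basisVec 1) • basisVec 0)
    (by
      intro h
      have := congrArg (fun v : Plane => v 1) h
      simp at this
      simp [this] at h0)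
  simp only [map_sub, map_smul, sub_apply, smul_apply,
    smul_eq_mul, hG (basisVec 1) (basisVec 0)] at h1
  have h2 : 0 < G (basisVec 0) (basisVec 0) * (G (basisVec 0) (basisVec 0) * G (basisVec 1) (basisVec 1)
      - G (basisVec 0) (basisVec 1) ^ 2) := by linarith
  exact pos_of_mul_pos_right h2 h0.le

theorem lowEig_mul_le (hG : ∀ v w, G v w = G w v) (hpos : ∀ v, v ≠ 0 → 0 < G v v)
    (hA : ∀ v w, A v w = A w v) (v : Plane) : lowEig G A * G v v ≤ A v v := by
  obtain ⟨h1, h2, h3⟩ := lowRoot_spec (a₁₁ := A (basisVec 0) (basisVec 0))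
    (a₁₂ := A (basisVec 0) (basisVec 1)) (a₂₂ := A (basisVec 1) (basisVec 1))
    (hpos (basisVec 0) (by simp)) (gram_pos hG hpos)
  change 0 ≤ _ - lowEig G A * _ at h1
  change 0 ≤ _ - lowEig G A * _ at h2
  change (_ - lowEig G A * _) * (_ - lowEig G A * _) = (_ - lowEig G A * _) ^ 2 at h3
  rw [form_apply_eq G, form_apply_eq A, hG (basisVec 1) (basisVec 0), hA (basisVec 1) (basisVec 0)]
  generalize lowEig G A = m at *
  set p := A (basisVec 0) (basisVec 0) - m * G (basisVec 0) (basisVec 0) with hp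
  set q := A (basisVec 0) (basisVec 1) - m * G (basisVec 0) (basisVec 1) with hq
  set r := A (basisVec 1) (basisVec 1) - m * G (basisVec 1) (basisVec 1) with hr
  have key : 0 ≤ v 0 ^ 2 * p + 2 * (v 0 * v 1) * q + v 1 ^ 2 * r := by
    rcases h1.eq_or_lt with h | h
    · rw [← h] at h3 ⊢
      have : q = 0 := by
        have : q ^ 2 = 0 := by rw [← h3]; ring
        exact pow_eq_zero_iff (two_ne_zero) |>.1 this
      rw [this]; nlinarith [sq_nonneg (v 1)]
    · have : 0 ≤ p * (v 0 ^ 2 * p + 2 * (v 0 * v 1) * q + v 1 ^ 2 * r) := by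
        have : p * (v 0 ^ 2 * p + 2 * (v 0 * v 1) * q + v 1 ^ 2 * r) = (v 0 * p + v 1 * q) ^ 2 := by
          linear_combination v 1 ^ 2 * h3
        rw [this]; positivity
      exact nonneg_of_mul_nonneg_right this h
  rw [hp, hq, hr] at key
  linarith

theorem exists_lowEig_eq (hG : ∀ v w, G v w = G w v) (hpos : ∀ v, v ≠ 0 → 0 < G v v)
    (hA : ∀ v w, A v w = A w v) : ∃ v : Plane, v ≠ 0 ∧ A v v = lowEig G A * G v v := by
  obtain ⟨-, -, h3⟩ := lowRoot_spec (a₁₁ := A (basisVec 0) (basisVec 0))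
    (a₁₂ := A (basisVec 0) (basisVec 1)) (a₂₂ := A (basisVec 1) (basisVec 1))
    (hpos (basisVec 0) (by simp)) (gram_pos hG hpos)
  change (_ - lowEig G A * _) * (_ - lowEig G A * _) = (_ - lowEig G A * _) ^ 2 at h3
  generalize lowEig G A = m at *
  by_cases hp : A (basisVec 0) (basisVec 0) - m * G (basisVec 0) (basisVec 0) = 0
  · exact ⟨basisVec 0, by simp, by linarith⟩
  · refine ⟨-(A (basisVec 0) (basisVec 1) - m * G (basisVec 0) (basisVec 1)) • basisVec 0
      + (A (basisVec 0) (basisVec 0) - m * G (basisVec 0) (basisVec 0)) • basisVec 1, ?_, ?_⟩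
    · intro h
      have := congrArg (fun v : Plane => v 1) h
      simp at this
      exact hp this
    · simp only [map_add, map_smul, add_apply, smul_apply,
        smul_eq_mul, hG (basisVec 1) (basisVec 0), hA (basisVec 1) (basisVec 0)]
      linear_combination (A (basisVec 0) (basisVec 0) - m * G (basisVec 0) (basisVec 0)) * h3

theorem eq_lowEig (hG : ∀ v w, G v w = G w v) (hpos : ∀ v, v ≠ 0 → 0 < G v v)
    (hA : ∀ v w, A v w = A w v) {m : ℝ} (hle : ∀ v, m * G v v ≤ A v v)
    (hex : ∃ v, v ≠ 0 ∧ A v v = m * G v v) : m = lowEig G A := by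
  obtain ⟨v, hv, hv'⟩ := hex
  obtain ⟨w, hw, hw'⟩ := exists_lowEig_eq hG hpos hA
  have h1 := lowEig_mul_le hG hpos hA v
  have h2 := hle w
  rw [hv'] at h1
  rw [hw'] at h2
  exact le_antisymm (le_of_mul_le_mul_right h2 (hpos w hw)) (le_of_mul_le_mul_right h1 (hpos v hv))

theorem exists_smul_add_of_linearIndependent {ξ η : Plane} (hli : LinearIndependent ℝ ![ξ, η])
    (v : Plane) : ∃ a b : ℝ, v = a • ξ + b • η := by
  have hb := hli.span_eq_top_of_card_eq_finrank (by simp)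
  have : v ∈ Submodule.span ℝ (range ![ξ, η]) := by rw [hb]; trivial
  rw [Matrix.range_cons, Matrix.range_cons, Matrix.range_empty, union_empty,
    singleton_union, Submodule.mem_span_pair] at this
  obtain ⟨a, b, h⟩ := this
  exact ⟨a, b, h.symm⟩

/-- A form with two distinct zero directions that does not vanish has negative determinant. -/
theorem det_neg_of_zero_directions (hA : ∀ v w, A v w = A w v) (hA0 : A ≠ 0) {ξ η : Plane}
    (hli : LinearIndependent ℝ ![ξ, η]) (hξ : A ξ ξ = 0) (hη : A η η = 0) :
    A (basisVec 0) (basisVec 0) * A (basisVec 1) (basisVec 1)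
      - A (basisVec 0) (basisVec 1) ^ 2 < 0 := by
  have hne : A ξ η ≠ 0 := by
    intro h0
    apply hA0
    ext v w
    obtain ⟨a, b, rfl⟩ := exists_smul_add_of_linearIndependent hli v
    obtain ⟨a', b', rfl⟩ := exists_smul_add_of_linearIndependent hli w
    simp [hξ, hη, h0, hA η ξ]
  have hdet : (A (basisVec 0) (basisVec 0) * A (basisVec 1) (basisVec 1)
      - A (basisVec 0) (basisVec 1) ^ 2) * (ξ 0 * η 1 - ξ 1 * η 0) ^ 2 = - (A ξ η) ^ 2 := by
    have e : (A (basisVec 0) (basisVec 0) * A (basisVec 1) (basisVec 1)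
      - A (basisVec 0) (basisVec 1) ^ 2) * (ξ 0 * η 1 - ξ 1 * η 0) ^ 2
        = A ξ ξ * A η η - (A ξ η) ^ 2 := by
      rw [form_apply_eq A ξ ξ, form_apply_eq A η η, form_apply_eq A ξ η, hA (basisVec 1) (basisVec 0)]
      ring
    rw [e, hξ]; ring
  have : 0 < (A ξ η) ^ 2 := by positivity
  by_contra h
  push Not at h
  nlinarith [mul_nonneg h (sq_nonneg (ξ 0 * η 1 - ξ 1 * η 0))]

end

/-- The lowest eigenvalue of an indefinite form depends smoothly on the form and on the scalar
product. -/
theorem contDiffAt_lowEig {n : WithTop ℕ∞} {W : Type*} [NormedAddCommGroup W] [NormedSpace ℝ W]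
    {G A : W → Plane →L[ℝ] Plane →L[ℝ] ℝ} {y : W} (hG : ContDiffAt ℝ n G y)
    (hA : ContDiffAt ℝ n A y)
    (hdet : 0 < G y (basisVec 0) (basisVec 0) * G y (basisVec 1) (basisVec 1)
      - G y (basisVec 0) (basisVec 1) ^ 2)
    (hneg : A y (basisVec 0) (basisVec 0) * A y (basisVec 1) (basisVec 1)
      - A y (basisVec 0) (basisVec 1) ^ 2 < 0) :
    ContDiffAt ℝ n (fun z => lowEig (G z) (A z)) y := by
  have hGi : ∀ i j, ContDiffAt ℝ n (fun z => G z (basisVec i) (basisVec j)) y := fun i j =>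
    (hG.clm_apply contDiffAt_const).clm_apply contDiffAt_const
  have hAi : ∀ i j, ContDiffAt ℝ n (fun z => A z (basisVec i) (basisVec j)) y := fun i j =>
    (hA.clm_apply contDiffAt_const).clm_apply contDiffAt_const
  have hT := (((hAi 0 0).mul (hGi 1 1)).add ((hAi 1 1).mul (hGi 0 0))).sub
    ((contDiffAt_const (c := (2 : ℝ))).mul (hAi 0 1) |>.mul (hGi 0 1))
  have hD := ((hGi 0 0).mul (hGi 1 1)).sub ((hGi 0 1).pow 2)
  have hA' := ((hAi 0 0).mul (hAi 1 1)).sub ((hAi 0 1).pow 2)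
  unfold lowEig lowRoot
  -- where `A` is indefinite the discriminant is positive, so that the square root is smooth
  refine (hT.sub (ContDiffAt.sqrt ((hT.pow 2).sub
    (((contDiffAt_const (c := (4 : ℝ))).mul hD).mul hA')) ?_)).div
      ((contDiffAt_const (c := (2 : ℝ))).mul hD) ?_
  · apply ne_of_gt
    nlinarith [mul_pos hdet (neg_pos.2 hneg), sq_nonneg
      (A y (basisVec 0) (basisVec 0) * G y (basisVec 1) (basisVec 1)
        + A y (basisVec 1) (basisVec 1) * G y (basisVec 0) (basisVec 0)
        - 2 * A y (basisVec 0) (basisVec 1) * G y (basisVec 0) (basisVec 1))]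
  · exact ne_of_gt (by linarith)

/-- A positive semidefinite form vanishes on a vector if its quadratic form does. -/
theorem apply_eq_zero_of_nonneg {A : Plane →L[ℝ] Plane →L[ℝ] ℝ} (hA : ∀ v w, A v w = A w v)
    (hnn : ∀ v, 0 ≤ A v v) {v : Plane} (hv : A v v = 0) (w : Plane) : A v w = 0 := by
  have key : ∀ r : ℝ, 0 ≤ 2 * r * A v w + A w w * r ^ 2 := by
    intro r
    have := hnn (v + r • w)
    simp only [map_add, map_smul, add_apply, smul_apply,
      smul_eq_mul, hv, hA w v] at this
    nlinarith
  have hw := hnn w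
  by_contra hne
  -- the `+ 1` keeps the denominator positive when `A w w = 0`
  have h1 := key (-(A v w) / (A w w + 1))
  have h2 : 0 < A w w + 1 := by linarith
  have h3 : 0 < (A v w) ^ 2 := by positivity
  have h4 : 2 * (-(A v w) / (A w w + 1)) * A v w + A w w * (-(A v w) / (A w w + 1)) ^ 2
      = -((A v w) ^ 2 * (A w w + 2)) / (A w w + 1) ^ 2 := by
    field_simp; ring
  rw [h4] at h1
  have : -((A v w) ^ 2 * (A w w + 2)) / (A w w + 1) ^ 2 < 0 :=
    div_neg_of_neg_of_pos (by nlinarith) (by positivity)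
  linarith

section
variable {M : Type*} [TopologicalSpace M] [ChartedSpace Plane M]

/-! ### Quadratic fields in charts -/

/-- The expression of a field of bilinear forms in the chart `e`, as a map to the bilinear forms on
the plane. -/
noncomputable def chartForm (B : ∀ x : M, TangentSpace (𝓡 2) x →L[ℝ] TangentSpace (𝓡 2) x →L[ℝ] ℝ)
    (e : OpenPartialHomeomorph M Plane) (y : Plane) : Plane →L[ℝ] Plane →L[ℝ] ℝ :=
  ContinuousLinearMap.bilinearComp (show Plane →L[ℝ] Plane →L[ℝ] ℝ from B (e.symm y))
    (show Plane →L[ℝ] Plane from mfderiv (𝓡 2) (𝓡 2) e.symm y)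
    (show Plane →L[ℝ] Plane from mfderiv (𝓡 2) (𝓡 2) e.symm y)

theorem localForm_eq_chartForm
    (B : ∀ x : M, TangentSpace (𝓡 2) x →L[ℝ] TangentSpace (𝓡 2) x →L[ℝ] ℝ)
    (e : OpenPartialHomeomorph M Plane) (v w : Plane) :
    localForm B e v w = fun y => chartForm B e y v w := rfl

variable [IsManifold (𝓡 2) ∞ M]

/-- A Riemannian metric, as a quadratic field. -/
def metricField (g : Metric M) : QuadraticField M where
  form := g.inner
  symm := g.symm
  contMDiff := g.contMDiff

/-- A quadratic field evaluated on two smooth vector fields along a map is smooth. -/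
theorem contMDiffAt_apply_bundle (S : QuadraticField M) {N : Type*} {EN : Type*}
    [NormedAddCommGroup EN] [NormedSpace ℝ EN] {HN : Type*} [TopologicalSpace HN]
    {IN : ModelWithCorners ℝ EN HN} [TopologicalSpace N] [ChartedSpace HN N]
    {b : N → M} {v w : ∀ p, TangentSpace (𝓡 2) (b p)} {p : N}
    (hv : ContMDiffAt IN (𝓡 2).tangent ∞ (fun q => (⟨b q, v q⟩ : TangentBundle (𝓡 2) M)) p)
    (hw : ContMDiffAt IN (𝓡 2).tangent ∞ (fun q => (⟨b q, w q⟩ : TangentBundle (𝓡 2) M)) p) :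
    ContMDiffAt IN 𝓘(ℝ, ℝ) ∞ (fun q => S.form (b q) (v q) (w q)) p := by
  have hb : ContMDiffAt IN (𝓡 2) ∞ b p := (Bundle.contMDiffAt_totalSpace.1 hv).1
  have : ContMDiffAt IN ((𝓡 2).prod 𝓘(ℝ)) ∞
      (fun m ↦ Bundle.TotalSpace.mk' ℝ (E := Bundle.Trivial M ℝ) (b m)
        (S.form (b m) (v m) (w m))) p := by
    apply ContMDiffAt.clm_bundle_apply₂ (F₁ := Plane) (F₂ := Plane)
    · exact ContMDiffAt.comp p S.contMDiff.contMDiffAt hb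
    · exact hv
    · exact hw
  exact (Bundle.contMDiffAt_totalSpace.1 this).2

/-- A quadratic field is a smooth function on the tangent bundle. -/
theorem contMDiff_quadratic (S : QuadraticField M) :
    ContMDiff (𝓡 2).tangent 𝓘(ℝ, ℝ) ∞
      (fun z : TangentBundle (𝓡 2) M => S.form z.1 z.2 z.2) := fun _ =>
  contMDiffAt_apply_bundle S (b := fun z : TangentBundle (𝓡 2) M => z.1) (v := fun z => z.2)
    (w := fun z => z.2) contMDiffAt_id contMDiffAt_id

theorem chartForm_symm (S : QuadraticField M) (e : OpenPartialHomeomorph M Plane) (y v w : Plane) :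
    chartForm S.form e y v w = chartForm S.form e y w v :=
  S.symm _ _ _

section chart

variable {e : OpenPartialHomeomorph M Plane} (he : e ∈ IsManifold.maximalAtlas (𝓡 2) ∞ M)
include he

theorem mdifferentiable_of_mem_maximalAtlas : e.MDifferentiable (𝓡 2) (𝓡 2) :=
  ⟨(contMDiffOn_of_mem_maximalAtlas he).mdifferentiableOn (by simp),
    (contMDiffOn_symm_of_mem_maximalAtlas he).mdifferentiableOn (by simp)⟩

theorem mfderiv_symm_mfderiv {x : M} (hx : x ∈ e.source) (v : TangentSpace (𝓡 2) x) :
    mfderiv (𝓡 2) (𝓡 2) e.symm (e x) (mfderiv (𝓡 2) (𝓡 2) e x v) = v := by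
  have := (mdifferentiable_of_mem_maximalAtlas he).symm_comp_deriv hx
  exact congrArg (fun f => f v) this

theorem mfderiv_symm_injective {y : Plane} (hy : y ∈ e.target) :
    Function.Injective (mfderiv (𝓡 2) (𝓡 2) e.symm y) :=
  (mdifferentiable_of_mem_maximalAtlas he).symm.mfderiv_injective hy

theorem mfderiv_mfderiv_symm {x : M} (hx : x ∈ e.source) (v : Plane) :
    mfderiv (𝓡 2) (𝓡 2) e x (mfderiv (𝓡 2) (𝓡 2) e.symm (e x) v) = v := by
  apply mfderiv_symm_injective he (e.map_source hx)
  exact mfderiv_symm_mfderiv he hx (show Plane from mfderiv (𝓡 2) (𝓡 2) e.symm (e x) v)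

theorem mfderiv_symm_surjective {y : Plane} (hy : y ∈ e.target) :
    Function.Surjective (mfderiv (𝓡 2) (𝓡 2) e.symm y) :=
  (mdifferentiable_of_mem_maximalAtlas he).symm.mfderiv_surjective hy

theorem chartForm_mfderiv (S : QuadraticField M) {x : M} (hx : x ∈ e.source)
    (v w : TangentSpace (𝓡 2) x) :
    chartForm S.form e (e x) (mfderiv (𝓡 2) (𝓡 2) e x v) (mfderiv (𝓡 2) (𝓡 2) e x w)
      = S.form x v w := by
  change S.form (e.symm (e x)) (mfderiv (𝓡 2) (𝓡 2) e.symm (e x) (mfderiv (𝓡 2) (𝓡 2) e x v))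
    (mfderiv (𝓡 2) (𝓡 2) e.symm (e x) (mfderiv (𝓡 2) (𝓡 2) e x w)) = _
  rw [mfderiv_symm_mfderiv he hx, mfderiv_symm_mfderiv he hx, e.left_inv hx]

theorem chartForm_pos (g : Metric M) {y : Plane} (hy : y ∈ e.target) (v : Plane) (hv : v ≠ 0) :
    0 < chartForm (metricField g).form e y v v := by
  refine g.pos (e.symm y) _ fun h => hv ?_
  exact mfderiv_symm_injective he hy (h.trans (map_zero _).symm)

theorem contDiffOn_chartForm (S : QuadraticField M) :
    ContDiffOn ℝ ∞ (chartForm S.form e) e.target := by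
  have hsm : ContMDiffOn (𝓡 2) (𝓡 2) ∞ e.symm e.target := contMDiffOn_symm_of_mem_maximalAtlas he
  have hvec : ∀ v : Plane, ∀ y ∈ e.target, ContMDiffAt (𝓡 2) (𝓡 2).tangent ∞
      (fun y : Plane => (⟨e.symm y, mfderiv (𝓡 2) (𝓡 2) e.symm y v⟩ : TangentBundle (𝓡 2) M)) y := by
    intro v y hy
    have h1 := hsm.contMDiffOn_tangentMapWithin (m := ∞) (by simp) e.open_target.uniqueMDiffOn
    have h2 : ContMDiffOn (𝓡 2) (𝓡 2).tangent ∞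
        (fun y : Plane => (⟨y, v⟩ : TangentBundle (𝓡 2) Plane)) e.target := fun y _ =>
      contMDiffWithinAt_vectorSpace_iff_contDiffWithinAt.2 contDiffWithinAt_const
    have h3 := h1.comp h2 (fun y hy => hy)
    refine (h3.congr fun y hy => ?_).contMDiffAt (e.open_target.mem_nhds hy)
    simp only [Function.comp_apply, tangentMapWithin]
    rw [mfderivWithin_of_isOpen e.open_target hy]
  rw [contDiffOn_clm_apply]
  intro v
  rw [contDiffOn_clm_apply]
  intro w y hy
  exact (contMDiffAt_apply_bundle S (hvec v y hy) (hvec w y hy)).contDiffAt.contDiffWithinAt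

theorem contDiffAt_chartForm (S : QuadraticField M) {y : Plane} (hy : y ∈ e.target) :
    ContDiffAt ℝ ∞ (chartForm S.form e) y :=
  (contDiffOn_chartForm he S).contDiffAt (e.open_target.mem_nhds hy)

theorem differentiableAt_chartForm (S : QuadraticField M) {y : Plane} (hy : y ∈ e.target) :
    DifferentiableAt ℝ (chartForm S.form e) y :=
  (contDiffAt_chartForm he S hy).differentiableAt (by simp)

theorem fderiv_localForm (S : QuadraticField M) {y : Plane} (hy : y ∈ e.target) (v w z : Plane) :
    fderiv ℝ (localForm S.form e v w) y z = fderiv ℝ (chartForm S.form e) y z v w := by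
  rw [localForm_eq_chartForm]
  have h := (differentiableAt_chartForm he S hy).hasFDerivAt
  have h2 := (h.clm_apply (hasFDerivAt_const v y)).clm_apply (hasFDerivAt_const w y)
  rw [h2.fderiv]
  simp

end chart

theorem chartAt_mem (x : M) : chartAt Plane x ∈ IsManifold.maximalAtlas (𝓡 2) ∞ M :=
  IsManifold.chart_mem_maximalAtlas x

/-! ### The lowest eigenvalue of a quadratic field -/

/-- The lowest eigenvalue of the form `S` with respect to the metric, as a function on the surface.
It is computed in the components of tangent vectors that identify `TangentSpace (𝓡 2) x` with the
plane; by `eigen_mul_le` and `exists_eigen_eq` it does not depend on them. -/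
noncomputable def eigen (g : Metric M) (S : QuadraticField M) (x : M) : ℝ :=
  lowEig (show Plane →L[ℝ] Plane →L[ℝ] ℝ from g.inner x)
    (show Plane →L[ℝ] Plane →L[ℝ] ℝ from S.form x)

theorem eigen_mul_le (g : Metric M) (S : QuadraticField M) (x : M) (v : TangentSpace (𝓡 2) x) :
    eigen g S x * g.inner x v v ≤ S.form x v v :=
  lowEig_mul_le (G := g.inner x) (A := S.form x) (g.symm x) (g.pos x) (S.symm x) v

theorem exists_eigen_eq (g : Metric M) (S : QuadraticField M) (x : M) :
    ∃ v : TangentSpace (𝓡 2) x, v ≠ 0 ∧ S.form x v v = eigen g S x * g.inner x v v :=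
  exists_lowEig_eq (G := g.inner x) (A := S.form x) (g.symm x) (g.pos x) (S.symm x)

theorem eigen_symm_eq (g : Metric M) (S : QuadraticField M) {e : OpenPartialHomeomorph M Plane}
    (he : e ∈ IsManifold.maximalAtlas (𝓡 2) ∞ M) {y : Plane} (hy : y ∈ e.target) :
    eigen g S (e.symm y) = lowEig (chartForm (metricField g).form e y) (chartForm S.form e y) := by
  apply eq_lowEig (chartForm_symm (metricField g) e y) (chartForm_pos he g hy) (chartForm_symm S e y)
  · intro v
    exact eigen_mul_le g S (e.symm y) _
  · obtain ⟨v, hv, hv'⟩ := exists_eigen_eq g S (e.symm y)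
    obtain ⟨w, rfl⟩ := mfderiv_symm_surjective he hy v
    refine ⟨w, ?_, hv'⟩
    rintro rfl
    exact hv (map_zero _)

theorem HasRealZeroDirections.chartForm_det_neg {S : QuadraticField M}
    {e : OpenPartialHomeomorph M Plane} (he : e ∈ IsManifold.maximalAtlas (𝓡 2) ∞ M) {y : Plane}
    (hy : y ∈ e.target) (h : HasRealZeroDirections S (e.symm y)) :
    chartForm S.form e y (basisVec 0) (basisVec 0) * chartForm S.form e y (basisVec 1) (basisVec 1)
      - chartForm S.form e y (basisVec 0) (basisVec 1) ^ 2 < 0 := by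
  obtain ⟨h0, ξ, η, hli, hξ, hη⟩ := h
  obtain ⟨ξ, rfl⟩ := mfderiv_symm_surjective he hy ξ
  obtain ⟨η, rfl⟩ := mfderiv_symm_surjective he hy η
  refine det_neg_of_zero_directions (chartForm_symm S e y) (fun h => h0 ?_) (ξ := ξ) (η := η) ?_ hξ hη
  · ext v w
    obtain ⟨v, rfl⟩ := mfderiv_symm_surjective he hy v
    obtain ⟨w, rfl⟩ := mfderiv_symm_surjective he hy w
    exact congrArg (fun f : Plane →L[ℝ] Plane →L[ℝ] ℝ => f v w) h
  · rw [LinearIndependent.pair_iff] at hli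
    refine (LinearIndependent.pair_iff (M := Plane)).2 fun s t hst => ?_
    refine hli s t ?_
    have := congrArg (mfderiv (𝓡 2) (𝓡 2) e.symm y) hst
    refine Eq.trans ?_ (this.trans (map_zero _))
    exact ((map_add _ _ _).trans (congrArg₂ _ (map_smul _ _ _) (map_smul _ _ _))).symm

/-- The lowest eigenvalue in a chart is smooth where the form is indefinite. -/
theorem contDiffAt_eigen_chart (g : Metric M) {S : QuadraticField M}
    {e : OpenPartialHomeomorph M Plane} (he : e ∈ IsManifold.maximalAtlas (𝓡 2) ∞ M) {y : Plane}
    (hy : y ∈ e.target) (h : HasRealZeroDirections S (e.symm y)) :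
    ContDiffAt ℝ ∞ (fun z => eigen g S (e.symm z)) y := by
  have h1 := contDiffAt_lowEig (contDiffAt_chartForm he (metricField g) hy)
    (contDiffAt_chartForm he S hy)
    (gram_pos (chartForm_symm (metricField g) e y) (chartForm_pos he g hy))
    (h.chartForm_det_neg he hy)
  refine h1.congr_of_eventuallyEq ?_
  filter_upwards [e.open_target.mem_nhds hy] with z hz
  exact eigen_symm_eq g S he hz

theorem contMDiffAt_eigen (g : Metric M) {S : QuadraticField M} {x : M}
    (h : HasRealZeroDirections S x) : ContMDiffAt (𝓡 2) 𝓘(ℝ, ℝ) ∞ (eigen g S) x := by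
  have he := chartAt_mem x
  have hx := mem_chart_source Plane x
  have hy := mem_chart_target Plane x
  have h1 := contDiffAt_eigen_chart g (S := S) he hy (by rwa [(chartAt Plane x).left_inv hx])
  have h2 : ContMDiffAt (𝓡 2) 𝓘(ℝ, ℝ) ∞
      ((fun z => eigen g S ((chartAt Plane x).symm z)) ∘ chartAt Plane x) x :=
    h1.contMDiffAt.comp x (contMDiffAt_of_mem_maximalAtlas he hx)
  refine h2.congr_of_eventuallyEq ?_
  filter_upwards [(chartAt Plane x).open_source.mem_nhds hx] with z hz
  simp [(chartAt Plane x).left_inv hz]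

end
section
variable {M : Type*} [TopologicalSpace M] [ChartedSpace Plane M] [IsManifold (𝓡 2) ∞ M]

/-! ### Conservation along geodesics -/

/-- A scalar product represents every linear function. -/
theorem exists_representing {G : Plane →L[ℝ] Plane →L[ℝ] ℝ} (hpos : ∀ v, v ≠ 0 → 0 < G v v)
    (ℓ : Plane →ₗ[ℝ] ℝ) : ∃ b : Plane, ∀ w, G b w = ℓ w := by
  let T : Plane →ₗ[ℝ] Module.Dual ℝ Plane :=
    { toFun := fun v => (G v : Plane →ₗ[ℝ] ℝ)
      map_add' := fun v w => by ext; simp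
      map_smul' := fun r v => by ext; simp }
  have hinj : Function.Injective T := by
    refine (injective_iff_map_eq_zero T).2 fun v hv => ?_
    by_contra h
    have := congrArg (fun f : Module.Dual ℝ Plane => f v) hv
    exact (hpos v h).ne' this
  have hsurj : Function.Surjective T :=
    (LinearMap.injective_iff_surjective_of_finrank_eq_finrank
      (Subspace.dual_finrank_eq (K := ℝ) (V := Plane)).symm).1 hinj
  obtain ⟨b, hb⟩ := hsurj ℓ
  exact ⟨b, fun w => congrArg (fun f : Module.Dual ℝ Plane => f w) hb⟩

/-- The velocity of a curve, as a vector in the tangent plane at the point of the curve. -/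
noncomputable abbrev vel (γ : ℝ → M) (t : ℝ) : TangentSpace (𝓡 2) (γ t) :=
  mfderiv 𝓘(ℝ, ℝ) (𝓡 2) γ t (1 : ℝ)

section chart

variable {e : OpenPartialHomeomorph M Plane} (he : e ∈ IsManifold.maximalAtlas (𝓡 2) ∞ M)
include he

theorem fderiv_chartForm_symm (S : QuadraticField M) {y : Plane} (hy : y ∈ e.target)
    (z v w : Plane) :
    fderiv ℝ (chartForm S.form e) y z v w = fderiv ℝ (chartForm S.form e) y z w v := by
  rw [← fderiv_localForm he S hy, ← fderiv_localForm he S hy]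
  congr 2
  ext x
  exact chartForm_symm S e x v w

theorem covAcc_eq (g : Metric M) {y : Plane} (hy : y ∈ e.target) (v a w : Plane) :
    covAcc g e y v a w = chartForm (metricField g).form e y a w
      + fderiv ℝ (chartForm (metricField g).form e) y v v w
      - (1 / 2) * fderiv ℝ (chartForm (metricField g).form e) y w v v := by
  unfold covAcc
  rw [← fderiv_localForm he (metricField g) hy, ← fderiv_localForm he (metricField g) hy]
  rfl

/-- The metric is a quadratic integral, in a chart. -/
theorem fderiv_metric_of_covAcc_eq_zero (g : Metric M) {y : Plane} (hy : y ∈ e.target)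
    {v a : Plane} (h : ∀ w, covAcc g e y v a w = 0) :
    fderiv ℝ (chartForm (metricField g).form e) y v v v
      + 2 * chartForm (metricField g).form e y a v = 0 := by
  have := h v
  rw [covAcc_eq he g hy] at this
  linarith

theorem IsFirstIntegral.fderiv_chartForm {g : Metric M} {S : QuadraticField M}
    (hS : IsFirstIntegral g S) {y : Plane} (hy : y ∈ e.target)
    {v a : Plane} (h : ∀ w, covAcc g e y v a w = 0) :
    fderiv ℝ (chartForm S.form e) y v v v + 2 * chartForm S.form e y a v = 0 := by
  have := hS e he y hy v a h
  rwa [fderiv_localForm he S hy] at this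

/-- The velocity of a curve is computed in a chart. -/
theorem mfderiv_symm_deriv {γ : ℝ → M} {t : ℝ} (hγ : MDifferentiableAt 𝓘(ℝ, ℝ) (𝓡 2) γ t)
    (ht : γ t ∈ e.source) :
    mfderiv (𝓡 2) (𝓡 2) e (γ t) (vel γ t) = deriv (e ∘ γ) t := by
  have h1 := (mdifferentiable_of_mem_maximalAtlas he).mdifferentiableAt ht
  have h2 := mfderiv_comp t h1 hγ
  rw [mfderiv_eq_fderiv] at h2
  have h3 := congrArg (fun f : ℝ →L[ℝ] Plane => f 1) h2
  exact h3.symm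

theorem chartForm_deriv (S : QuadraticField M) {γ : ℝ → M} {t : ℝ}
    (hγ : MDifferentiableAt 𝓘(ℝ, ℝ) (𝓡 2) γ t) (ht : γ t ∈ e.source) :
    chartForm S.form e (e (γ t)) (deriv (e ∘ γ) t) (deriv (e ∘ γ) t)
      = S.form (γ t) (vel γ t) (vel γ t) := by
  rw [← chartForm_mfderiv he S ht, mfderiv_symm_deriv he hγ ht]

theorem contDiffAt_chart_comp {n : WithTop ℕ∞} (hn : n ≤ ∞) {γ : ℝ → M} {t : ℝ}
    (hγ : ContMDiffAt 𝓘(ℝ, ℝ) (𝓡 2) n γ t)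
    (ht : γ t ∈ e.source) : ContDiffAt ℝ n (e ∘ γ) t :=
  (((contMDiffAt_of_mem_maximalAtlas he ht).of_le hn).comp t hγ).contDiffAt

theorem hasDerivAt_deriv_chart {γ : ℝ → M} {t : ℝ} (hγ : ContMDiffAt 𝓘(ℝ, ℝ) (𝓡 2) ∞ γ t)
    (ht : γ t ∈ e.source) :
    HasDerivAt (e ∘ γ) (deriv (e ∘ γ) t) t ∧
      HasDerivAt (deriv (e ∘ γ)) (deriv (deriv (e ∘ γ)) t) t := by
  have h1 := contDiffAt_chart_comp he le_rfl hγ ht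
  exact ⟨(h1.differentiableAt (by simp)).hasDerivAt,
    ((h1.derivWithin (m := ∞) (by simp)).differentiableAt (by simp)).hasDerivAt⟩

end chart

theorem deriv_form_chart {e : OpenPartialHomeomorph M Plane}
    (he : e ∈ IsManifold.maximalAtlas (𝓡 2) ∞ M) (S : QuadraticField M) {u p q : ℝ → Plane}
    {u' p' q' : Plane} {t : ℝ} (ht : u t ∈ e.target) (hu : HasDerivAt u u' t)
    (hp : HasDerivAt p p' t) (hq : HasDerivAt q q' t) :
    HasDerivAt (fun τ => chartForm S.form e (u τ) (p τ) (q τ))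
      (fderiv ℝ (chartForm S.form e) (u t) u' (p t) (q t) + chartForm S.form e (u t) p' (q t)
        + chartForm S.form e (u t) (p t) q') t := by
  have h : HasDerivAt (fun τ => chartForm S.form e (u τ))
      (fderiv ℝ (chartForm S.form e) (u t) u') t :=
    HasFDerivAt.comp_hasDerivAt (F := Plane) (E := Plane →L[ℝ] Plane →L[ℝ] ℝ) t
      (differentiableAt_chartForm he S ht).hasFDerivAt hu
  simpa using (h.clm_apply hp).clm_apply hq

/-- The value of a quadratic integral on the velocity of a geodesic is constant. -/
theorem IsGeodesicOn.hasDerivAt_integral {g : Metric M} {S : QuadraticField M}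
    (hS : ∀ e ∈ IsManifold.maximalAtlas (𝓡 2) ∞ M, ∀ y ∈ e.target, ∀ v a : Plane,
      (∀ w, covAcc g e y v a w = 0) →
        fderiv ℝ (chartForm S.form e) y v v v + 2 * chartForm S.form e y a v = 0)
    {γ : ℝ → M} {J : Set ℝ} (hγ : IsGeodesicOn g γ J) {t : ℝ} (ht : t ∈ J) :
    HasDerivAt (fun τ => S.form (γ τ) (vel γ τ) (vel γ τ)) 0 t := by
  obtain ⟨hsm, hgeo⟩ := hγ t ht
  have he := chartAt_mem (γ t)
  set e := chartAt Plane (γ t) with hedef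
  have hx : γ t ∈ e.source := mem_chart_source Plane (γ t)
  obtain ⟨h1, h2⟩ := hasDerivAt_deriv_chart he hsm hx
  have h3 := deriv_form_chart he S (e.map_source hx) h1 h2 h2
  have h4 := hS e he (e (γ t)) (e.map_source hx) _ _ (hgeo e he hx)
  have h5 : HasDerivAt (fun τ => chartForm S.form e ((e ∘ γ) τ) (deriv (e ∘ γ) τ)
      (deriv (e ∘ γ) τ)) 0 t := by
    convert h3 using 1
    rw [chartForm_symm S e _ (deriv (e ∘ γ) t) (deriv (deriv (e ∘ γ)) t)]
    simp only [Function.comp_apply]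
    linarith
  refine h5.congr_of_eventuallyEq ?_
  have h6 : ∀ᶠ τ in nhds t, ContMDiffAt 𝓘(ℝ, ℝ) (𝓡 2) 1 γ τ :=
    contMDiffAt_iff_contMDiffAt_nhds (by simp) |>.1 (hsm.of_le (n := ∞) (by simp))
  filter_upwards [h6, hsm.continuousAt.preimage_mem_nhds (e.open_source.mem_nhds hx)] with τ hτ hτ'
  exact (chartForm_deriv he S (hτ.mdifferentiableAt (by simp)) hτ').symm

theorem IsGeodesicOn.integral_eq {g : Metric M} {S : QuadraticField M}
    (hS : ∀ e ∈ IsManifold.maximalAtlas (𝓡 2) ∞ M, ∀ y ∈ e.target, ∀ v a : Plane,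
      (∀ w, covAcc g e y v a w = 0) →
        fderiv ℝ (chartForm S.form e) y v v v + 2 * chartForm S.form e y a v = 0)
    {γ : ℝ → M} {a b : ℝ} (hγ : IsGeodesicOn g γ (Icc a b)) {t t' : ℝ} (ht : t ∈ Icc a b)
    (ht' : t' ∈ Icc a b) :
    S.form (γ t) (vel γ t) (vel γ t) = S.form (γ t') (vel γ t') (vel γ t') := by
  have h := fun τ (hτ : τ ∈ Icc a b) => hγ.hasDerivAt_integral hS hτ
  have h1 : ∀ τ ∈ Icc a b, S.form (γ τ) (vel γ τ) (vel γ τ) = S.form (γ a) (vel γ a) (vel γ a) :=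
    constant_of_has_deriv_right_zero
      (fun τ hτ => (h τ hτ).continuousAt.continuousWithinAt)
      (fun τ hτ => (h τ (Ico_subset_Icc_self hτ)).hasDerivWithinAt)
  rw [h1 t ht, h1 t' ht']

/-- The square of the speed of a geodesic is constant. -/
theorem IsGeodesicOn.speed_eq {g : Metric M} {γ : ℝ → M} {a b : ℝ}
    (hγ : IsGeodesicOn g γ (Icc a b)) {t t' : ℝ} (ht : t ∈ Icc a b) (ht' : t' ∈ Icc a b) :
    g.inner (γ t) (vel γ t) (vel γ t) = g.inner (γ t') (vel γ t') (vel γ t') :=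
  hγ.integral_eq (S := metricField g)
    (fun _ he _ hy _ _ h => fderiv_metric_of_covAcc_eq_zero he g hy h) ht ht'

/-! ### The Killing equation in a chart -/

/-- In the plane with a Riemannian metric and a quadratic integral, given by their matrices, the
polarized Killing equation for the form `A - m G` at a point where it degenerates in the
direction `v`. It expresses the derivative of the form in any direction by the covariant
acceleration of curves with velocity `v`. -/
theorem killing_polarized {G A : Plane →L[ℝ] Plane →L[ℝ] ℝ}
    {dG dA : Plane →L[ℝ] Plane →L[ℝ] Plane →L[ℝ] ℝ} (hG : ∀ v w, G v w = G w v)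
    (hdG : ∀ z v w, dG z v w = dG z w v) (hA : ∀ v w, A v w = A w v)
    (hdA : ∀ z v w, dA z v w = dA z w v)
    (hpos : ∀ v, v ≠ 0 → 0 < G v v)
    (hint : ∀ v a, (∀ w, G a w + dG v v w - (1 / 2) * dG w v v = 0) →
      dA v v v + 2 * A a v = 0)
    {m : ℝ} {v : Plane} (hdeg : ∀ w, A v w = m * G v w) :
    ∃ a, (∀ w, G a w + dG v v w - (1 / 2) * dG w v v = 0) ∧
      ∀ w, (dA w v v - m * dG w v v) + 2 * (dA v v w - m * dG v v w) + 2 * (A a w - m * G a w) = 0 := by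
  -- the geodesic accelerations form a quadratic map, whose polarization gives the vectors `b`
  have hex : ∀ v w : Plane, ∃ b, ∀ z, G b z + dG v w z + dG w v z - dG z v w = 0 := by
    intro v w
    obtain ⟨b, hb⟩ := exists_representing hpos
      (((dG.flip v).flip w : Plane →L[ℝ] ℝ) - (dG v w : Plane →L[ℝ] ℝ) - (dG w v : Plane →L[ℝ] ℝ) :
        Plane →L[ℝ] ℝ).toLinearMap
    refine ⟨b, fun z => ?_⟩
    have := hb z
    simp at this
    rw [this]; ring
  have hacc : ∀ v : Plane, ∃ a, ∀ z, G a z + dG v v z - (1 / 2) * dG z v v = 0 := by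
    intro v
    obtain ⟨b, hb⟩ := hex v v
    refine ⟨(1 / 2 : ℝ) • b, fun z => ?_⟩
    simp only [map_smul, smul_apply, smul_eq_mul]
    linarith [hb z]
  obtain ⟨a, ha⟩ := hacc v
  refine ⟨a, ha, fun w => ?_⟩
  obtain ⟨a', ha'⟩ := hacc w
  obtain ⟨b, hb⟩ := hex v w
  have hQ : ∀ v a, (∀ w, G a w + dG v v w - (1 / 2) * dG w v v = 0) →
      (dA v v v - m * dG v v v) + 2 * (A a v - m * G a v) = 0 := by
    intro v a h
    linarith [hint v a h, congrArg (fun r => m * r) (h v)]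
  have h1 := hQ (v + w) (a + a' + b) (by
    intro z
    simp only [map_add, add_apply]
    rw [hdG z w v]
    linarith [ha z, ha' z, hb z])
  have h2 := hQ (v - w) (a + a' - b) (by
    intro z
    simp only [map_add, map_sub, add_apply, sub_apply]
    rw [hdG z w v]
    linarith [ha z, ha' z, hb z])
  have h3 := hQ w a' ha'
  simp only [map_add, map_sub, add_apply, sub_apply] at h1 h2
  rw [hA b v, hdeg, hG b v] at h1 h2
  rw [hA a v, hA a' v, hdeg, hdeg, hG a v, hG a' v, hdA v w v, hdA w w v, hdG v w v, hdG w w v] at h1 h2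
  linarith

end
section
variable {M : Type*} [TopologicalSpace M] [ChartedSpace Plane M] [IsManifold (𝓡 2) ∞ M]

/-! ### The derivative of the lowest eigenvalue -/

/-- The differential of the lowest eigenvalue. -/
noncomputable abbrev deigen (g : Metric M) (S : QuadraticField M) (x : M) :
    TangentSpace (𝓡 2) x →L[ℝ] ℝ :=
  mfderiv (𝓡 2) 𝓘(ℝ, ℝ) (eigen g S) x

theorem mfderiv_eq_fderiv_chart {l : M → ℝ} {x : M}
    (hl : MDifferentiableAt (𝓡 2) 𝓘(ℝ, ℝ) l x) {e : OpenPartialHomeomorph M Plane}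
    (he : e ∈ IsManifold.maximalAtlas (𝓡 2) ∞ M) (hxe : x ∈ e.source) (v : TangentSpace (𝓡 2) x) :
    (mfderiv (𝓡 2) 𝓘(ℝ, ℝ) l x v : ℝ)
      = fderiv ℝ (fun z => l (e.symm z)) (e x) (mfderiv (𝓡 2) (𝓡 2) e x v) := by
  have hm := mdifferentiable_of_mem_maximalAtlas he
  have hd : MDifferentiableAt (𝓡 2) 𝓘(ℝ, ℝ) (l ∘ e.symm) (e x) :=
    MDifferentiableAt.comp (e x) (by rwa [e.left_inv hxe])
      (hm.mdifferentiableAt_symm (e.map_source hxe))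
  have h1 : mfderiv (𝓡 2) 𝓘(ℝ, ℝ) l x = mfderiv (𝓡 2) 𝓘(ℝ, ℝ) ((l ∘ e.symm) ∘ e) x := by
    apply Filter.EventuallyEq.mfderiv_eq
    filter_upwards [e.open_source.mem_nhds hxe] with z hz
    simp [e.left_inv hz]
  have h2 := mfderiv_comp x hd (hm.mdifferentiableAt hxe)
  rw [mfderiv_eq_fderiv] at h2
  rw [h1, h2]
  rfl

theorem deigen_eq_fderiv {g : Metric M} {S : QuadraticField M} {x : M}
    (hx : HasRealZeroDirections S x) {e : OpenPartialHomeomorph M Plane}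
    (he : e ∈ IsManifold.maximalAtlas (𝓡 2) ∞ M) (hxe : x ∈ e.source) (v : TangentSpace (𝓡 2) x) :
    deigen g S x v
      = fderiv ℝ (fun z => eigen g S (e.symm z)) (e x) (mfderiv (𝓡 2) (𝓡 2) e x v) :=
  mfderiv_eq_fderiv_chart ((contMDiffAt_eigen g hx).mdifferentiableAt (by simp)) he hxe v

/-- The form `S - m g` vanishes on an eigenvector for the lowest eigenvalue `m`. -/
theorem form_eq_of_eigen {g : Metric M} {S : QuadraticField M} {x : M} {v : TangentSpace (𝓡 2) x}
    (hv : S.form x v v = eigen g S x * g.inner x v v) (w : TangentSpace (𝓡 2) x) :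
    S.form x v w = eigen g S x * g.inner x v w := by
  have h := apply_eq_zero_of_nonneg
    (A := (show Plane →L[ℝ] Plane →L[ℝ] ℝ from S.form x)
      - eigen g S x • (show Plane →L[ℝ] Plane →L[ℝ] ℝ from g.inner x))
    (fun v w => ?_) (fun v => ?_) (v := v) ?_ w
  · exact sub_eq_zero.1 h
  · exact congrArg₂ (fun a b => a - eigen g S x * b) (S.symm x v w) (g.symm x v w)
  · exact sub_nonneg.2 (eigen_mul_le g S x v)
  · exact sub_eq_zero.2 hv

section chart

variable {e : OpenPartialHomeomorph M Plane} (he : e ∈ IsManifold.maximalAtlas (𝓡 2) ∞ M)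
include he

/-- The Hellmann-Feynman formula: the derivative of the lowest eigenvalue is obtained by
differentiating the form `S - m g` on a fixed eigenvector. -/
theorem fderiv_eigen_mul (g : Metric M) {S : QuadraticField M} {y : Plane} (hy : y ∈ e.target)
    (hreal : HasRealZeroDirections S (e.symm y)) {u : Plane}
    (hu : chartForm S.form e y u u
      = eigen g S (e.symm y) * chartForm (metricField g).form e y u u) (w : Plane) :
    fderiv ℝ (fun z => eigen g S (e.symm z)) y w * chartForm (metricField g).form e y u u
      = fderiv ℝ (chartForm S.form e) y w u u
        - eigen g S (e.symm y) * fderiv ℝ (chartForm (metricField g).form e) y w u u := by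
  have h1 : HasFDerivAt (fun z => eigen g S (e.symm z))
      (fderiv ℝ (fun z => eigen g S (e.symm z)) y) y :=
    ((contDiffAt_eigen_chart g he hy hreal).differentiableAt (by simp)).hasFDerivAt
  have hform : ∀ T : QuadraticField M, HasFDerivAt (fun z => chartForm T.form e z u u)
      (((fderiv ℝ (chartForm T.form e) y).flip u).flip u) y := by
    intro T
    have h := (differentiableAt_chartForm he T hy).hasFDerivAt
    have h2 := (h.clm_apply (hasFDerivAt_const u y)).clm_apply (hasFDerivAt_const u y)
    refine h2.congr_fderiv ?_
    ext z
    simp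
  -- `S - m g` is nonnegative on `u` near `y` and vanishes at `y`
  have hmin : IsLocalMin (fun z => chartForm S.form e z u u
      - eigen g S (e.symm z) * chartForm (metricField g).form e z u u) y := by
    filter_upwards [e.open_target.mem_nhds hy] with z hz
    rw [hu, sub_self]
    exact sub_nonneg.2 (eigen_mul_le g S (e.symm z) _)
  have h3 := hmin.hasFDerivAt_eq_zero ((hform S).sub (h1.mul (hform (metricField g))))
  have h4 := congrArg (fun f : Plane →L[ℝ] ℝ => f w) h3
  simp at h4
  linarith

/-- The derivative of the lowest eigenvalue `m` in the direction of an eigenvector `u` is, up to a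
positive factor, the derivative of `S - m g` along the geodesic flow at `u`, with `m` frozen. This
vanishes, since both `S` and `g` are integrals. -/
theorem fderiv_eigen_eq_zero {g : Metric M} {S : QuadraticField M} (hS : IsFirstIntegral g S)
    {y : Plane} (hy : y ∈ e.target)
    (hreal : HasRealZeroDirections S (e.symm y)) {u : Plane}
    (hu : chartForm S.form e y u u
      = eigen g S (e.symm y) * chartForm (metricField g).form e y u u) :
    fderiv ℝ (fun z => eigen g S (e.symm z)) y u = 0 := by
  by_cases hu0 : u = 0
  · rw [hu0, map_zero]
  have hpos := chartForm_pos he g hy u hu0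
  have h := fderiv_eigen_mul he g hy hreal hu u
  obtain ⟨a, ha⟩ : ∃ a, ∀ w, covAcc g e y u a w = 0 := by
    obtain ⟨a, ha⟩ := exists_representing (chartForm_pos he g hy)
      (((1 / 2 : ℝ) • ((fderiv ℝ (chartForm (metricField g).form e) y).flip u).flip u
        - fderiv ℝ (chartForm (metricField g).form e) y u u : Plane →L[ℝ] ℝ)).toLinearMap
    refine ⟨a, fun w => ?_⟩
    rw [covAcc_eq he g hy, ha w]
    simp
  have h1 := hS.fderiv_chartForm he hy ha
  have h2 := fderiv_metric_of_covAcc_eq_zero he g hy ha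
  have h3 : chartForm S.form e y u a
      = eigen g S (e.symm y) * chartForm (metricField g).form e y u a := form_eq_of_eigen hu _
  rw [chartForm_symm S e y u a, chartForm_symm (metricField g) e y u a] at h3
  have h4 : fderiv ℝ (fun z => eigen g S (e.symm z)) y u
      * chartForm (metricField g).form e y u u = 0 := by
    rw [h]
    linear_combination h1 - eigen g S (e.symm y) * h2 - 2 * h3
  exact (mul_eq_zero.1 h4).resolve_right hpos.ne'

end chart

/-- The lowest eigenvalue of a quadratic integral is constant in the direction of its
eigenvectors. -/
theorem deigen_eq_zero {g : Metric M} {S : QuadraticField M} (hS : IsFirstIntegral g S) {x : M}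
    (hx : HasRealZeroDirections S x) {v : TangentSpace (𝓡 2) x}
    (hv : S.form x v v = eigen g S x * g.inner x v v) : deigen g S x v = 0 := by
  have hxe := mem_chart_source Plane x
  have he := chartAt_mem x
  rw [deigen_eq_fderiv hx he hxe]
  apply fderiv_eigen_eq_zero he hS (mem_chart_target Plane x)
  · rwa [(chartAt Plane x).left_inv hxe]
  · rw [chartForm_mfderiv he S hxe, chartForm_mfderiv he (metricField g) hxe,
      (chartAt Plane x).left_inv hxe]
    exact hv

/-! ### The geodesic curvature of the wall -/

theorem exists_smul_add_of_orthogonal {G : Plane →L[ℝ] Plane →L[ℝ] ℝ} (hG : ∀ v w, G v w = G w v)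
    (hpos : ∀ v, v ≠ 0 → 0 < G v v) {u n : Plane} (hu : u ≠ 0) (hn : n ≠ 0) (hun : G u n = 0)
    (w : Plane) : w = (G w u / G u u) • u + (G w n / G n n) • n := by
  have hu' := hpos u hu
  have hn' := hpos n hn
  have hli : LinearIndependent ℝ ![u, n] := by
    refine LinearIndependent.pair_iff.2 fun s t hst => ?_
    have h1 := congrArg (fun z => G z u) hst
    have h2 := congrArg (fun z => G z n) hst
    simp [hG n u, hun] at h1 h2
    exact ⟨h1.resolve_right hu'.ne', h2.resolve_right hn'.ne'⟩
  obtain ⟨a, b, rfl⟩ := exists_smul_add_of_linearIndependent hli w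
  simp only [map_add, map_smul, add_apply, smul_apply, smul_eq_mul, hG n u, hun]
  simp only [mul_zero, add_zero, zero_add]
  rw [mul_div_cancel_right₀ _ hu'.ne', mul_div_cancel_right₀ _ hn'.ne']

/-- A wall in the region of real zero directions, tangent to the eigendirection of the lowest
eigenvalue. A leaf of the bisector net is such a wall for the integral or for its opposite. -/
structure IsEigenWall (g : Metric M) (S : QuadraticField M) (c : ℝ → M)
    (ν : ∀ x : M, TangentSpace (𝓡 2) x) : Prop where
  smooth : ContMDiff 𝓘(ℝ, ℝ) (𝓡 2) ∞ c
  regular : ∀ t, vel c t ≠ 0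
  real_nhds : ∀ t, ∀ᶠ x in nhds (c t), HasRealZeroDirections S x
  unit : ∀ t, g.inner (c t) (ν (c t)) (ν (c t)) = 1
  normal : ∀ t, g.inner (c t) (vel c t) (ν (c t)) = 0
  eigen_eq : ∀ t, S.form (c t) (vel c t) (vel c t)
    = eigen g S (c t) * g.inner (c t) (vel c t) (vel c t)

namespace IsEigenWall

variable {g : Metric M} {S : QuadraticField M} {c : ℝ → M} {ν : ∀ x : M, TangentSpace (𝓡 2) x}

theorem real (h : IsEigenWall g S c ν) (t : ℝ) : HasRealZeroDirections S (c t) :=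
  (h.real_nhds t).self_of_nhds

theorem normal_ne_zero (h : IsEigenWall g S c ν) (t : ℝ) : ν (c t) ≠ 0 := by
  intro h0
  have := h.unit t
  rw [h0, map_zero] at this
  exact one_ne_zero this.symm

theorem eq_smul_add (h : IsEigenWall g S c ν) (t : ℝ) (w : TangentSpace (𝓡 2) (c t)) :
    ∃ a : ℝ, w = a • vel c t + g.inner (c t) w (ν (c t)) • ν (c t) := by
  have := exists_smul_add_of_orthogonal (G := g.inner (c t)) (g.symm (c t)) (g.pos (c t))
    (h.regular t) (h.normal_ne_zero t) (h.normal t) w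
  refine ⟨g.inner (c t) w (vel c t) / g.inner (c t) (vel c t) (vel c t), ?_⟩
  have h1 := h.unit t
  conv_lhs => rw [this]
  change _ + (g.inner (c t) w (ν (c t)) / g.inner (c t) (ν (c t)) (ν (c t))) • ν (c t) = _
  rw [h1, div_one]
  rfl

/-- The normal of the wall is not an eigenvector for the lowest eigenvalue. -/
theorem eigen_lt_normal (h : IsEigenWall g S c ν) (t : ℝ) :
    eigen g S (c t) < S.form (c t) (ν (c t)) (ν (c t)) := by
  have hle := eigen_mul_le g S (c t) (ν (c t))
  rw [h.unit t, mul_one] at hle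
  refine lt_of_le_of_ne hle fun heq => ?_
  have hν : S.form (c t) (ν (c t)) (ν (c t))
      = eigen g S (c t) * g.inner (c t) (ν (c t)) (ν (c t)) := by rw [h.unit t, mul_one, heq]
  have hall : ∀ w w', S.form (c t) w w' = eigen g S (c t) * g.inner (c t) w w' := by
    intro w w'
    obtain ⟨a, ha⟩ := h.eq_smul_add t w
    rw [ha]
    simp only [map_add, map_smul, add_apply, smul_apply, smul_eq_mul,
      form_eq_of_eigen (h.eigen_eq t) w', form_eq_of_eigen hν w']
    ring
  obtain ⟨h0, ξ, η, hli, hξ, -⟩ := h.real t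
  have hξ0 : ξ ≠ 0 := by simpa using hli.ne_zero 0
  have hlam : eigen g S (c t) = 0 := by
    rw [hall] at hξ
    exact (mul_eq_zero.1 hξ).resolve_right (g.pos (c t) ξ hξ0).ne'
  apply h0
  ext w w'
  rw [hall, hlam, zero_mul]
  rfl

theorem hasDerivAt_eigen (h : IsEigenWall g S c ν) (hS : IsFirstIntegral g S) (t : ℝ) :
    HasDerivAt (fun τ => eigen g S (c τ)) 0 t := by
  have h1 : MDifferentiableAt (𝓡 2) 𝓘(ℝ, ℝ) (eigen g S) (c t) :=
    (contMDiffAt_eigen g (h.real t)).mdifferentiableAt (by simp)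
  have h2 : MDifferentiableAt 𝓘(ℝ, ℝ) (𝓡 2) c t := (h.smooth t).mdifferentiableAt (by simp)
  have h3 : HasFDerivAt (fun τ => eigen g S (c τ)) (show ℝ →L[ℝ] ℝ from
      (deigen g S (c t)).comp (mfderiv 𝓘(ℝ, ℝ) (𝓡 2) c t)) t :=
    (h1.hasMFDerivAt.comp t h2.hasMFDerivAt).hasFDerivAt
  have h4 : deigen g S (c t) (vel c t) = 0 := deigen_eq_zero hS (h.real t) (h.eigen_eq t)
  have h5 := h3.hasDerivAt
  rwa [show (show ℝ →L[ℝ] ℝ from (deigen g S (c t)).comp (mfderiv 𝓘(ℝ, ℝ) (𝓡 2) c t)) 1 = 0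
    from h4] at h5

theorem eigen_const (h : IsEigenWall g S c ν) (hS : IsFirstIntegral g S) (t t' : ℝ) :
    eigen g S (c t) = eigen g S (c t') :=
  is_const_of_deriv_eq_zero (f := fun τ => eigen g S (c τ))
    (fun τ => (h.hasDerivAt_eigen hS τ).differentiableAt) (fun τ => (h.hasDerivAt_eigen hS τ).deriv)
    t t'

theorem mdifferentiableAt (h : IsEigenWall g S c ν) (t : ℝ) :
    MDifferentiableAt 𝓘(ℝ, ℝ) (𝓡 2) c t :=
  (h.smooth t).mdifferentiableAt (by simp)

theorem form_normal (h : IsEigenWall g S c ν) (t : ℝ) (q : TangentSpace (𝓡 2) (c t)) :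
    S.form (c t) q (ν (c t)) = g.inner (c t) q (ν (c t)) * S.form (c t) (ν (c t)) (ν (c t)) := by
  obtain ⟨r, hr⟩ := h.eq_smul_add t q
  have : S.form (c t) (vel c t) (ν (c t)) = 0 := by
    rw [form_eq_of_eigen (h.eigen_eq t), h.normal t, mul_zero]
  conv_lhs => rw [hr]
  simp only [map_add, map_smul, add_apply, smul_apply, smul_eq_mul, this]
  ring

section chart

variable {e : OpenPartialHomeomorph M Plane} (he : e ∈ IsManifold.maximalAtlas (𝓡 2) ∞ M)
include he

theorem chartForm_eigen (h : IsEigenWall g S c ν) {t : ℝ} (hx : c t ∈ e.source) (w : Plane) :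
    chartForm S.form e (e (c t)) (deriv (e ∘ c) t) w
      = eigen g S (c t) * chartForm (metricField g).form e (e (c t)) (deriv (e ∘ c) t) w := by
  obtain ⟨w', rfl⟩ : ∃ w' : TangentSpace (𝓡 2) (c t),
      mfderiv (𝓡 2) (𝓡 2) e (c t) w' = w := ⟨_, mfderiv_mfderiv_symm he hx w⟩
  rw [← mfderiv_symm_deriv he (h.mdifferentiableAt t) hx, chartForm_mfderiv he S hx,
    chartForm_mfderiv he (metricField g) hx]
  exact form_eq_of_eigen (h.eigen_eq t) w'

/-- The equation `(S - m g) (c', w) = 0` along the wall, differentiated for constant `w`. -/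
theorem deriv_chartForm_eigen (h : IsEigenWall g S c ν) (hS : IsFirstIntegral g S) {t : ℝ}
    (hx : c t ∈ e.source) (w : Plane) :
    (fderiv ℝ (chartForm S.form e) (e (c t)) (deriv (e ∘ c) t) (deriv (e ∘ c) t) w
      - eigen g S (c t) * fderiv ℝ (chartForm (metricField g).form e) (e (c t)) (deriv (e ∘ c) t)
        (deriv (e ∘ c) t) w)
      + (chartForm S.form e (e (c t)) (deriv (deriv (e ∘ c)) t) w
        - eigen g S (c t)
          * chartForm (metricField g).form e (e (c t)) (deriv (deriv (e ∘ c)) t) w) = 0 := by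
  have hy : (e ∘ c) t ∈ e.target := e.map_source hx
  obtain ⟨hu1, hu2⟩ := hasDerivAt_deriv_chart he (h.smooth t) hx
  have h1 := deriv_form_chart he S hy hu1 hu2 (hasDerivAt_const t w)
  have h2 := deriv_form_chart he (metricField g) hy hu1 hu2 (hasDerivAt_const t w)
  have h3 := h1.sub (h2.const_mul (eigen g S (c t)))
  have h4 : (fun τ => chartForm S.form e ((e ∘ c) τ) (deriv (e ∘ c) τ) w
      - eigen g S (c t) * chartForm (metricField g).form e ((e ∘ c) τ) (deriv (e ∘ c) τ) w)
        =ᶠ[nhds t] fun _ => 0 := by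
    filter_upwards [h.smooth.continuous.continuousAt.preimage_mem_nhds
      (e.open_source.mem_nhds hx)] with τ hτ
    rw [h.eigen_const hS t τ]
    exact sub_eq_zero.2 (h.chartForm_eigen he hτ w)
  have h5 := (h3.congr_of_eventuallyEq h4.symm).unique (hasDerivAt_const t (0 : ℝ))
  simp only [map_zero, add_zero, Function.comp_apply] at h5
  linarith

/-- The derivative of the lowest eigenvalue along the normal of the wall in terms of the covariant
acceleration of the wall. -/
theorem deigen_normal_chart (h : IsEigenWall g S c ν) (hS : IsFirstIntegral g S) {t : ℝ}
    (hx : c t ∈ e.source) {n : Plane} (hn : mfderiv (𝓡 2) (𝓡 2) e (c t) (ν (c t)) = n) :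
    deigen g S (c t) (ν (c t)) * g.inner (c t) (vel c t) (vel c t)
      = 2 * (covAcc g e (e (c t)) (deriv (e ∘ c) t) (deriv (deriv (e ∘ c)) t) n
        * (S.form (c t) (ν (c t)) (ν (c t)) - eigen g S (c t))) := by
  have hy : e (c t) ∈ e.target := e.map_source hx
  have hmy : eigen g S (e.symm (e (c t))) = eigen g S (c t) := by rw [e.left_inv hx]
  have hgv := chartForm_deriv he (metricField g) (h.mdifferentiableAt t) hx
  have hHF := fderiv_eigen_mul he g hy (S := S) (u := deriv (e ∘ c) t)
    (by rw [e.left_inv hx]; exact h.real t) (by rw [hmy]; exact h.chartForm_eigen he hx _) n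
  have hn' := deigen_eq_fderiv (g := g) (h.real t) he hx (ν (c t))
  rw [hn] at hn'
  rw [hmy, hgv, ← hn'] at hHF
  obtain ⟨a, ha, hkill⟩ := killing_polarized (m := eigen g S (c t)) (v := deriv (e ∘ c) t)
    (G := chartForm (metricField g).form e (e (c t))) (A := chartForm S.form e (e (c t)))
    (dG := fderiv ℝ (chartForm (metricField g).form e) (e (c t)))
    (dA := fderiv ℝ (chartForm S.form e) (e (c t)))
    (chartForm_symm _ _ _) (fderiv_chartForm_symm he _ hy)
    (chartForm_symm _ _ _) (fderiv_chartForm_symm he _ hy)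
    (chartForm_pos he g hy)
    (fun v a hva => hS.fderiv_chartForm he hy fun w => by rw [covAcc_eq he g hy]; exact hva w)
    (h.chartForm_eigen he hx)
  have hder := h.deriv_chartForm_eigen he hS hx n
  replace ha := ha n
  replace hkill := hkill n
  -- the covariant acceleration `q = c'' - a` and its normal component
  obtain ⟨q, hq⟩ : ∃ q : TangentSpace (𝓡 2) (c t),
      mfderiv (𝓡 2) (𝓡 2) e (c t) q = deriv (deriv (e ∘ c)) t - a := ⟨_, mfderiv_mfderiv_symm he hx _⟩
  have a1 := chartForm_mfderiv he S hx q (ν (c t))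
  have a2 := chartForm_mfderiv he (metricField g) hx q (ν (c t))
  rw [hq, hn] at a1 a2
  rw [h.form_normal t q] at a1
  change _ = g.inner (c t) q (ν (c t)) at a2
  change _ * g.inner (c t) (vel c t) (vel c t) = _ at hHF
  rw [covAcc_eq he g hy, hHF]
  simp only [map_sub, sub_apply] at a1 a2
  generalize S.form (c t) (ν (c t)) (ν (c t)) = l at *
  generalize g.inner (c t) q (ν (c t)) = k at *
  have hk : chartForm (metricField g).form e (e (c t)) (deriv (deriv (e ∘ c)) t) n
      + fderiv ℝ (chartForm (metricField g).form e) (e (c t)) (deriv (e ∘ c) t) (deriv (e ∘ c) t) n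
      - 1 / 2 * fderiv ℝ (chartForm (metricField g).form e) (e (c t)) n (deriv (e ∘ c) t)
        (deriv (e ∘ c) t) = k := by linarith
  rw [hk]
  linear_combination hkill - 2 * hder + 2 * a1 - 2 * eigen g S (c t) * a2

end chart

/-- The derivative of the lowest eigenvalue along the normal of the wall is proportional to the
geodesic curvature. -/
theorem deigen_normal (h : IsEigenWall g S c ν) (hS : IsFirstIntegral g S) (t : ℝ) :
    deigen g S (c t) (ν (c t)) = 2 * geodesicCurvature g c ν t
      * (S.form (c t) (ν (c t)) (ν (c t)) - eigen g S (c t)) := by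
  have h1 := h.deigen_normal_chart (chartAt_mem (c t)) hS (mem_chart_source Plane (c t)) rfl
  have hgpos : 0 < g.inner (c t) (vel c t) (vel c t) := g.pos _ _ (h.regular t)
  have h2 : geodesicCurvature g c ν t * g.inner (c t) (vel c t) (vel c t)
      = covAcc g (chartAt Plane (c t)) (chartAt Plane (c t) (c t))
      (deriv (chartAt Plane (c t) ∘ c) t) (deriv (deriv (chartAt Plane (c t) ∘ c)) t)
      (mfderiv (𝓡 2) (𝓡 2) (chartAt Plane (c t)) (c t) (ν (c t))) :=
    div_mul_cancel₀ _ hgpos.ne'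
  rw [← h2] at h1
  apply mul_right_cancel₀ hgpos.ne'
  rw [h1]
  ring

end IsEigenWall

end
/-! ### Critical points of the lowest eigenvalue propagate along the wall -/

/-- Let the function `L` be constant along the vector field `X`. Along an integral curve of `X`
(with any parametrization) the differential of `L` solves a linear differential equation;
therefore it vanishes near any point where it vanishes. -/
theorem eventually_fderiv_eq_zero {L : Plane → ℝ} {X : Plane → Plane} {u : ℝ → Plane} {ρ : ℝ → ℝ}
    {t₀ : ℝ} (hL : ContDiffAt ℝ 2 L (u t₀)) (hX : ContDiffAt ℝ 1 X (u t₀))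
    (hLX : ∀ᶠ y in nhds (u t₀), fderiv ℝ L y (X y) = 0) (hρ : ContinuousAt ρ t₀)
    (hu : ∀ᶠ t in nhds t₀, HasDerivAt u (ρ t • X (u t)) t) (h0 : fderiv ℝ L (u t₀) = 0) :
    ∀ᶠ t in nhds t₀, fderiv ℝ L (u t) = 0 := by
  have hucont : ContinuousAt u t₀ := hu.self_of_nhds.continuousAt
  have hode : ∀ᶠ y in nhds (u t₀), ∀ z, fderiv ℝ (fderiv ℝ L) y (X y) z
      = -(fderiv ℝ L y (fderiv ℝ X y z)) := by
    filter_upwards [hL.eventually (by simp), hX.eventually (by simp), hLX.eventually_nhds]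
      with y hLy hXy hy z
    have h1 : HasFDerivAt (fderiv ℝ L) (fderiv ℝ (fderiv ℝ L) y) y :=
      ((hLy.fderiv_right (m := 1) (by norm_num)).differentiableAt (by simp)).hasFDerivAt
    have h2 : HasFDerivAt X (fderiv ℝ X y) y := (hXy.differentiableAt (by simp)).hasFDerivAt
    have h3 := h1.clm_apply h2
    have h4 : HasFDerivAt (fun y => fderiv ℝ L y (X y)) (0 : Plane →L[ℝ] ℝ) y :=
      (hasFDerivAt_const (0 : ℝ) y).congr_of_eventuallyEq hy
    have h5 := congrArg (fun f : Plane →L[ℝ] ℝ => f z) (h3.unique h4)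
    simp at h5
    have h6 := (hLy.isSymmSndFDerivAt (by simp)).eq (X y) z
    rw [h6]
    linarith
  have hDX : ContinuousAt (fun t => fderiv ℝ X (u t)) t₀ :=
    ContinuousAt.comp (f := u) (g := fderiv ℝ X) (hX.continuousAt_fderiv (by simp)) hucont
  have hbound : ∀ᶠ t in nhds t₀, ‖ρ t‖ * ‖fderiv ℝ X (u t)‖
      < ‖ρ t₀‖ * ‖fderiv ℝ X (u t₀)‖ + 1 :=
    (hρ.norm.mul hDX.norm).eventually (gt_mem_nhds (lt_add_one _))
  have hall := ((hbound.and hu).and (hucont.eventually hode)).and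
    (hucont.eventually (hL.eventually (by simp)))
  obtain ⟨δ, hδ, hball⟩ := Metric.eventually_nhds_iff_ball.1 hall
  have hK : 0 ≤ ‖ρ t₀‖ * ‖fderiv ℝ X (u t₀)‖ + 1 := by positivity
  have hEq : EqOn (fun t => fderiv ℝ L (u t)) (fun _ => (0 : Plane →L[ℝ] ℝ))
      (Ioo (t₀ - δ) (t₀ + δ)) := by
    refine ODE_solution_unique_of_mem_Ioo (K := ⟨_, hK⟩) (s := fun _ => univ) (t₀ := t₀)
      (v := fun t q => -(ρ t) • q.comp (fderiv ℝ X (u t))) ?_ ⟨by linarith, by linarith⟩ ?_ ?_ h0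
    · intro t ht
      rw [← Real.ball_eq_Ioo] at ht
      refine (LipschitzWith.of_dist_le_mul fun q q' => ?_).lipschitzOnWith
      have h1 := (hball t ht).1.1.1.le
      rw [dist_eq_norm, dist_eq_norm]
      calc ‖-(ρ t) • q.comp (fderiv ℝ X (u t)) - -(ρ t) • q'.comp (fderiv ℝ X (u t))‖
          = ‖ρ t‖ * ‖(q - q').comp (fderiv ℝ X (u t))‖ := by
            rw [← smul_sub, norm_smul, norm_neg, ContinuousLinearMap.sub_comp]
        _ ≤ ‖ρ t‖ * (‖q - q'‖ * ‖fderiv ℝ X (u t)‖) := by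
            gcongr; exact ContinuousLinearMap.opNorm_comp_le _ _
        _ = ‖ρ t‖ * ‖fderiv ℝ X (u t)‖ * ‖q - q'‖ := by ring
        _ ≤ _ := mul_le_mul_of_nonneg_right h1 (norm_nonneg _)
    · intro t ht
      rw [← Real.ball_eq_Ioo] at ht
      obtain ⟨⟨⟨-, h1⟩, h2⟩, h3⟩ := hball t ht
      refine ⟨?_, mem_univ _⟩
      have h4 : HasFDerivAt (fderiv ℝ L) (fderiv ℝ (fderiv ℝ L) (u t)) (u t) :=
        ((h3.fderiv_right (m := 1) (by norm_num)).differentiableAt (by simp)).hasFDerivAt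
      have h5 : HasDerivAt (fun t => fderiv ℝ L (u t))
          (fderiv ℝ (fderiv ℝ L) (u t) (ρ t • X (u t))) t :=
        HasFDerivAt.comp_hasDerivAt (F := Plane) (E := Plane →L[ℝ] ℝ) t h4 h1
      refine h5.congr_deriv ?_
      ext z
      simp [h2 z]
    · intro t _
      refine ⟨?_, mem_univ _⟩
      simpa using hasDerivAt_const t (0 : Plane →L[ℝ] ℝ)
  filter_upwards [Ioo_mem_nhds (show t₀ - δ < t₀ by linarith) (show t₀ < t₀ + δ by linarith)] with t ht
  exact hEq ht

section
variable {M : Type*} [TopologicalSpace M] [ChartedSpace Plane M] [IsManifold (𝓡 2) ∞ M]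
namespace IsEigenWall

variable {g : Metric M} {S : QuadraticField M} {c : ℝ → M} {ν : ∀ x : M, TangentSpace (𝓡 2) x}

theorem eventually_deigen_normal_eq_zero (h : IsEigenWall g S c ν) (hS : IsFirstIntegral g S)
    {t₀ : ℝ} (h0 : deigen g S (c t₀) (ν (c t₀)) = 0) :
    ∀ᶠ t in nhds t₀, deigen g S (c t) (ν (c t)) = 0 := by
  have he := chartAt_mem (c t₀)
  have hx : c t₀ ∈ (chartAt Plane (c t₀)).source := mem_chart_source Plane (c t₀)
  generalize chartAt Plane (c t₀) = e at he hx
  have hy : e (c t₀) ∈ e.target := e.map_source hx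
  have hreal : ∀ᶠ y in nhds (e (c t₀)), y ∈ e.target ∧ HasRealZeroDirections S (e.symm y) := by
    have h1 : Filter.Tendsto e.symm (nhds (e (c t₀))) (nhds (c t₀)) := by
      simpa [e.left_inv hx] using (e.continuousAt_symm hy).tendsto
    exact (e.open_target.eventually_mem hy).and (h1.eventually (h.real_nhds t₀))
  have hLsm : ContDiffAt ℝ ∞ (fun z => eigen g S (e.symm z)) (e (c t₀)) :=
    contDiffAt_eigen_chart g he hy hreal.self_of_nhds.2
  have hcsrc : ∀ᶠ t in nhds t₀, c t ∈ e.source :=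
    h.smooth.continuous.continuousAt.preimage_mem_nhds (e.open_source.mem_nhds hx)
  have hu : ∀ t, c t ∈ e.source → HasDerivAt (e ∘ c) (deriv (e ∘ c) t) t ∧
      HasDerivAt (deriv (e ∘ c)) (deriv (deriv (e ∘ c)) t) t := fun t ht =>
    hasDerivAt_deriv_chart he (h.smooth t) ht
  -- the degenerate form `S - m g` and its kernel field
  let B : Plane → Plane →L[ℝ] Plane →L[ℝ] ℝ := fun y => chartForm S.form e y
    - eigen g S (e.symm y) • chartForm (metricField g).form e y
  have hBsm : ∀ p q, ContDiffAt ℝ ∞ (fun y => B y p q) (e (c t₀)) := fun p q =>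
    (((contDiffAt_chartForm he S hy).clm_apply contDiffAt_const).clm_apply contDiffAt_const).sub
      (hLsm.mul (((contDiffAt_chartForm he (metricField g) hy).clm_apply
        contDiffAt_const).clm_apply contDiffAt_const))
  obtain ⟨n, hn⟩ : ∃ n : Plane, mfderiv (𝓡 2) (𝓡 2) e (c t₀) (ν (c t₀)) = n := ⟨_, rfl⟩
  obtain ⟨v, hv⟩ : ∃ v : Plane, mfderiv (𝓡 2) (𝓡 2) e (c t₀) (vel c t₀) = v := ⟨_, rfl⟩
  have hinj : ∀ w : TangentSpace (𝓡 2) (c t₀), w ≠ 0 → mfderiv (𝓡 2) (𝓡 2) e (c t₀) w ≠ 0 := by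
    intro w hw hw'
    exact hw ((mdifferentiable_of_mem_maximalAtlas he).mfderiv_injective hx
      (hw'.trans (map_zero _).symm))
  have hv0 : v ≠ 0 := hv ▸ hinj _ (h.regular t₀)
  have hn0 : n ≠ 0 := hn ▸ hinj _ (h.normal_ne_zero t₀)
  have horth : chartForm (metricField g).form e (e (c t₀)) v n = 0 := by
    have := chartForm_mfderiv he (metricField g) hx (vel c t₀) (ν (c t₀))
    rw [hn, hv] at this
    rw [this]
    exact h.normal t₀
  have hBn : 0 < B (e (c t₀)) n n := by
    have a1 := chartForm_mfderiv he S hx (ν (c t₀)) (ν (c t₀))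
    have a2 := chartForm_mfderiv he (metricField g) hx (ν (c t₀)) (ν (c t₀))
    rw [hn] at a1 a2
    change 0 < chartForm S.form e _ n n
      - eigen g S (e.symm _) * chartForm (metricField g).form e _ n n
    rw [a1, a2, e.left_inv hx]
    change 0 < _ - _ * g.inner (c t₀) (ν (c t₀)) (ν (c t₀))
    rw [h.unit t₀, mul_one]
    exact sub_pos.2 (h.eigen_lt_normal t₀)
  have hBn' : ∀ᶠ y in nhds (e (c t₀)), 0 < B y n n := by
    have : ContinuousAt (fun y => B y n n) (e (c t₀)) :=
      (hBsm n n).continuousAt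
    exact this.eventually (lt_mem_nhds hBn)
  let X : Plane → Plane := fun y => B y n n • v - B y v n • n
  have hXsm : ContDiffAt ℝ ∞ X (e (c t₀)) :=
    ((hBsm n n).smul contDiffAt_const).sub ((hBsm v n).smul contDiffAt_const)
  let α : Plane →L[ℝ] ℝ := (chartForm (metricField g).form e (e (c t₀)) v v)⁻¹ •
    (chartForm (metricField g).form e (e (c t₀)) v)
  have hker : ∀ y, 0 < B y n n → ∀ z, B y z n = 0 → z = (α z / B y n n) • X y := by
    intro y hy' z hz
    obtain ⟨b, hb⟩ : ∃ b : ℝ, z = α z • v + b • n := by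
      have := exists_smul_add_of_orthogonal (chartForm_symm (metricField g) e (e (c t₀)))
        (chartForm_pos he g hy) hv0 hn0 horth z
      have hα : α z = chartForm (metricField g).form e (e (c t₀)) z v
          / chartForm (metricField g).form e (e (c t₀)) v v := by
        change (chartForm (metricField g).form e (e (c t₀)) v v)⁻¹
          * chartForm (metricField g).form e (e (c t₀)) v z = _
        rw [chartForm_symm (metricField g) e (e (c t₀)) z v, div_eq_inv_mul]
      rw [← hα] at this
      exact ⟨_, this⟩
    have hz' : α z * B y v n + b * B y n n = 0 := by
      rw [hb] at hz
      simpa only [map_add, map_smul, add_apply, smul_apply, smul_eq_mul] using hz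
    have hb' : b = -(α z * B y v n) / B y n n := by
      field_simp
      linarith
    conv_lhs => rw [hb, hb']
    simp only [X, smul_sub, smul_smul]
    rw [div_mul_cancel₀ _ hy'.ne', sub_eq_add_neg, ← neg_smul]
    congr 2
    ring
  have hdeg : ∀ y ∈ e.target, ∀ z, chartForm S.form e y z z
      = eigen g S (e.symm y) * chartForm (metricField g).form e y z z → B y z n = 0 :=
    fun y _ z hz => sub_eq_zero.2 (form_eq_of_eigen hz _)
  have hLX : ∀ᶠ y in nhds (e (c t₀)), fderiv ℝ (fun z => eigen g S (e.symm z)) y (X y) = 0 := by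
    filter_upwards [hreal, hBn'] with y hy' hB
    obtain ⟨z, hz0, hz⟩ := exists_eigen_eq g S (e.symm y)
    obtain ⟨z, rfl⟩ := mfderiv_symm_surjective he hy'.1 z
    have hz1 := hker y hB z (hdeg y hy'.1 z hz)
    have hα : α z / B y n n ≠ 0 := by
      intro h
      rw [h, zero_smul] at hz1
      rw [hz1] at hz0
      exact hz0 (map_zero _)
    have hz2 := fderiv_eigen_eq_zero he hS hy'.1 hy'.2 (u := z) hz
    rw [hz1, map_smul] at hz2
    exact (smul_eq_zero.1 hz2).resolve_left hα
  have hall := eventually_fderiv_eq_zero (L := fun z => eigen g S (e.symm z)) (X := X) (u := e ∘ c)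
    (ρ := fun t => α (deriv (e ∘ c) t) / B (e (c t)) n n) (t₀ := t₀)
    (hLsm.of_le ENat.LEInfty.out) (hXsm.of_le (by simp)) hLX ?_ ?_ ?_
  · filter_upwards [hall, hcsrc] with t ht hsrc
    rw [deigen_eq_fderiv (h.real t) he hsrc]
    exact congrArg (fun f : Plane →L[ℝ] ℝ => f _) ht
  · have h1 : ContinuousAt (fun t => α (deriv (e ∘ c) t)) t₀ :=
      α.continuous.continuousAt.comp (hu t₀ hx).2.continuousAt
    have h2 : ContinuousAt (fun t => B ((e ∘ c) t) n n) t₀ :=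
      ContinuousAt.comp (f := e ∘ c) (g := fun y => B y n n)
        (hBsm n n).continuousAt
        (hu t₀ hx).1.continuousAt
    exact h1.div h2 hBn.ne'
  · have hBt : ∀ᶠ t in nhds t₀, 0 < B ((e ∘ c) t) n n :=
      (hu t₀ hx).1.continuousAt.eventually hBn'
    filter_upwards [hcsrc, hBt] with t hsrc hB
    have h1 := (hu t hsrc).1
    have h2 := hker _ hB (deriv (e ∘ c) t) (hdeg _ (e.map_source hsrc) _ (by
      rw [e.left_inv hsrc]; exact h.chartForm_eigen he hsrc _))
    rw [h2] at h1
    exact h1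
  · ext z
    obtain ⟨z', hz'⟩ : ∃ z' : TangentSpace (𝓡 2) (c t₀),
        mfderiv (𝓡 2) (𝓡 2) e (c t₀) z' = z := ⟨_, mfderiv_mfderiv_symm he hx z⟩
    have h1 := deigen_eq_fderiv (g := g) (h.real t₀) he hx z'
    rw [hz'] at h1
    refine h1.symm.trans ?_
    obtain ⟨a, ha⟩ := h.eq_smul_add t₀ z'
    rw [ha, map_add, map_smul, map_smul, h0, deigen_eq_zero hS (h.real t₀) (h.eigen_eq t₀)]
    simp

/-- On a convex wall the lowest eigenvalue increases towards the table. -/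
theorem deigen_normal_pos (h : IsEigenWall g S c ν) (hS : IsFirstIntegral g S)
    (hconv : IsConvexWall g c ν) (t : ℝ) : 0 < deigen g S (c t) (ν (c t)) := by
  have hgap := fun τ => sub_pos.2 (h.eigen_lt_normal τ)
  refine lt_of_le_of_ne ?_ fun h0 => ?_
  · rw [h.deigen_normal hS t]
    exact mul_nonneg (mul_nonneg zero_le_two (hconv.1 t)) (hgap t).le
  · obtain ⟨δ, hδ, hball⟩ :=
      Metric.eventually_nhds_iff_ball.1 (h.eventually_deigen_normal_eq_zero hS h0.symm)
    obtain ⟨τ, hτ, hne⟩ := hconv.2 (t - δ) (t + δ) (by linarith)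
    rw [← Real.ball_eq_Ioo] at hτ
    have h1 := hball τ hτ
    rw [h.deigen_normal hS τ] at h1
    exact (mul_ne_zero (mul_ne_zero two_ne_zero hne) (hgap τ).ne') h1

end IsEigenWall

end
/-! ### A smooth phase around a closed curve -/

/-- The inverse function theorem, with smoothness of the inverse in a neighbourhood. -/
theorem exists_smooth_local_inverse {E F : Type*} [NormedAddCommGroup E] [NormedSpace ℝ E]
    [CompleteSpace E] [NormedAddCommGroup F] [NormedSpace ℝ F] {f : E → F} {x : E}
    {f' : E ≃L[ℝ] F} (hf : ∀ᶠ y in nhds x, ContDiffAt ℝ ∞ f y)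
    (hf' : HasFDerivAt f (f' : E →L[ℝ] F) x) :
    ∃ ψ : F → E, ψ (f x) = x ∧ (∀ᶠ p in nhds (f x), ContDiffAt ℝ ∞ ψ p ∧ f (ψ p) = p) ∧
      ∃ U ∈ nhds x, InjOn f U ∧ ∀ᶠ y in nhds x, ψ (f y) = y := by
  have hfx := hf.self_of_nhds
  let R := hfx.toOpenPartialHomeomorph f hf' (by simp)
  have hxs : x ∈ R.source := hfx.mem_toOpenPartialHomeomorph_source hf' (by simp)
  have hxt : f x ∈ R.target := R.map_source hxs
  have hRx : R.symm (f x) = x := R.left_inv hxs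
  refine ⟨R.symm, hRx, ?_, R.source, R.open_source.mem_nhds hxs, R.injOn, ?_⟩
  · have hcont : Filter.Tendsto R.symm (nhds (f x)) (nhds x) := by
      have := (R.continuousAt_symm hxt).tendsto
      rwa [hRx] at this
    have hinv : ∀ᶠ y in nhds x, fderiv ℝ f y ∈ range ((↑) : (E ≃L[ℝ] F) → E →L[ℝ] F) := by
      have h1 : ContinuousAt (fderiv ℝ f) x := hfx.continuousAt_fderiv (by simp)
      apply h1.eventually
      rw [hf'.fderiv]
      exact ContinuousLinearEquiv.nhds f'
    filter_upwards [R.open_target.mem_nhds hxt, hcont.eventually hf, hcont.eventually hinv]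
      with p hp h1 ⟨f'', h2⟩
    refine ⟨R.contDiffAt_symm (f₀' := f'') hp ?_ h1, R.right_inv hp⟩
    rw [h2]
    exact (h1.differentiableAt (by simp)).hasFDerivAt
  · filter_upwards [R.open_source.mem_nhds hxs] with y hy
    exact R.left_inv hy

section
variable {M : Type*} [TopologicalSpace M] [ChartedSpace Plane M] [IsManifold (𝓡 2) ∞ M]

namespace IsSimpleClosedCurve

variable {c : ℝ → M}

theorem add_int (hc : IsSimpleClosedCurve c) (t : ℝ) (n : ℤ) : c (t + n) = c t := by
  simpa using (show Function.Periodic c 1 from hc.periodic).int_mul n t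

theorem range_eq (hc : IsSimpleClosedCurve c) : range c = c '' Icc 0 1 := by
  refine Subset.antisymm ?_ (image_subset_range _ _)
  rintro _ ⟨t, rfl⟩
  refine ⟨Int.fract t, ⟨Int.fract_nonneg t, (Int.fract_lt_one t).le⟩, ?_⟩
  rw [← hc.add_int (Int.fract t) ⌊t⌋, Int.fract_add_floor]

theorem isCompact_range (hc : IsSimpleClosedCurve c) : IsCompact (range c) := by
  rw [hc.range_eq]
  exact isCompact_Icc.image hc.smooth.continuous

/-- Near a point of a regular curve the parameter extends to a smooth function. -/
theorem exists_local_parameter (hc : IsSimpleClosedCurve c) (t₀ : ℝ) :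
    ∃ q : M → ℝ, (∀ᶠ x in nhds (c t₀), ContMDiffAt (𝓡 2) 𝓘(ℝ, ℝ) ∞ q x) ∧
      ∀ᶠ t in nhds t₀, q (c t) = t := by
  have he := chartAt_mem (c t₀)
  have hx : c t₀ ∈ (chartAt Plane (c t₀)).source := mem_chart_source Plane (c t₀)
  generalize chartAt Plane (c t₀) = e at he hx
  have hsrc : ∀ᶠ t in nhds t₀, c t ∈ e.source :=
    hc.smooth.continuous.continuousAt.preimage_mem_nhds (e.open_source.mem_nhds hx)
  have hu : ∀ᶠ t in nhds t₀, ContDiffAt ℝ ∞ (e ∘ c) t := by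
    filter_upwards [hsrc] with t ht
    exact contDiffAt_chart_comp he le_rfl (hc.smooth t) ht
  have hne : deriv (e ∘ c) t₀ ≠ 0 := by
    rw [← mfderiv_symm_deriv he ((hc.smooth t₀).mdifferentiableAt (by simp)) hx]
    intro h
    exact hc.regular t₀ ((mdifferentiable_of_mem_maximalAtlas he).mfderiv_injective hx
      (h.trans (map_zero _).symm))
  let l : Plane →L[ℝ] ℝ := innerSL ℝ (deriv (e ∘ c) t₀)
  have hd : HasDerivAt (fun t => l ((e ∘ c) t)) (l (deriv (e ∘ c) t₀)) t₀ :=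
    l.hasFDerivAt.comp_hasDerivAt t₀
      (hu.self_of_nhds.differentiableAt (by simp)).hasDerivAt
  have hl : l (deriv (e ∘ c) t₀) ≠ 0 := by
    simpa [l] using hne
  obtain ⟨ψ, -, h1, U, hU, -, h2⟩ := exists_smooth_local_inverse
    (f := fun t => l ((e ∘ c) t)) (x := t₀)
    (f' := ContinuousLinearEquiv.unitsEquivAut ℝ (Units.mk0 _ hl)) (by
      filter_upwards [hu] with t ht
      exact l.contDiff.contDiffAt.comp t ht) (by
      refine hd.hasFDerivAt.congr_fderiv ?_
      ext
      simp)
  refine ⟨fun x => ψ (l (e x)), ?_, h2⟩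
  have h3 : Filter.Tendsto (fun x => l (e x)) (nhds (c t₀)) (nhds (l ((e ∘ c) t₀))) :=
    (l.continuous.continuousAt.comp (e.continuousAt hx))
  filter_upwards [e.open_source.mem_nhds hx, h3.eventually h1] with x hxe hψ
  exact hψ.1.contMDiffAt.comp x
    (l.contDiff.contDiffAt.contMDiffAt.comp x (contMDiffAt_of_mem_maximalAtlas he hxe))

/-- The parameter of a simple closed curve modulo `1`, as a point of the unit circle, extends to a
smooth function on the surface. -/
theorem exists_phase [T2Space M] [SecondCountableTopology M] (hc : IsSimpleClosedCurve c) :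
    ∃ P : M → ℂ, ContMDiff (𝓡 2) 𝓘(ℝ, ℂ) ∞ P ∧
      ∀ t : ℝ, P (c t) = Complex.exp (2 * Real.pi * t * Complex.I) := by
  have hexp : ∀ (t : ℝ) (n : ℤ), Complex.exp (2 * Real.pi * ((t + n : ℝ) : ℂ) * Complex.I)
      = Complex.exp (2 * Real.pi * t * Complex.I) := by
    intro t n
    rw [Complex.exp_eq_exp_iff_exists_int]
    exact ⟨n, by push_cast; ring⟩
  have : LocallyCompactSpace M := ChartedSpace.locallyCompactSpace Plane M
  suffices h : ∃ P : ContMDiffMap (𝓡 2) 𝓘(ℝ, ℂ) M ℂ ∞, ∀ x : M,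
      P x ∈ {z : ℂ | ∀ t : ℝ, c t = x → z = Complex.exp (2 * Real.pi * t * Complex.I)} by
    obtain ⟨P, hP⟩ := h
    exact ⟨P, P.contMDiff, fun t => hP (c t) t rfl⟩
  refine exists_contMDiffMap_forall_mem_convex_of_local (n := (⊤ : ℕ∞)) (𝓡 2) ?_ ?_
  · intro x z hz w hw a b _ _ hab t ht
    rw [hz t ht, hw t ht, ← add_smul, hab, one_smul]
  · intro x
    by_cases hx : x ∈ range c
    · obtain ⟨t₀, rfl⟩ := hx
      obtain ⟨q, hq, hqc⟩ := hc.exists_local_parameter t₀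
      obtain ⟨η, hη, hball⟩ := Metric.eventually_nhds_iff_ball.1 hqc
      -- the part of the curve with parameters away from `t₀` stays away from the point `c t₀`
      have hcpt : IsCompact (c '' Icc (t₀ + min (η / 2) (1 / 2)) (t₀ + 1 - min (η / 2) (1 / 2))) :=
        isCompact_Icc.image hc.smooth.continuous
      set ρ := min (η / 2) (1 / 2) with hρ
      have hρ0 : 0 < ρ := lt_min (by linarith) (by norm_num)
      have hρη : ρ < η := (min_le_left _ _).trans_lt (by linarith)
      have hnot : c t₀ ∉ c '' Icc (t₀ + ρ) (t₀ + 1 - ρ) := by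
        rintro ⟨t, ht, htt⟩
        obtain ⟨n, hn⟩ := hc.simple t t₀ htt
        have h1 : (-1 : ℝ) < n := by linarith [ht.2]
        have h2 : (n : ℝ) < 0 := by linarith [ht.1]
        have h1' : (-1 : ℤ) < n := by exact_mod_cast h1
        have h2' : n < (0 : ℤ) := by exact_mod_cast h2
        omega
      refine ⟨{x | ContMDiffAt (𝓡 2) 𝓘(ℝ, ℝ) ∞ q x} ∩ (c '' Icc (t₀ + ρ) (t₀ + 1 - ρ))ᶜ,
        Filter.inter_mem hq (hcpt.isClosed.isOpen_compl.mem_nhds hnot),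
        fun x => Complex.exp (2 * Real.pi * q x * Complex.I), ?_, ?_⟩
      · intro x hx
        have h1 : ContDiff ℝ ∞ (fun r : ℝ => Complex.exp (2 * Real.pi * r * Complex.I)) := by
          have : ContDiff ℝ ∞ (fun r : ℝ => (r : ℂ)) := Complex.ofRealCLM.contDiff
          fun_prop
        exact (h1.contDiffAt.contMDiffAt.comp x hx.1).contMDiffWithinAt
      · rintro x ⟨-, hx⟩ t rfl
        obtain ⟨n, hn⟩ : ∃ n : ℤ, t + n ∈ Ico (t₀ - ρ) (t₀ - ρ + 1) := by
          refine ⟨-⌊t - (t₀ - ρ)⌋, ?_, ?_⟩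
          · push_cast; linarith [Int.floor_le (t - (t₀ - ρ))]
          · push_cast; linarith [Int.lt_floor_add_one (t - (t₀ - ρ))]
        have hlt : t + n < t₀ + ρ := by
          by_contra hge
          exact hx ⟨t + n, ⟨not_lt.1 hge, by linarith [hn.2]⟩, hc.add_int t n⟩
        have h1 := hball (t + n) (by
          rw [Real.ball_eq_Ioo]; exact ⟨by linarith [hn.1], by linarith⟩)
        rw [hc.add_int] at h1
        dsimp only
        rw [h1]
        exact hexp t n
    · exact ⟨(range c)ᶜ, hc.isCompact_range.isClosed.isOpen_compl.mem_nhds hx, fun _ => 0,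
        contMDiffOn_const, fun y hy t ht => (hy ⟨t, ht⟩).elim⟩

end IsSimpleClosedCurve

end
section
variable {M : Type*} [TopologicalSpace M] [ChartedSpace Plane M] [IsManifold (𝓡 2) ∞ M]

/-! ### The collar -/

/-- The direction of the complex number `P x`, together with `l x`. With `P` a phase around a closed
curve and `l` a defining function of this curve, these are coordinates near the curve. -/
noncomputable def phaseLevel (P : M → ℂ) (l : M → ℝ) (x : M) : ℂ × ℝ := (P x / ‖P x‖, l x)

/-- The universal covering of the cylinder. -/
noncomputable def circleLevel (p : ℝ × ℝ) : ℂ × ℝ :=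
  (Complex.exp (2 * Real.pi * p.1 * Complex.I), p.2)

theorem circleLevel_add_int (t s : ℝ) (n : ℤ) : circleLevel (t + n, s) = circleLevel (t, s) := by
  refine Prod.ext ?_ rfl
  change Complex.exp _ = Complex.exp _
  rw [Complex.exp_eq_exp_iff_exists_int]
  exact ⟨n, by push_cast; ring⟩

theorem circleLevel_eq_iff {t s t' s' : ℝ} (h : circleLevel (t, s) = circleLevel (t', s')) :
    s = s' ∧ ∃ n : ℤ, t' = t + n := by
  obtain ⟨h1, h2⟩ := Prod.ext_iff.1 h
  refine ⟨h2, ?_⟩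
  obtain ⟨n, hn⟩ := Complex.exp_eq_exp_iff_exists_int.1 h1
  refine ⟨-n, ?_⟩
  have h3 : (2 * Real.pi * Complex.I) * (t : ℂ) = (2 * Real.pi * Complex.I) * (t' + n) := by
    linear_combination hn
  have h4 : (t : ℂ) = t' + n := mul_left_cancel₀ (by simp [Real.pi_ne_zero]) h3
  have h5 : t = t' + n := by exact_mod_cast h4
  push_cast
  linarith

theorem arg_mul_eq (w k : ℂ) : (w * k).arg = (w / ‖w‖ * k).arg := by
  by_cases hw : w = 0
  · simp [hw]
  have h1 : 0 < ‖w‖ := norm_pos_iff.2 hw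
  have h2 : (‖w‖ : ℂ) ≠ 0 := by exact_mod_cast h1.ne'
  have h3 : w * k = (‖w‖ : ℂ) * (w / ‖w‖ * k) := by field_simp
  rw [h3, Complex.arg_real_mul _ h1]

theorem div_norm_eq_exp {w : ℂ} (hw : w ≠ 0) {α β : ℝ}
    (h : (w * Complex.exp (-(α * Complex.I))).arg = β) :
    w / ‖w‖ = Complex.exp ((α + β) * Complex.I) := by
  have h1 : (‖w‖ : ℂ) ≠ 0 := by exact_mod_cast (norm_pos_iff.2 hw).ne'
  have h2 := Complex.norm_mul_exp_arg_mul_I (w * Complex.exp (-(α * Complex.I)))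
  have h3 : ‖Complex.exp (-(α * Complex.I))‖ = 1 := by
    rw [← neg_mul, ← Complex.ofReal_neg, Complex.norm_exp_ofReal_mul_I]
  rw [h, norm_mul, h3, mul_one] at h2
  rw [div_eq_iff h1, add_mul, Complex.exp_add, mul_assoc, mul_comm _ (‖w‖ : ℂ), h2]
  rw [mul_comm, mul_assoc, ← Complex.exp_add, neg_add_cancel, Complex.exp_zero, mul_one]

/-- A function composed with `Φ` is stationary in the directions in the kernel of the derivative of
`Φ`. -/
theorem hasDerivAt_comp_line_of_mfderiv_eq_zero {E : Type*} [NormedAddCommGroup E]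
    [NormedSpace ℝ E] {Φ : ℝ × ℝ → M} {p v : ℝ × ℝ} {u : M → E}
    (hΦ : MDifferentiableAt 𝓘(ℝ, ℝ × ℝ) (𝓡 2) Φ p)
    (hu : MDifferentiableAt (𝓡 2) 𝓘(ℝ, E) u (Φ p))
    (hv : mfderiv 𝓘(ℝ, ℝ × ℝ) (𝓡 2) Φ p v = 0) :
    HasDerivAt (fun τ : ℝ => u (Φ (p + τ • v))) 0 0 := by
  have h1 : HasFDerivAt (u ∘ Φ) _ p := (hu.hasMFDerivAt.comp p hΦ.hasMFDerivAt).hasFDerivAt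
  have h2 : HasDerivAt (fun τ : ℝ => p + τ • v) v 0 := by
    simpa using ((hasDerivAt_id (0 : ℝ)).smul_const v).const_add p
  have h3 : p = p + (0 : ℝ) • v := by simp
  rw [h3] at h1
  refine (HasFDerivAt.comp_hasDerivAt (F := ℝ × ℝ) (E := E) (0 : ℝ) h1 h2).congr_deriv ?_
  rw [← h3]
  change mfderiv (𝓡 2) 𝓘(ℝ, E) u (Φ p) (mfderiv 𝓘(ℝ, ℝ × ℝ) (𝓡 2) Φ p v) = 0
  rw [hv, map_zero]

namespace IsSimpleClosedCurve

variable {c : ℝ → M}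

/-- Near a point of the curve the phase and the level are local coordinates: their joint map is
injective there, and its composition with a smooth `ψ` is the covering of the cylinder. -/
theorem exists_local_collar (hc : IsSimpleClosedCurve c) {P : M → ℂ}
    (hP : ContMDiff (𝓡 2) 𝓘(ℝ, ℂ) ∞ P)
    (hPc : ∀ t : ℝ, P (c t) = Complex.exp (2 * Real.pi * t * Complex.I)) {l : M → ℝ}
    (hl : ∀ t, ∀ᶠ x in nhds (c t), ContMDiffAt (𝓡 2) 𝓘(ℝ, ℝ) ∞ l x) (hl0 : ∀ t, l (c t) = 0)
    (hdl : ∀ t, ∃ v : TangentSpace (𝓡 2) (c t), (mfderiv (𝓡 2) 𝓘(ℝ, ℝ) l (c t) v : ℝ) ≠ 0)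
    (t₀ : ℝ) :
    (∃ U ∈ nhds (c t₀), InjOn (phaseLevel P l) U) ∧
      ∃ ψ : ℝ × ℝ → M, ψ (t₀, 0) = c t₀ ∧ ∀ᶠ p in nhds ((t₀, 0) : ℝ × ℝ),
        ContMDiffAt 𝓘(ℝ, ℝ × ℝ) (𝓡 2) ∞ ψ p ∧ phaseLevel P l (ψ p) = circleLevel p := by
  have he := chartAt_mem (c t₀)
  have hx : c t₀ ∈ (chartAt Plane (c t₀)).source := mem_chart_source Plane (c t₀)
  generalize chartAt Plane (c t₀) = e at he hx
  have hy : e (c t₀) ∈ e.target := e.map_source hx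
  have hsymm : Filter.Tendsto e.symm (nhds (e (c t₀))) (nhds (c t₀)) := by
    simpa [e.left_inv hx] using (e.continuousAt_symm hy).tendsto
  -- near `c t₀` the phase is replaced by a real coordinate, an angle measured from `t₀`
  let z : M → ℂ := fun x => P x * Complex.exp (-(2 * Real.pi * t₀ * Complex.I))
  let θ : M → ℝ := fun x => t₀ + (Complex.log (z x)).im / (2 * Real.pi)
  let L : Plane → ℝ × ℝ := fun y => (θ (e.symm y), l (e.symm y))
  have hzsm : ContMDiff (𝓡 2) 𝓘(ℝ, ℂ) ∞ z := by
    have h1 : ContDiff ℝ ∞ (fun w : ℂ => w * Complex.exp (-(2 * Real.pi * t₀ * Complex.I))) := by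
      fun_prop
    exact h1.contMDiff.comp hP
  have hz : ∀ᶠ x in nhds (c t₀), z x ∈ Complex.slitPlane := by
    apply hzsm.continuous.continuousAt.eventually
    apply Complex.isOpen_slitPlane.mem_nhds
    simp only [z]
    rw [hPc, ← Complex.exp_add, add_neg_cancel, Complex.exp_zero]
    exact Complex.one_mem_slitPlane
  have hθsm : ∀ x, z x ∈ Complex.slitPlane → ContMDiffAt (𝓡 2) 𝓘(ℝ, ℝ) ∞ θ x := by
    intro x hx
    have h1 : ContDiffAt ℝ ∞ (fun w : ℂ => t₀ + (Complex.log w).im / (2 * Real.pi)) (z x) := by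
      have h2 : ContDiffAt ℝ ∞ Complex.log (z x) := (Complex.contDiffAt_log hx).restrict_scalars ℝ
      have h3 : ContDiffAt ℝ ∞ (fun w => (Complex.log w).im) (z x) :=
        Complex.imCLM.contDiff.contDiffAt.comp (z x) h2
      exact contDiffAt_const.add (h3.div_const _)
    exact h1.contMDiffAt.comp x (hzsm x)
  have hLsm : ∀ᶠ y in nhds (e (c t₀)), ContDiffAt ℝ ∞ L y := by
    filter_upwards [e.open_target.mem_nhds hy, hsymm.eventually hz, hsymm.eventually (hl t₀)]
      with y hy h1 h2
    have h3 := (contMDiffOn_symm_of_mem_maximalAtlas he).contMDiffAt (e.open_target.mem_nhds hy)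
    exact (((hθsm _ h1).comp y h3).contDiffAt).prodMk ((h2.comp y h3).contDiffAt)
  have hL0 : HasFDerivAt L (fderiv ℝ L (e (c t₀))) (e (c t₀)) :=
    (hLsm.self_of_nhds.differentiableAt (by simp)).hasFDerivAt
  have hLc : ∀ᶠ t in nhds t₀, L ((e ∘ c) t) = (t, 0) := by
    have hsrc : ∀ᶠ t in nhds t₀, c t ∈ e.source :=
      hc.smooth.continuous.continuousAt.preimage_mem_nhds (e.open_source.mem_nhds hx)
    filter_upwards [hsrc, Metric.ball_mem_nhds t₀ (show (0 : ℝ) < 1 / 2 by norm_num)] with t ht ht'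
    rw [Real.ball_eq_Ioo] at ht'
    simp only [L, Function.comp_apply, e.left_inv ht, hl0]
    refine Prod.ext ?_ rfl
    simp only [θ, z]
    rw [hPc, ← Complex.exp_add]
    have h1 : 2 * Real.pi * t * Complex.I + -(2 * Real.pi * t₀ * Complex.I)
        = ((2 * Real.pi * (t - t₀) : ℝ) : ℂ) * Complex.I := by push_cast; ring
    have h2 : (((2 * Real.pi * (t - t₀) : ℝ) : ℂ) * Complex.I).im = 2 * Real.pi * (t - t₀) := by
      simp
    have hpi := Real.pi_pos
    rw [h1, Complex.log_exp, h2]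
    · field_simp
      ring
    · rw [h2]; nlinarith [ht'.1]
    · rw [h2]; nlinarith [ht'.2]
  obtain ⟨u', hu'⟩ : ∃ u' : Plane, HasDerivAt (e ∘ c) u' t₀ :=
    ⟨_, (hasDerivAt_deriv_chart he (hc.smooth t₀) hx).1⟩
  have hDu : fderiv ℝ L (e (c t₀)) u' = (1, 0) := by
    have h1 : HasDerivAt (fun t => L ((e ∘ c) t)) (fderiv ℝ L (e (c t₀)) u') t₀ :=
      HasFDerivAt.comp_hasDerivAt (F := Plane) (E := ℝ × ℝ) (f := e ∘ c) (l := L) t₀ hL0 hu'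
    have h2 : HasDerivAt (fun t : ℝ => (t, (0 : ℝ))) ((1 : ℝ), (0 : ℝ)) t₀ :=
      (hasDerivAt_id t₀).prodMk (hasDerivAt_const t₀ 0)
    exact h1.unique (h2.congr_of_eventuallyEq hLc)
  obtain ⟨v, hv⟩ : ∃ v : Plane, (fderiv ℝ L (e (c t₀)) v).2 ≠ 0 := by
    obtain ⟨v, hv⟩ := hdl t₀
    refine ⟨mfderiv (𝓡 2) (𝓡 2) e (c t₀) v, ?_⟩
    rw [mfderiv_eq_fderiv_chart ((hl t₀).self_of_nhds.mdifferentiableAt (by simp)) he hx] at hv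
    have h1 : HasFDerivAt (fun y => l (e.symm y))
        ((ContinuousLinearMap.snd ℝ ℝ ℝ).comp (fderiv ℝ L (e (c t₀)))) (e (c t₀)) :=
      (ContinuousLinearMap.snd ℝ ℝ ℝ).hasFDerivAt.comp (e (c t₀)) hL0
    rw [h1.fderiv] at hv
    exact hv
  have hsurj : Function.Surjective (fderiv ℝ L (e (c t₀))) := by
    rintro ⟨a, b⟩
    set w := fderiv ℝ L (e (c t₀)) v with hw
    refine ⟨(a - w.1 * (b / w.2)) • u' + (b / w.2) • v, ?_⟩
    rw [map_add, map_smul, map_smul, hDu, ← hw]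
    ext
    · simp; ring
    · simp [div_mul_cancel₀ _ hv]
  have hinj : Function.Injective (fderiv ℝ L (e (c t₀))) :=
    (LinearMap.injective_iff_surjective_of_finrank_eq_finrank
      (f := (fderiv ℝ L (e (c t₀))).toLinearMap) (by simp)).2 hsurj
  let D : Plane ≃L[ℝ] ℝ × ℝ := (LinearEquiv.ofBijective (fderiv ℝ L (e (c t₀))).toLinearMap
    ⟨hinj, hsurj⟩).toContinuousLinearEquiv
  have hLy : L (e (c t₀)) = (t₀, 0) := hLc.self_of_nhds
  obtain ⟨ψ, hψ0, hψ, U, hU, hUinj, -⟩ := exists_smooth_local_inverse (f' := D) hLsm hL0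
  rw [hLy] at hψ0 hψ
  constructor
  · refine ⟨e.source ∩ e ⁻¹' U, Filter.inter_mem (e.open_source.mem_nhds hx)
      ((e.continuousAt hx).preimage_mem_nhds hU), ?_⟩
    rintro x ⟨hxs, hxU⟩ x' ⟨hxs', hxU'⟩ heq
    obtain ⟨h1, h2⟩ := Prod.ext_iff.1 heq
    refine e.injOn hxs hxs' (hUinj hxU hxU' ?_)
    simp only [L, θ, z, e.left_inv hxs, e.left_inv hxs', Complex.log_im]
    rw [arg_mul_eq (P x), arg_mul_eq (P x'), show P x / ‖P x‖ = P x' / ‖P x'‖ from h1,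
      show l x = l x' from h2]
  · refine ⟨fun p => e.symm (ψ p), by simp only [hψ0, e.left_inv hx], ?_⟩
    have hψc : Filter.Tendsto ψ (nhds (t₀, 0)) (nhds (e (c t₀))) := by
      have := hψ.self_of_nhds.1.continuousAt.tendsto
      rwa [hψ0] at this
    filter_upwards [hψ, hψc.eventually (e.open_target.mem_nhds hy),
      (hsymm.comp hψc).eventually hz] with p h1 h2 h3
    refine ⟨((contMDiffOn_symm_of_mem_maximalAtlas he).contMDiffAt
      (e.open_target.mem_nhds h2)).comp p h1.1.contMDiffAt, ?_⟩
    have hp := h1.2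
    obtain ⟨h4, h5⟩ := Prod.ext_iff.1 hp
    refine Prod.ext ?_ h5
    have h6 : (Complex.log (z (e.symm (ψ p)))).im = 2 * Real.pi * (p.1 - t₀) := by
      have hpi := Real.pi_pos
      rw [← show θ (e.symm (ψ p)) = p.1 from h4]
      simp only [θ]
      field_simp
      ring
    rw [Complex.log_im] at h6
    have h7 : P (e.symm (ψ p)) ≠ 0 := left_ne_zero_of_mul (Complex.slitPlane_ne_zero h3)
    have h8 := div_norm_eq_exp h7 (α := 2 * Real.pi * t₀) (β := 2 * Real.pi * (p.1 - t₀)) (by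
      rw [← h6]
      simp only [z]
      push_cast
      rfl)
    refine h8.trans (congrArg Complex.exp ?_)
    push_cast
    ring

/-- Existence of a collar whose transversal coordinate is a given defining function `l` of the
curve. The last statement expresses that the collar covers the points of the open set `N` at which
`l` is small. -/
theorem exists_collar [T2Space M] [SecondCountableTopology M] (hc : IsSimpleClosedCurve c)
    {l : M → ℝ} {Ω : Set M} (hΩ : IsOpen Ω) (hcΩ : ∀ t, c t ∈ Ω)
    (hl : ∀ x ∈ Ω, ContMDiffAt (𝓡 2) 𝓘(ℝ, ℝ) ∞ l x) (hl0 : ∀ t, l (c t) = 0)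
    (hdl : ∀ t, ∃ v : TangentSpace (𝓡 2) (c t), (mfderiv (𝓡 2) 𝓘(ℝ, ℝ) l (c t) v : ℝ) ≠ 0) :
    ∃ (ε : ℝ) (N : Set M) (Φ : ℝ × ℝ → M), 0 < ε ∧ IsOpen N ∧ N ⊆ Ω ∧
      (∀ t, ∀ s ∈ Ioo (-ε) ε, ContMDiffAt 𝓘(ℝ, ℝ × ℝ) (𝓡 2) ∞ Φ (t, s) ∧ Φ (t, s) ∈ N ∧
        l (Φ (t, s)) = s ∧
        Function.Injective (mfderiv 𝓘(ℝ, ℝ × ℝ) (𝓡 2) Φ (t, s))) ∧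
      (∀ t s, Φ (t + 1, s) = Φ (t, s)) ∧
      (∀ t t', ∀ s ∈ Ioo (-ε) ε, ∀ s' ∈ Ioo (-ε) ε, Φ (t, s) = Φ (t', s') →
        s = s' ∧ ∃ n : ℤ, t' = t + n) ∧
      (∀ t, Φ (t, 0) = c t) ∧
      ∀ x ∈ N, l x ∈ Ioo (-ε) ε → ∃ t, Φ (t, l x) = x := by
  obtain ⟨P, hP, hPc⟩ := hc.exists_phase
  have hl' : ∀ t, ∀ᶠ x in nhds (c t), ContMDiffAt (𝓡 2) 𝓘(ℝ, ℝ) ∞ l x := fun t => by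
    filter_upwards [hΩ.mem_nhds (hcΩ t)] with x hx using hl x hx
  have hloc := hc.exists_local_collar hP hPc hl' hl0 hdl
  have hPne : ∀ t, P (c t) ≠ 0 := fun t => by rw [hPc]; exact Complex.exp_ne_zero _
  have hFc : ∀ t, phaseLevel P l (c t) = circleLevel (t, 0) := by
    intro t
    obtain ⟨-, ψ, h1, h2⟩ := hloc t
    have := h2.self_of_nhds.2
    rwa [h1] at this
  -- an open neighbourhood of the curve on which phase and level separate points
  obtain ⟨N, hNo, hcN, hNΩ, hNinj, hNP⟩ : ∃ N : Set M, IsOpen N ∧ (∀ t, c t ∈ N) ∧ N ⊆ Ω ∧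
      InjOn (phaseLevel P l) N ∧ ∀ x ∈ N, P x ≠ 0 := by
    obtain ⟨T, hT, hTinj⟩ := Set.InjOn.exists_mem_nhdsSet (f := phaseLevel P l) (s := range c)
      (by
        rintro _ ⟨t, rfl⟩ _ ⟨t', rfl⟩ h
        rw [hFc, hFc] at h
        obtain ⟨-, n, hn⟩ := circleLevel_eq_iff h
        rw [hn, hc.add_int])
      hc.isCompact_range
      (by
        rintro _ ⟨t, rfl⟩
        refine ContinuousAt.prodMk ?_ (hl _ (hcΩ t)).continuousAt
        refine hP.continuous.continuousAt.div
          (Complex.continuous_ofReal.comp hP.continuous.norm).continuousAt ?_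
        simpa using hPne t)
      (by rintro _ ⟨t, rfl⟩; exact (hloc t).1)
    refine ⟨interior T ∩ Ω ∩ {x | P x ≠ 0}, (isOpen_interior.inter hΩ).inter
      (isOpen_compl_singleton.preimage hP.continuous), fun t => ⟨⟨?_, hcΩ t⟩, hPne t⟩,
      fun x hx => hx.1.2, hTinj.mono fun x hx => interior_subset hx.1.1, fun x hx => hx.2⟩
    exact mem_interior_iff_mem_nhds.2 (mem_nhdsSet_iff_forall.1 hT (c t) ⟨t, rfl⟩)
  have : Nonempty M := ⟨c 0⟩
  let Φ : ℝ × ℝ → M := fun p => Function.invFunOn (phaseLevel P l) N (circleLevel p)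
  have hΦeq : ∀ x ∈ N, ∀ p, phaseLevel P l x = circleLevel p → Φ p = x := by
    intro x hx p hxp
    have hex : ∃ x ∈ N, phaseLevel P l x = circleLevel p := ⟨x, hx, hxp⟩
    exact hNinj (Function.invFunOn_mem hex) hx ((Function.invFunOn_eq hex).trans hxp.symm)
  have hΦint : ∀ t s (n : ℤ), Φ (t + n, s) = Φ (t, s) := fun t s n => by
    simp only [Φ, circleLevel_add_int]
  let Q : ℝ × ℝ → Prop := fun p => ContMDiffAt 𝓘(ℝ, ℝ × ℝ) (𝓡 2) ∞ Φ p ∧ Φ p ∈ N ∧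
    phaseLevel P l (Φ p) = circleLevel p
  have hQ0 : ∀ t, ∀ᶠ p in nhds ((t, 0) : ℝ × ℝ), Q p := by
    intro t
    obtain ⟨-, ψ, h1, h2⟩ := hloc t
    have h3 : ∀ᶠ p in nhds ((t, 0) : ℝ × ℝ), ψ p ∈ N :=
      h2.self_of_nhds.1.continuousAt.eventually (by rw [h1]; exact hNo.mem_nhds (hcN t))
    have h4 : ∀ᶠ p in nhds ((t, 0) : ℝ × ℝ), Φ p = ψ p := by
      filter_upwards [h2, h3] with p h h'
      exact hΦeq _ h' _ h.2
    filter_upwards [h2, h3, h4.eventually_nhds] with p h5 h6 h7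
    refine ⟨h5.1.congr_of_eventuallyEq h7, ?_, ?_⟩
    · rw [h7.self_of_nhds]; exact h6
    · rw [h7.self_of_nhds]; exact h5.2
  obtain ⟨ε, hε, hQε⟩ : ∃ ε > 0, ∀ s ∈ Ioo (-ε) ε, ∀ t ∈ Icc (0 : ℝ) 1, Q (t, s) := by
    have h1 : ∀ᶠ s in nhds (0 : ℝ), ∀ t ∈ Icc (0 : ℝ) 1, Q (t, s) := by
      refine isCompact_Icc.eventually_forall_of_forall_eventually fun t _ => ?_
      exact (continuous_swap.continuousAt (x := ((0 : ℝ), t))).eventually (hQ0 t)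
    obtain ⟨ε, hε, h2⟩ := Metric.eventually_nhds_iff_ball.1 h1
    refine ⟨ε, hε, fun s hs => h2 s ?_⟩
    rw [Real.ball_eq_Ioo]
    simpa using hs
  have hQ : ∀ t, ∀ s ∈ Ioo (-ε) ε, Q (t, s) := by
    intro t s hs
    have h1 := hQε s hs (Int.fract t) ⟨Int.fract_nonneg t, (Int.fract_lt_one t).le⟩
    have h2 : Φ (t, s) = Φ (Int.fract t, s) := by
      rw [← hΦint (Int.fract t) s ⌊t⌋, Int.fract_add_floor]
    refine ⟨?_, by rw [h2]; exact h1.2.1, ?_⟩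
    · have h3 : ContMDiffAt 𝓘(ℝ, ℝ × ℝ) 𝓘(ℝ, ℝ × ℝ) ∞
          (fun p : ℝ × ℝ => (p.1 - (⌊t⌋ : ℝ), p.2)) (t, s) := by
        apply ContDiffAt.contMDiffAt
        fun_prop
      have h4 := ContMDiffAt.comp (t, s) (g := Φ)
        (f := fun p : ℝ × ℝ => (p.1 - (⌊t⌋ : ℝ), p.2)) h1.1 h3
      refine h4.congr_of_eventuallyEq (Filter.Eventually.of_forall fun p => ?_)
      have := hΦint (p.1 - ⌊t⌋) p.2 ⌊t⌋
      rwa [sub_add_cancel] at this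
    · rw [h2, h1.2.2, ← circleLevel_add_int (Int.fract t) s ⌊t⌋, Int.fract_add_floor]
  have hlev : ∀ t, ∀ s ∈ Ioo (-ε) ε, l (Φ (t, s)) = s := fun t s hs =>
    congrArg Prod.snd (hQ t s hs).2.2
  have hpha : ∀ t, ∀ s ∈ Ioo (-ε) ε, P (Φ (t, s)) / ‖P (Φ (t, s))‖
      = Complex.exp (2 * Real.pi * t * Complex.I) := fun t s hs =>
    congrArg Prod.fst (hQ t s hs).2.2
  refine ⟨ε, N, Φ, hε, hNo, hNΩ, fun t s hs => ⟨(hQ t s hs).1, (hQ t s hs).2.1, hlev t s hs, ?_⟩,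
    fun t s => by simpa using hΦint t s 1, ?_, ?_, ?_⟩
  · refine (injective_iff_map_eq_zero _).2 fun v hv => ?_
    obtain ⟨a, b⟩ : ℝ × ℝ := v
    have hΦd := (hQ t s hs).1.mdifferentiableAt (by simp)
    have hNΦ := (hQ t s hs).2.1
    have hev : ∀ᶠ τ in nhds (0 : ℝ), s + τ * b ∈ Ioo (-ε) ε := by
      have : ContinuousAt (fun τ : ℝ => s + τ * b) 0 := by fun_prop
      exact this.eventually (isOpen_Ioo.mem_nhds (by simpa using hs))
    have hb : b = 0 := by
      have h1 := hasDerivAt_comp_line_of_mfderiv_eq_zero hΦd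
        ((hl _ (hNΩ hNΦ)).mdifferentiableAt (by simp)) hv
      have h2 : HasDerivAt (fun τ : ℝ => s + τ * b) b 0 := by
        simpa using ((hasDerivAt_id (0 : ℝ)).mul_const b).const_add s
      refine h2.unique (h1.congr_of_eventuallyEq ?_)
      filter_upwards [hev] with τ hτ using (hlev (t + τ * a) _ hτ).symm
    -- rotated back by its own phase, `P ∘ Φ` is real, so it cannot be constant along `t`
    have ha : a = 0 := by
      have h1 := hasDerivAt_comp_line_of_mfderiv_eq_zero hΦd (hP.mdifferentiable (by simp) _) hv
      have h2 : HasDerivAt (fun τ : ℝ => Complex.exp (-(2 * Real.pi * ((t + τ * a : ℝ) : ℂ)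
          * Complex.I))) (Complex.exp (-(2 * Real.pi * t * Complex.I))
            * -(2 * Real.pi * a * Complex.I)) 0 := by
        have h3 : HasDerivAt (fun τ : ℝ => t + τ * a) a 0 := by
          simpa using ((hasDerivAt_id (0 : ℝ)).mul_const a).const_add t
        have h4 := ((h3.ofReal_comp.const_mul (2 * Real.pi : ℂ)).mul_const Complex.I).neg.cexp
        simpa using h4
      have h5 := (Complex.imCLM.hasFDerivAt.comp_hasDerivAt (0 : ℝ) (h1.mul h2))
      have h6 : HasDerivAt (fun _ : ℝ => (0 : ℝ)) _ 0 := h5.congr_of_eventuallyEq (by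
        filter_upwards [hev] with τ hτ
        have h7 := hpha (t + τ * a) _ hτ
        have h8 : (‖P (Φ (t + τ * a, s + τ * b))‖ : ℂ) ≠ 0 := by
          have := norm_pos_iff.2 (hNP _ (hQ (t + τ * a) _ hτ).2.1)
          exact_mod_cast this.ne'
        rw [div_eq_iff h8] at h7
        have h9 : ((t, s) : ℝ × ℝ) + τ • (a, b) = (t + τ * a, s + τ * b) := rfl
        simp only [Function.comp_apply, Pi.mul_apply, h9]
        rw [h7, mul_assoc, mul_comm (‖P (Φ (t + τ * a, s + τ * b))‖ : ℂ), ← mul_assoc,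
          ← Complex.exp_add]
        simp)
      have h7 := h6.unique (hasDerivAt_const 0 0)
      have h8 := hpha t s hs
      have h9 := norm_pos_iff.2 (hNP _ hNΦ)
      generalize ‖P (Φ (t, s))‖ = n at h8 h9
      have h10 : (n : ℂ) ≠ 0 := by exact_mod_cast h9.ne'
      rw [div_eq_iff h10] at h8
      have h11 : P (Φ (t, s)) * (Complex.exp (-(2 * Real.pi * t * Complex.I))
          * -(2 * Real.pi * a * Complex.I)) = ((-(2 * Real.pi * a * n) : ℝ) : ℂ)
            * Complex.I := by
        rw [h8, mul_mul_mul_comm, ← Complex.exp_add, add_neg_cancel, Complex.exp_zero]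
        push_cast
        ring
      simp only [zero_smul, add_zero, zero_mul, zero_add] at h7
      rw [h11] at h7
      simpa [Real.pi_ne_zero, h9.ne'] using h7
    rw [ha, hb]
    rfl
  · intro t t' s hs s' hs' h
    have := congrArg (phaseLevel P l) h
    rw [(hQ t s hs).2.2, (hQ t' s' hs').2.2] at this
    exact circleLevel_eq_iff this
  · exact fun t => hΦeq _ (hcN t) _ (hFc t)
  · intro x hx hxl
    have h1 := hNP x hx
    refine ⟨(P x).arg / (2 * Real.pi), hΦeq x hx _ (Prod.ext ?_ rfl)⟩
    have h2 := div_norm_eq_exp h1 (α := 0) (β := (P x).arg) (by simp)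
    refine h2.trans (congrArg Complex.exp ?_)
    have hpi : (Real.pi : ℂ) ≠ 0 := by exact_mod_cast Real.pi_pos.ne'
    push_cast
    field_simp
    ring

end IsSimpleClosedCurve

end
section
variable {M : Type*} [TopologicalSpace M] [ChartedSpace Plane M] [IsManifold (𝓡 2) ∞ M]

/-! ### The integral of motion -/

/-- The ratio of the quadratic integral and the energy, a function of the direction of motion. -/
noncomputable def ratio (g : Metric M) (S : QuadraticField M) (z : TangentBundle (𝓡 2) M) : ℝ :=
  S.form z.1 z.2 z.2 / g.inner z.1 z.2 z.2

theorem eigen_le_ratio (g : Metric M) (S : QuadraticField M) {z : TangentBundle (𝓡 2) M}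
    (hz : z.2 ≠ 0) : eigen g S z.1 ≤ ratio g S z :=
  (le_div_iff₀ (g.pos z.1 z.2 hz)).2 (eigen_mul_le g S z.1 z.2)

theorem contMDiffOn_ratio (g : Metric M) (S : QuadraticField M) :
    ContMDiffOn (𝓡 2).tangent 𝓘(ℝ, ℝ) ∞ (ratio g S) {z | z.2 ≠ 0} :=
  (contMDiff_quadratic S).contMDiffOn.div₀ (contMDiff_quadratic (metricField g)).contMDiffOn
    fun z hz => (g.pos z.1 z.2 hz).ne'

theorem ratio_smul (g : Metric M) (S : QuadraticField M) (x : M) (v : TangentSpace (𝓡 2) x) {r : ℝ}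
    (hr : r ≠ 0) : ratio g S ⟨x, r • v⟩ = ratio g S ⟨x, v⟩ := by
  simp only [ratio, map_smul, smul_apply, smul_eq_mul]
  rw [mul_div_mul_left _ _ hr, mul_div_mul_left _ _ hr]

namespace IsEigenWall

variable {g : Metric M} {S : QuadraticField M} {c : ℝ → M} {ν : ∀ x : M, TangentSpace (𝓡 2) x}

/-- On the wall the integral is a combination of the energy and the square of the normal
component of the velocity. -/
theorem form_eq (h : IsEigenWall g S c ν) (t : ℝ) (v : TangentSpace (𝓡 2) (c t)) :
    S.form (c t) v v = eigen g S (c t) * g.inner (c t) v v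
      + (S.form (c t) (ν (c t)) (ν (c t)) - eigen g S (c t)) * g.inner (c t) v (ν (c t)) ^ 2 := by
  obtain ⟨a, ha⟩ := h.eq_smul_add t v
  generalize g.inner (c t) v (ν (c t)) = b at ha
  have h1 : S.form (c t) (vel c t) (ν (c t)) = 0 := by
    rw [form_eq_of_eigen (h.eigen_eq t), h.normal t, mul_zero]
  have h2 := h.normal t
  have h3 : g.inner (c t) (ν (c t)) (vel c t) = 0 := by rw [g.symm, h2]
  have h4 : S.form (c t) (ν (c t)) (vel c t) = 0 := by rw [S.symm, h1]
  rw [ha]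
  simp only [map_add, map_smul, add_apply, smul_apply, smul_eq_mul, h1, h2, h3, h4, h.unit t,
    h.eigen_eq t]
  ring

/-- The integral as a function of the sine of the angle with the wall. -/
theorem ratio_eq (h : IsEigenWall g S c ν) (t : ℝ) {v : TangentSpace (𝓡 2) (c t)} (hv : v ≠ 0) :
    ratio g S ⟨c t, v⟩ = eigen g S (c t) + (S.form (c t) (ν (c t)) (ν (c t)) - eigen g S (c t))
      * (g.inner (c t) v (ν (c t)) / √(g.inner (c t) v v)) ^ 2 := by
  have hpos := g.pos (c t) v hv
  rw [div_pow, Real.sq_sqrt hpos.le, ratio, div_eq_iff hpos.ne', h.form_eq t v, add_mul, mul_assoc,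
    div_mul_cancel₀ _ hpos.ne']

theorem ratio_reflect (h : IsEigenWall g S c ν) {z : TangentBundle (𝓡 2) M} (hz : z.1 ∈ range c) :
    ratio g S (reflect g ν z) = ratio g S z := by
  obtain ⟨x, v⟩ := z
  obtain ⟨t, rfl⟩ : ∃ t, c t = x := hz
  have h1 : g.inner (c t) (v - (2 * g.inner (c t) v (ν (c t))) • ν (c t))
      (v - (2 * g.inner (c t) v (ν (c t))) • ν (c t)) = g.inner (c t) v v := by
    simp only [map_sub, map_smul, sub_apply, smul_apply, smul_eq_mul, h.unit t,
      g.symm (c t) (ν (c t)) v]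
    ring
  have h2 : g.inner (c t) (v - (2 * g.inner (c t) v (ν (c t))) • ν (c t)) (ν (c t))
      = -g.inner (c t) v (ν (c t)) := by
    simp only [map_sub, map_smul, sub_apply, smul_apply, smul_eq_mul, h.unit t]
    ring
  change S.form (c t) (v - (2 * g.inner (c t) v (ν (c t))) • ν (c t))
      (v - (2 * g.inner (c t) v (ν (c t))) • ν (c t))
      / g.inner (c t) (v - (2 * g.inner (c t) v (ν (c t))) • ν (c t))
      (v - (2 * g.inner (c t) v (ν (c t))) • ν (c t)) = S.form (c t) v v / g.inner (c t) v v
  rw [h.form_eq t, h.form_eq t v, h1, h2, neg_sq]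

end IsEigenWall

namespace Trajectory

variable {g : Metric M} {S : QuadraticField M} {c : ℝ → M} {ν : ∀ x : M, TangentSpace (𝓡 2) x}
  {N : ℕ} (T : Trajectory g c ν N)

theorem speed_pos {i : ℕ} (hi : i < N) {t : ℝ} (ht : t ∈ Icc (T.time i) (T.time (i + 1))) :
    0 < g.inner (T.arc i t) (vel (T.arc i) t) (vel (T.arc i) t) := by
  rw [(T.geodesic i hi).speed_eq ht (left_mem_Icc.2 (T.time_lt i hi).le)]
  refine g.pos _ _ fun h0 => (T.start_inward i hi).ne' ?_
  change g.inner _ (vel (T.arc i) (T.time i)) _ = 0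
  rw [h0, map_zero]
  rfl

theorem vel_ne_zero {i : ℕ} (hi : i < N) {t : ℝ} (ht : t ∈ Icc (T.time i) (T.time (i + 1))) :
    vel (T.arc i) t ≠ 0 := by
  intro h0
  have := T.speed_pos hi ht
  rw [h0, map_zero] at this
  exact lt_irrefl _ this

theorem ratio_arc (hS : IsFirstIntegral g S) {i : ℕ} (hi : i < N) {t t' : ℝ}
    (ht : t ∈ Icc (T.time i) (T.time (i + 1))) (ht' : t' ∈ Icc (T.time i) (T.time (i + 1))) :
    ratio g S (velocity (T.arc i) t) = ratio g S (velocity (T.arc i) t') :=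
  congrArg₂ (· / ·)
    ((T.geodesic i hi).integral_eq (fun _ he _ hy _ _ h => hS.fderiv_chartForm he hy h) ht ht')
    ((T.geodesic i hi).speed_eq ht ht')

theorem ratio_start (h : IsEigenWall g S c ν) (hS : IsFirstIntegral g S) {i : ℕ} (hi : i < N)
    {t : ℝ} (ht : t ∈ Icc (T.time i) (T.time (i + 1))) :
    ratio g S (velocity (T.arc i) t) = ratio g S (velocity (T.arc 0) (T.time 0)) := by
  induction i generalizing t with
  | zero => exact T.ratio_arc hS hi ht (left_mem_Icc.2 (T.time_lt 0 hi).le)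
  | succ i ih =>
    have hi' : i < N := (Nat.lt_succ_self i).trans hi
    rw [T.ratio_arc hS hi ht (left_mem_Icc.2 (T.time_lt _ hi).le), T.reflection i hi,
      h.ratio_reflect (T.end_mem i hi')]
    exact ih hi' (right_mem_Icc.2 (T.time_lt i hi').le)

end Trajectory

/-- The ratio of the quadratic integral and the energy is an integral of motion. At the wall it
increases with the angle up to the normal direction. -/
theorem IsEigenWall.isIntegralOfMotion {g : Metric M} {S : QuadraticField M} {c : ℝ → M}
    {ν : ∀ x : M, TangentSpace (𝓡 2) x} (h : IsEigenWall g S c ν) (hS : IsFirstIntegral g S) :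
    IsIntegralOfMotion g c ν (Real.pi / 2) (ratio g S) where
  smooth := contMDiffOn_ratio g S
  homogeneous x v r _ hr := ratio_smul g S x v hr.ne'
  nonconstant t w hw hwν := by
    have hνw : g.inner (c t) (ν (c t)) w = 0 := by rw [g.symm, hwν]
    have hval : ∀ θ : ℝ, ratio g S ⟨c t, Real.cos θ • w + Real.sin θ • ν (c t)⟩
        = eigen g S (c t)
          + (S.form (c t) (ν (c t)) (ν (c t)) - eigen g S (c t)) * Real.sin θ ^ 2 := by
      intro θ
      have h1 : g.inner (c t) (Real.cos θ • w + Real.sin θ • ν (c t))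
          (Real.cos θ • w + Real.sin θ • ν (c t)) = 1 := by
        simp only [map_add, map_smul, add_apply, smul_apply, smul_eq_mul, hw, hwν, hνw, h.unit t]
        linear_combination Real.cos_sq_add_sin_sq θ
      have h2 : g.inner (c t) (Real.cos θ • w + Real.sin θ • ν (c t)) (ν (c t)) = Real.sin θ := by
        simp only [map_add, map_smul, add_apply, smul_apply, smul_eq_mul, hwν, h.unit t]
        ring
      have h3 : Real.cos θ • w + Real.sin θ • ν (c t) ≠ 0 := by
        intro h0
        rw [h0, map_zero] at h1
        exact zero_ne_one h1
      rw [h.ratio_eq t h3, h1, h2, Real.sqrt_one, div_one]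
    intro θ hθ θ' hθ' hlt
    simp only [hval]
    have h1 := Real.strictMonoOn_sin
      ⟨(by linarith [hθ.1, Real.pi_pos] : -(Real.pi / 2) ≤ θ), hθ.2⟩
      ⟨(by linarith [hθ'.1, Real.pi_pos] : -(Real.pi / 2) ≤ θ'), hθ'.2⟩ hlt
    have h2 := Real.sin_nonneg_of_nonneg_of_le_pi hθ.1 (by linarith [hθ.2, Real.pi_pos])
    have h3 := sub_pos.2 (h.eigen_lt_normal t)
    gcongr
  conserved N T _ i hi j hj t ht t' ht' := by
    rw [T.ratio_start h hS hi ht, T.ratio_start h hS hj ht']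

end
section
variable {M : Type*} [TopologicalSpace M] [ChartedSpace Plane M] [IsManifold (𝓡 2) ∞ M]

/-! ### The level curves of the lowest eigenvalue -/

theorem exists_eq_smul_of_apply_eq_zero {ℓ : Plane →L[ℝ] ℝ} {u v w : Plane} (hu : ℓ u ≠ 0)
    (hv : ℓ v = 0) (hv0 : v ≠ 0) (hw : ℓ w = 0) : ∃ a : ℝ, w = a • v := by
  have hli : LinearIndependent ℝ ![v, u] := by
    refine LinearIndependent.pair_iff.2 fun s t hst => ?_
    have h1 := congrArg ℓ hst
    simp only [map_add, map_smul, smul_eq_mul, hv, mul_zero, zero_add, map_zero] at h1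
    have h2 := (mul_eq_zero.1 h1).resolve_right hu
    rw [h2, zero_smul, add_zero] at hst
    exact ⟨(smul_eq_zero.1 hst).resolve_right hv0, h2⟩
  obtain ⟨a, b, rfl⟩ := exists_smul_add_of_linearIndependent hli w
  simp only [map_add, map_smul, smul_eq_mul, hv, mul_zero, zero_add] at hw
  rw [(mul_eq_zero.1 hw).resolve_right hu, zero_smul, add_zero]
  exact ⟨a, rfl⟩

theorem hasDerivAt_comp_curve {l : M → ℝ} {γ : ℝ → M} {t : ℝ}
    (hl : MDifferentiableAt (𝓡 2) 𝓘(ℝ, ℝ) l (γ t)) (hγ : MDifferentiableAt 𝓘(ℝ, ℝ) (𝓡 2) γ t) :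
    HasDerivAt (fun τ => l (γ τ)) (mfderiv (𝓡 2) 𝓘(ℝ, ℝ) l (γ t) (vel γ t) : ℝ) t := by
  have h : HasFDerivAt (fun τ => l (γ τ)) (show ℝ →L[ℝ] ℝ from
      (mfderiv (𝓡 2) 𝓘(ℝ, ℝ) l (γ t)).comp (mfderiv 𝓘(ℝ, ℝ) (𝓡 2) γ t)) t :=
    (hl.hasMFDerivAt.comp t hγ.hasMFDerivAt).hasFDerivAt
  exact h.hasDerivAt

theorem hasDerivAt_eigen_comp {g : Metric M} {S : QuadraticField M} {γ : ℝ → M} {t : ℝ}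
    (hx : HasRealZeroDirections S (γ t)) (hγ : MDifferentiableAt 𝓘(ℝ, ℝ) (𝓡 2) γ t) :
    HasDerivAt (fun τ => eigen g S (γ τ)) (deigen g S (γ t) (vel γ t)) t :=
  hasDerivAt_comp_curve ((contMDiffAt_eigen g hx).mdifferentiableAt (by simp)) hγ

/-- Where the lowest eigenvalue has no critical point, its level lines are the lines of the
eigendirections. -/
theorem form_eq_of_deigen_eq_zero {g : Metric M} {S : QuadraticField M} (hS : IsFirstIntegral g S)
    {x : M} (hx : HasRealZeroDirections S x) {u v : TangentSpace (𝓡 2) x} (hu : deigen g S x u ≠ 0)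
    (hv : deigen g S x v = 0) : S.form x v v = eigen g S x * g.inner x v v := by
  obtain ⟨w, hw0, hw⟩ := exists_eigen_eq g S x
  obtain ⟨a, ha⟩ : ∃ a : ℝ, v = a • w :=
    exists_eq_smul_of_apply_eq_zero (ℓ := deigen g S x) hu (deigen_eq_zero hS hx hw) hw0 hv
  rw [ha]
  simp only [map_smul, smul_apply, smul_eq_mul, hw]
  ring

/-- A collar `Φ` of the curve `c` inside of the open set `N`, such that the lowest eigenvalue
exceeds its value on `c` by `s` at the points `Φ (t, s)`. -/
structure IsLevelCollar (g : Metric M) (S : QuadraticField M) (c : ℝ → M) (ε : ℝ) (N : Set M)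
    (Φ : ℝ × ℝ → M) : Prop where
  isOpen : IsOpen N
  real : ∀ x ∈ N, HasRealZeroDirections S x
  smooth : ∀ t, ∀ s ∈ Ioo (-ε) ε, ContMDiffAt 𝓘(ℝ, ℝ × ℝ) (𝓡 2) ∞ Φ (t, s)
  mem : ∀ t, ∀ s ∈ Ioo (-ε) ε, Φ (t, s) ∈ N
  level : ∀ t, ∀ s ∈ Ioo (-ε) ε, eigen g S (Φ (t, s)) = eigen g S (c 0) + s
  injective_mfderiv : ∀ t, ∀ s ∈ Ioo (-ε) ε,
    Function.Injective (mfderiv 𝓘(ℝ, ℝ × ℝ) (𝓡 2) Φ (t, s))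
  periodic : ∀ t s, Φ (t + 1, s) = Φ (t, s)
  injective : ∀ t t', ∀ s ∈ Ioo (-ε) ε, ∀ s' ∈ Ioo (-ε) ε, Φ (t, s) = Φ (t', s') →
    s = s' ∧ ∃ n : ℤ, t' = t + n
  core : ∀ t, Φ (t, 0) = c t
  cover : ∀ x ∈ N, ∀ s ∈ Ioo (-ε) ε, eigen g S x = eigen g S (c 0) + s → ∃ t, Φ (t, s) = x

namespace IsLevelCollar

variable {g : Metric M} {S : QuadraticField M} {c : ℝ → M} {ε : ℝ} {N : Set M} {Φ : ℝ × ℝ → M}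

theorem contMDiffAt_fst (h : IsLevelCollar g S c ε N Φ) (t : ℝ) {s : ℝ} (hs : s ∈ Ioo (-ε) ε) :
    ContMDiffAt 𝓘(ℝ, ℝ) (𝓡 2) ∞ (fun τ => Φ (τ, s)) t := by
  have h1 : ContMDiffAt 𝓘(ℝ, ℝ) 𝓘(ℝ, ℝ × ℝ) ∞ (fun τ : ℝ => (τ, s)) t := by
    apply ContDiffAt.contMDiffAt
    fun_prop
  exact ContMDiffAt.comp t (g := Φ) (f := fun τ : ℝ => (τ, s)) (h.smooth t s hs) h1

theorem contMDiffAt_snd (h : IsLevelCollar g S c ε N Φ) (t : ℝ) {s : ℝ} (hs : s ∈ Ioo (-ε) ε) :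
    ContMDiffAt 𝓘(ℝ, ℝ) (𝓡 2) ∞ (fun σ => Φ (t, σ)) s := by
  have h1 : ContMDiffAt 𝓘(ℝ, ℝ) 𝓘(ℝ, ℝ × ℝ) ∞ (fun σ : ℝ => (t, σ)) s := by
    apply ContDiffAt.contMDiffAt
    fun_prop
  exact ContMDiffAt.comp s (g := Φ) (f := fun σ : ℝ => (t, σ)) (h.smooth t s hs) h1

theorem vel_fst_ne_zero (h : IsLevelCollar g S c ε N Φ) (t : ℝ) {s : ℝ} (hs : s ∈ Ioo (-ε) ε) :
    vel (fun τ => Φ (τ, s)) t ≠ 0 := by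
  have h1 : HasDerivAt (fun τ : ℝ => (τ, s)) ((1 : ℝ), (0 : ℝ)) t :=
    (hasDerivAt_id t).prodMk (hasDerivAt_const t s)
  have h2 := HasMFDerivAt.comp t (g := Φ) (f := fun τ : ℝ => (τ, s))
    ((h.smooth t s hs).mdifferentiableAt (by simp)).hasMFDerivAt h1.hasFDerivAt.hasMFDerivAt
  have h3 : vel (fun τ => Φ (τ, s)) t
      = mfderiv 𝓘(ℝ, ℝ × ℝ) (𝓡 2) Φ (t, s) ((1 : ℝ) • ((1 : ℝ), (0 : ℝ))) :=
    congrArg (fun f : ℝ →L[ℝ] Plane => f 1) h2.mfderiv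
  rw [h3, one_smul]
  intro h0
  have h4 := h.injective_mfderiv t s hs (h0.trans (map_zero _).symm)
  exact one_ne_zero (congrArg (fun p : ℝ × ℝ => p.1) h4)

theorem deigen_fst (h : IsLevelCollar g S c ε N Φ) (t : ℝ) {s : ℝ} (hs : s ∈ Ioo (-ε) ε) :
    deigen g S (Φ (t, s)) (vel (fun τ => Φ (τ, s)) t) = 0 := by
  have h1 := hasDerivAt_eigen_comp (g := g) (γ := fun τ => Φ (τ, s)) (h.real _ (h.mem t s hs))
    ((h.contMDiffAt_fst t hs).mdifferentiableAt (by simp))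
  simp only [h.level _ s hs] at h1
  exact h1.unique (hasDerivAt_const t _)

theorem deigen_snd (h : IsLevelCollar g S c ε N Φ) (t : ℝ) {s : ℝ} (hs : s ∈ Ioo (-ε) ε) :
    deigen g S (Φ (t, s)) (vel (fun σ => Φ (t, σ)) s) = 1 := by
  have h1 := hasDerivAt_eigen_comp (g := g) (γ := fun σ => Φ (t, σ)) (h.real _ (h.mem t s hs))
    ((h.contMDiffAt_snd t hs).mdifferentiableAt (by simp))
  refine h1.unique (((hasDerivAt_id s).const_add (eigen g S (c 0))).congr_of_eventuallyEq ?_)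
  filter_upwards [isOpen_Ioo.mem_nhds hs] with σ hσ using h.level t σ hσ

theorem deigen_snd_ne_zero (h : IsLevelCollar g S c ε N Φ) (t : ℝ) {s : ℝ} (hs : s ∈ Ioo (-ε) ε) :
    deigen g S (Φ (t, s)) (vel (fun σ => Φ (t, σ)) s) ≠ 0 :=
  (h.deigen_snd t hs).trans_ne one_ne_zero

/-- The curves of the collar are simple closed curves. -/
theorem isSimpleClosedCurve (h : IsLevelCollar g S c ε N Φ) {s : ℝ} (hs : s ∈ Ioo (-ε) ε) :
    IsSimpleClosedCurve (fun t => Φ (t, s)) where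
  smooth t := h.contMDiffAt_fst t hs
  regular t := h.vel_fst_ne_zero t hs
  periodic t := h.periodic t s
  simple t t' heq := (h.injective t t' s hs s hs heq).2

/-- A vector tangent to a curve of the collar has the level of this curve as its ratio. -/
theorem ratio_eq_of_tangent (h : IsLevelCollar g S c ε N Φ) (hS : IsFirstIntegral g S) {t s l : ℝ}
    (hs : s ∈ Ioo (-ε) ε) (hl : l • vel (fun τ => Φ (τ, s)) t ≠ 0) :
    ratio g S ⟨Φ (t, s), l • vel (fun τ => Φ (τ, s)) t⟩ = eigen g S (c 0) + s := by
  have h1 : deigen g S (Φ (t, s)) (l • vel (fun τ => Φ (τ, s)) t) = 0 := by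
    rw [map_smul, h.deigen_fst t hs, smul_zero]
  have h2 := form_eq_of_deigen_eq_zero hS (h.real _ (h.mem t s hs))
    (u := vel (fun σ => Φ (t, σ)) s) (h.deigen_snd_ne_zero t hs) h1
  have h3 := g.pos (Φ (t, s)) _ hl
  rw [ratio, div_eq_iff h3.ne', ← h.level t s hs]
  exact h2

/-- A vector at a point of the collar which is annihilated by the differential of the lowest
eigenvalue is tangent to the curve of the collar through this point, and the value of the integral
on it is the parameter of this curve. -/
theorem exists_tangent (h : IsLevelCollar g S c ε N Φ) (hS : IsFirstIntegral g S)
    {z : TangentBundle (𝓡 2) M} {κ : ℝ} {t s : ℝ} (hs : s ∈ Ioo (-ε) ε) (hz : z.1 = Φ (t, s))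
    (hz0 : z.2 ≠ 0) (hd : deigen g S z.1 z.2 = 0) (hκ : ratio g S z = eigen g S (c 0) + κ) :
    ∃ l : ℝ, z = ⟨Φ (t, κ), l • vel (fun τ => Φ (τ, κ)) t⟩ := by
  obtain ⟨x, v⟩ := z
  obtain rfl : x = Φ (t, s) := hz
  obtain ⟨l, hl⟩ : ∃ l : ℝ, v = l • vel (fun τ => Φ (τ, s)) t :=
    exists_eq_smul_of_apply_eq_zero (ℓ := deigen g S (Φ (t, s)))
      (u := vel (fun σ => Φ (t, σ)) s) (h.deigen_snd_ne_zero t hs)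
      (h.deigen_fst t hs) (h.vel_fst_ne_zero t hs) hd
  have h1 := h.ratio_eq_of_tangent hS hs (hl ▸ hz0)
  rw [← hl, hκ] at h1
  obtain rfl : κ = s := by linarith
  exact ⟨l, by rw [hl]⟩

/-- A geodesic arc between two points of the wall on which the ratio exceeds its value at the wall by
`κ` touches the curve of level `κ`. The lowest eigenvalue does not exceed the ratio, so the arc is
confined to the strip between these curves. At an extremum of the eigenvalue along the arc the
velocity is an eigenvector, and the eigenvalue attains the ratio. Of the arc being a geodesic, only
the constancy of the ratio is needed. -/
theorem exists_touching [T2Space M] (h : IsLevelCollar g S c ε N Φ)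
    (hS : IsFirstIntegral g S) {γ : ℝ → M} {a b κ : ℝ} (hab : a < b) (hκ : κ ∈ Ioo 0 ε)
    (hγ : ∀ t ∈ Icc a b, MDifferentiableAt 𝓘(ℝ, ℝ) (𝓡 2) γ t)
    (hγ0 : ∀ t ∈ Icc a b, vel γ t ≠ 0) (ha : γ a ∈ range c) (hb : γ b ∈ range c)
    (hab' : ∀ t ∈ Ioo a b, γ t ∉ range c) (hin : 0 < deigen g S (γ a) (vel γ a))
    (hratio : ∀ t ∈ Icc a b, ratio g S (velocity γ t) = eigen g S (c 0) + κ) :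
    ∃ t ∈ Ioo a b, ∃ r l : ℝ, velocity γ t = ⟨Φ (r, κ), l • vel (fun τ => Φ (τ, κ)) r⟩ := by
  have hsub : Icc 0 κ ⊆ Ioo (-ε) ε := fun s hs =>
    ⟨by linarith [hs.1, hκ.1, hκ.2], hs.2.trans_lt hκ.2⟩
  have h0 : (0 : ℝ) ∈ Icc 0 κ := ⟨le_rfl, hκ.1.le⟩
  -- the strip between the wall and the level curve is compact
  let K : Set M := Φ '' (Icc 0 1 ×ˢ Icc 0 κ)
  have hK : ∀ r, ∀ s ∈ Icc 0 κ, Φ (r, s) ∈ K := by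
    intro r s hs
    have h1 := (h.isSimpleClosedCurve (hsub hs)).range_eq
    have h2 : Φ (r, s) ∈ range fun t => Φ (t, s) := ⟨r, rfl⟩
    rw [h1] at h2
    obtain ⟨r', hr', heq⟩ := h2
    exact ⟨(r', s), ⟨hr', hs⟩, heq⟩
  have hKc : IsClosed K := by
    refine ((isCompact_Icc.prod isCompact_Icc).image_of_continuousOn fun p hp => ?_).isClosed
    exact (h.smooth p.1 p.2 (hsub hp.2)).continuousAt.continuousWithinAt
  have hKN : ∀ x ∈ K, x ∈ N := by
    rintro _ ⟨p, hp, rfl⟩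
    exact h.mem p.1 p.2 (hsub hp.2)
  have hKc' : ∀ x ∈ range c, x ∈ K := by
    rintro _ ⟨t, rfl⟩
    rw [← h.core t]
    exact hK t 0 h0
  have hderiv : ∀ t ∈ Icc a b, γ t ∈ N →
      HasDerivAt (fun τ => eigen g S (γ τ)) (deigen g S (γ t) (vel γ t)) t := fun t ht hN =>
    hasDerivAt_eigen_comp (h.real _ hN) (hγ t ht)
  have hcore : ∀ x ∈ range c, eigen g S x = eigen g S (c 0) := by
    rintro _ ⟨t, rfl⟩
    rw [← h.core t, h.level t 0 (hsub h0), add_zero]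
  have hle : ∀ t ∈ Icc a b, eigen g S (γ t) ≤ eigen g S (c 0) + κ := fun t ht =>
    (eigen_le_ratio g S (z := velocity γ t) (hγ0 t ht)).trans_eq (hratio t ht)
  have hcont : ContinuousOn γ (Icc a b) := fun t ht => (hγ t ht).continuousAt.continuousWithinAt
  have hconf : Icc a b ⊆ γ ⁻¹' K := by
    refine IsClosed.Icc_subset_of_forall_mem_nhdsWithin ?_ (hKc' _ ha) ?_
    · rw [inter_comm]
      exact hcont.preimage_isClosed_of_isClosed isClosed_Icc hKc
    · rintro t ⟨htK, ht⟩
      have htI : t ∈ Icc a b := Ico_subset_Icc_self ht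
      have hd := hderiv t htI (hKN _ htK)
      have hpos : ∀ᶠ τ in nhdsWithin t (Ioi t), eigen g S (c 0) < eigen g S (γ τ) := by
        rcases ht.1.eq_or_lt with rfl | hat
        · have h1 := (hasDerivAt_iff_tendsto_slope.1 hd).eventually (lt_mem_nhds hin)
          have h2 := h1.filter_mono (nhdsWithin_mono a fun τ (hτ : a < τ) => hτ.ne')
          filter_upwards [h2, self_mem_nhdsWithin] with τ hτ (hτ' : a < τ)
          rw [slope_def_field] at hτ
          have h3 := (div_pos_iff_of_pos_right (sub_pos.2 hτ')).1 hτ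
          rw [hcore _ ha] at h3
          exact sub_pos.1 h3
        · obtain ⟨⟨r, s⟩, ⟨-, hs⟩, hrs⟩ := htK
          have h1 : eigen g S (γ t) = eigen g S (c 0) + s := by rw [← hrs, h.level r s (hsub hs)]
          have h2 : s ≠ 0 := by
            rintro rfl
            rw [h.core] at hrs
            exact hab' t ⟨hat, ht.2⟩ ⟨r, hrs⟩
          refine (hd.continuousAt.eventually (lt_mem_nhds ?_)).filter_mono nhdsWithin_le_nhds
          have h3 := lt_of_le_of_ne hs.1 h2.symm
          change _ < eigen g S (γ t)
          linarith
      have hN : ∀ᶠ τ in nhdsWithin t (Ioi t), γ τ ∈ N :=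
        ((hγ t htI).continuousAt.eventually (h.isOpen.mem_nhds (hKN _ htK))).filter_mono
          nhdsWithin_le_nhds
      have hI : ∀ᶠ τ in nhdsWithin t (Ioi t), τ ∈ Ioo t b := Ioo_mem_nhdsGT ht.2
      filter_upwards [hpos, hN, hI] with τ h1 h2 h3
      have h4 := hle τ ⟨ht.1.trans h3.1.le, h3.2.le⟩
      have h5 : eigen g S (γ τ) - eigen g S (c 0) ∈ Icc 0 κ := ⟨by linarith, by linarith⟩
      obtain ⟨r, hr⟩ := h.cover (γ τ) h2 _ (hsub h5) (by ring)
      change γ τ ∈ K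
      rw [← hr]
      exact hK r _ h5
  -- by Rolle's theorem the velocity is tangent to a level line of the eigenvalue at some time
  obtain ⟨t, ht, htd⟩ := exists_hasDerivAt_eq_zero hab
    (f := fun τ => eigen g S (γ τ)) (f' := fun τ => deigen g S (γ τ) (vel γ τ))
    (fun τ hτ => (hderiv τ hτ (hKN _ (hconf hτ))).continuousAt.continuousWithinAt)
    ((hcore _ ha).trans (hcore _ hb).symm)
    (fun τ hτ => hderiv τ (Ioo_subset_Icc_self hτ) (hKN _ (hconf (Ioo_subset_Icc_self hτ))))
  have htI := Ioo_subset_Icc_self ht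
  obtain ⟨⟨r, s⟩, ⟨-, hs⟩, hrs⟩ := hconf htI
  obtain ⟨l, hl⟩ := h.exists_tangent hS (z := velocity γ t) (hsub hs) hrs.symm (hγ0 t htI) htd
    (hratio t htI)
  exact ⟨t, ht, r, l, hl⟩

end IsLevelCollar

/-! ### The caustics -/

namespace IsEigenWall

variable {g : Metric M} {S : QuadraticField M} {c : ℝ → M} {ν : ∀ x : M, TangentSpace (𝓡 2) x}

/-- The derivative of the lowest eigenvalue at the wall only involves the normal component. -/
theorem deigen_eq (h : IsEigenWall g S c ν) (hS : IsFirstIntegral g S) (t : ℝ)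
    (v : TangentSpace (𝓡 2) (c t)) :
    deigen g S (c t) v = g.inner (c t) v (ν (c t)) * deigen g S (c t) (ν (c t)) := by
  obtain ⟨a, ha⟩ := h.eq_smul_add t v
  conv_lhs => rw [ha]
  rw [map_add, map_smul, map_smul, deigen_eq_zero hS (h.real t) (h.eigen_eq t), smul_zero, zero_add]
  rfl

/-- At a convex wall the vectors pointing into the table are those along which the lowest eigenvalue
increases. -/
theorem deigen_pos_iff (h : IsEigenWall g S c ν) (hS : IsFirstIntegral g S)
    (hconv : IsConvexWall g c ν) {z : TangentBundle (𝓡 2) M} (hz : z.1 ∈ range c) :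
    0 < deigen g S z.1 z.2 ↔ 0 < g.inner z.1 z.2 (ν z.1) := by
  obtain ⟨x, v⟩ := z
  obtain ⟨t, rfl⟩ : ∃ t, c t = x := hz
  change 0 < deigen g S (c t) v ↔ 0 < g.inner (c t) v (ν (c t))
  rw [h.deigen_eq hS t]
  exact mul_pos_iff_of_pos_right (h.deigen_normal_pos hS hconv t)

/-- By convexity of the wall the lowest eigenvalue has no critical points on it, and so is a
transversal coordinate near it. -/
theorem exists_levelCollar [T2Space M] [SecondCountableTopology M] (h : IsEigenWall g S c ν)
    (hS : IsFirstIntegral g S) (hconv : IsConvexWall g c ν) (hc : IsSimpleClosedCurve c) :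
    ∃ (ε : ℝ) (N : Set M) (Φ : ℝ × ℝ → M), 0 < ε ∧ IsLevelCollar g S c ε N Φ := by
  let Ω : Set M := interior {x | HasRealZeroDirections S x}
  have hΩ : ∀ x ∈ Ω, HasRealZeroDirections S x := fun x hx =>
    interior_subset (s := {x | HasRealZeroDirections S x}) hx
  have hsm : ∀ x ∈ Ω, ContMDiffAt (𝓡 2) 𝓘(ℝ, ℝ) ∞ (fun x => eigen g S x - eigen g S (c 0)) x :=
    fun x hx => (contMDiffAt_eigen g (hΩ x hx)).sub contMDiffAt_const
  have hd : ∀ t, (mfderiv (𝓡 2) 𝓘(ℝ, ℝ) (fun x => eigen g S x - eigen g S (c 0)) (c t)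
      (ν (c t)) : ℝ) ≠ 0 := by
    intro t
    have h1 : MDifferentiableAt (𝓡 2) 𝓘(ℝ, ℝ) (eigen g S) (c t) :=
      (contMDiffAt_eigen g (h.real t)).mdifferentiableAt (by simp)
    have h2 : mfderiv (𝓡 2) 𝓘(ℝ, ℝ) (fun x => eigen g S x - eigen g S (c 0)) (c t)
        = deigen g S (c t) := by
      have h3 := (h1.hasMFDerivAt.sub (hasMFDerivAt_const (eigen g S (c 0)) (c t))).mfderiv
      exact h3.trans (sub_zero _)
    rw [h2]
    exact (h.deigen_normal_pos hS hconv t).ne'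
  obtain ⟨ε, N, Φ, hε, hN, hNΩ, hΦ, hper, hinj, hcore, hcov⟩ := hc.exists_collar
    (l := fun x => eigen g S x - eigen g S (c 0)) isOpen_interior
    (fun t => mem_interior_iff_mem_nhds.2 (h.real_nhds t)) hsm
    (fun t => sub_eq_zero.2 (h.eigen_const hS t 0)) (fun t => ⟨ν (c t), hd t⟩)
  refine ⟨ε, N, Φ, hε, hN, fun x hx => hΩ x (hNΩ hx), fun t s hs => (hΦ t s hs).1,
    fun t s hs => (hΦ t s hs).2.1, fun t s hs => ?_, fun t s hs => (hΦ t s hs).2.2.2, hper, hinj,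
    hcore, fun x hx s hs heq => ?_⟩
  · linarith [(hΦ t s hs).2.2.1]
  · have h1 : eigen g S x - eigen g S (c 0) = s := by linarith
    rw [← h1] at hs ⊢
    exact hcov x hx hs

theorem isCollar (h : IsEigenWall g S c ν) (hS : IsFirstIntegral g S) (hconv : IsConvexWall g c ν)
    {ε : ℝ} {N : Set M} {Φ : ℝ × ℝ → M} (hε : 0 < ε) (hΦ : IsLevelCollar g S c ε N Φ) :
    IsCollar g c ν ε Φ where
  smooth p hp := (hΦ.smooth p.1 p.2 hp.2).contMDiffWithinAt
  bijective_mfderiv t s hs := by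
    have h1 := hΦ.injective_mfderiv t s hs
    exact ⟨h1, (LinearMap.injective_iff_surjective_of_finrank_eq_finrank
      (f := (show ℝ × ℝ →L[ℝ] Plane from mfderiv 𝓘(ℝ, ℝ × ℝ) (𝓡 2) Φ (t, s)).toLinearMap)
      (by simp)).1 h1⟩
  periodic t s _ := hΦ.periodic t s
  injective := hΦ.injective
  core := hΦ.core
  inward t := by
    have h1 := hΦ.deigen_snd t (s := 0) ⟨by linarith, hε⟩
    refine (h.deigen_pos_iff hS hconv (z := velocity (fun s => Φ (t, s)) 0) ⟨t, (hΦ.core t).symm⟩).1 ?_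
    exact h1.symm ▸ one_pos

/-- All arcs of a trajectory are tangent to the level curve given by the value of the integral. -/
theorem tangentTo [T2Space M] (h : IsEigenWall g S c ν) (hS : IsFirstIntegral g S)
    (hconv : IsConvexWall g c ν) {ε : ℝ} {N : Set M} {Φ : ℝ × ℝ → M}
    (hΦ : IsLevelCollar g S c ε N Φ) {n : ℕ} (T : Trajectory g c ν n) {κ : ℝ} (hκ : κ ∈ Ioo 0 ε)
    (hT : ratio g S (velocity (T.arc 0) (T.time 0)) = eigen g S (c 0) + κ) {i : ℕ} (hi : i < n) :
    T.TangentTo i (fun t => Φ (t, κ)) := by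
  refine hΦ.exists_touching hS (T.time_lt i hi) hκ
    (fun t ht => (T.geodesic i hi t ht).1.mdifferentiableAt (by simp))
    (fun t ht => T.vel_ne_zero hi ht) (T.start_mem i hi) (T.end_mem i hi) (T.interior i hi) ?_
    fun t ht => (T.ratio_start h hS hi ht).trans hT
  exact (h.deigen_pos_iff hS hconv (z := velocity (T.arc i) (T.time i)) (T.start_mem i hi)).2
    (T.start_inward i hi)

/-- Tangency to a level curve determines the value of the integral, and conversely. -/
theorem isCaustic [T2Space M] (h : IsEigenWall g S c ν) (hS : IsFirstIntegral g S)
    (hconv : IsConvexWall g c ν) {ε : ℝ} {N : Set M} {Φ : ℝ × ℝ → M}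
    (hΦ : IsLevelCollar g S c ε N Φ) {κ : ℝ} (hκ : κ ∈ Ioo 0 ε) :
    IsCaustic g c ν (fun t => Φ (t, κ)) := by
  have hκ' : κ ∈ Ioo (-ε) ε := ⟨by linarith [hκ.1, hκ.2], hκ.2⟩
  refine ⟨hΦ.isSimpleClosedCurve hκ', fun n T i hi j hj hT => ?_⟩
  obtain ⟨t, ht, r, l, hv⟩ := hT
  have htI := Ioo_subset_Icc_self ht
  refine h.tangentTo hS hconv hΦ T hκ ?_ hj
  rw [← T.ratio_start h hS hi htI, hv]
  refine hΦ.ratio_eq_of_tangent hS hκ' fun h0 => ?_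
  have h1 : (velocity (T.arc i) t).2 ≠ 0 := T.vel_ne_zero hi htI
  rw [hv] at h1
  exact h1 h0

/-- The value of the integral on a trajectory in terms of the angle at which it starts. -/
theorem exists_ratio_eq (h : IsEigenWall g S c ν) (hS : IsFirstIntegral g S) {n : ℕ}
    (T : Trajectory g c ν n) (hn : 0 < n) :
    ∃ (t : ℝ), ratio g S (velocity (T.arc 0) (T.time 0)) = eigen g S (c 0)
      + (S.form (c t) (ν (c t)) (ν (c t)) - eigen g S (c 0)) * Real.sin T.angle ^ 2 ∧
        0 < T.angle := by
  have h1 := T.start_mem 0 hn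
  have h2 := T.start_inward 0 hn
  have h3 : (velocity (T.arc 0) (T.time 0)).2 ≠ 0 :=
    T.vel_ne_zero hn (left_mem_Icc.2 (T.time_lt 0 hn).le)
  have h4 : T.angle = wallAngle g ν (velocity (T.arc 0) (T.time 0)) := rfl
  rw [h4]
  change (velocity (T.arc 0) (T.time 0)).1 ∈ range c at h1
  change 0 < g.inner (velocity (T.arc 0) (T.time 0)).1 (velocity (T.arc 0) (T.time 0)).2
    (ν (velocity (T.arc 0) (T.time 0)).1) at h2
  generalize velocity (T.arc 0) (T.time 0) = z at h1 h2 h3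
  obtain ⟨x, v⟩ := z
  obtain ⟨t, rfl⟩ : ∃ t, c t = x := h1
  have hv := g.pos (c t) v h3
  have hcs : |g.inner (c t) v (ν (c t)) / √(g.inner (c t) v v)| ≤ 1 := by
    rw [← sq_le_one_iff_abs_le_one, div_pow, Real.sq_sqrt hv.le, div_le_one hv]
    obtain ⟨a, ha⟩ := h.eq_smul_add t v
    generalize g.inner (c t) v (ν (c t)) = b at ha
    have h5 : g.inner (c t) v v = a ^ 2 * g.inner (c t) (vel c t) (vel c t) + b ^ 2 := by
      rw [ha]
      simp only [map_add, map_smul, add_apply, smul_apply, smul_eq_mul, h.unit t, h.normal t,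
        g.symm (c t) (ν (c t)) (vel c t)]
      ring
    rw [h5]
    have := mul_nonneg (sq_nonneg a) (g.pos (c t) _ (h.regular t)).le
    linarith
  refine ⟨t, ?_, Real.arcsin_pos.2 (div_pos h2 (Real.sqrt_pos.2 hv))⟩
  rw [h.ratio_eq t h3, h.eigen_const hS t 0]
  congr 3
  exact (Real.sin_arcsin (abs_le.1 hcs).1 (abs_le.1 hcs).2).symm

theorem isFoliatedByCaustics [T2Space M] [SecondCountableTopology M] (h : IsEigenWall g S c ν)
    (hS : IsFirstIntegral g S) (hconv : IsConvexWall g c ν) (hc : IsSimpleClosedCurve c)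
    (hν : ContinuousFieldOn ν (range c)) : IsFoliatedByCaustics g c ν := by
  obtain ⟨ε, N, Φ, hε, hΦ⟩ := h.exists_levelCollar hS hconv hc
  refine ⟨ε, hε, Φ, h.isCollar hS hconv hε hΦ, fun s hs => h.isCaustic hS hconv hΦ hs, ?_⟩
  obtain ⟨C, hC⟩ : ∃ C : ℝ, ∀ t, S.form (c t) (ν (c t)) (ν (c t)) - eigen g S (c 0) ≤ C := by
    have h1 : ContinuousOn (fun x => S.form x (ν x) (ν x)) (range c) :=
      (contMDiff_quadratic S).continuous.comp_continuousOn hν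
    obtain ⟨C, hC⟩ := hc.isCompact_range.bddAbove_image h1
    exact ⟨C - eigen g S (c 0), fun t => sub_le_sub_right (hC ⟨c t, ⟨t, rfl⟩, rfl⟩) _⟩
  -- trajectories starting at angles less than `δ` have a ratio less than `ε` above the wall
  have hlim : ∀ᶠ δ in nhds (0 : ℝ), C * Real.sin δ ^ 2 < ε ∧ δ < Real.pi / 2 := by
    have h1 : ContinuousAt (fun δ : ℝ => C * Real.sin δ ^ 2) 0 := by fun_prop
    exact (h1.eventually (gt_mem_nhds (by simpa using hε))).and (gt_mem_nhds (by positivity))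
  obtain ⟨δ, ⟨hδ1, hδ2⟩, hδ0⟩ :=
    ((hlim.filter_mono (nhdsWithin_le_nhds (s := Ioi 0))).and self_mem_nhdsWithin).exists
  have hδ0 : 0 < δ := hδ0
  refine ⟨δ, hδ0, fun n T hT => ?_⟩
  rcases Nat.eq_zero_or_pos n with rfl | hn
  · exact ⟨ε / 2, ⟨by linarith, by linarith⟩, fun i hi => absurd hi (Nat.not_lt_zero i)⟩
  obtain ⟨t, ht, hpos⟩ := h.exists_ratio_eq hS T hn
  have h1 := sub_pos.2 (h.eigen_lt_normal t)
  rw [h.eigen_const hS t 0] at h1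
  have h2 : 0 < Real.sin T.angle := Real.sin_pos_of_pos_of_lt_pi hpos (by linarith)
  have h3 : Real.sin T.angle ≤ Real.sin δ :=
    Real.sin_le_sin_of_le_of_le_pi_div_two (by linarith) hδ2.le hT.le
  have h4 : (S.form (c t) (ν (c t)) (ν (c t)) - eigen g S (c 0)) * Real.sin T.angle ^ 2
      ∈ Ioo 0 ε := by
    refine ⟨by positivity, lt_of_le_of_lt ?_ hδ1⟩
    have h5 := hC t
    have h6 := h1.le.trans h5
    gcongr
  exact ⟨_, h4, fun i hi => h.tangentTo hS hconv hΦ T h4 ht hi⟩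

end IsEigenWall

end
section
variable {M : Type*} [TopologicalSpace M] [ChartedSpace Plane M] [IsManifold (𝓡 2) ∞ M]

/-! ### Bisectors of the zero directions -/

/-- The integral with the opposite sign. It has the same zero directions and bisectors. -/
noncomputable def QuadraticField.neg (S : QuadraticField M) : QuadraticField M where
  form x := -S.form x
  symm x v w := congrArg Neg.neg (S.symm x v w)
  contMDiff := S.contMDiff.neg_section

theorem QuadraticField.neg_form_apply (S : QuadraticField M) (x : M) (v w : TangentSpace (𝓡 2) x) :
    S.neg.form x v w = -S.form x v w :=
  rfl

theorem IsFirstIntegral.neg {g : Metric M} {S : QuadraticField M} (hS : IsFirstIntegral g S) :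
    IsFirstIntegral g S.neg := by
  intro e he y hy v a h
  have h1 := hS e he y hy v a h
  have h2 : ∀ v w, localForm S.neg.form e v w = fun y => -localForm S.form e v w y :=
    fun v w => rfl
  rw [h2, h2, fderiv_fun_neg, neg_apply]
  linarith

theorem HasRealZeroDirections.neg {S : QuadraticField M} {x : M} (h : HasRealZeroDirections S x) :
    HasRealZeroDirections S.neg x := by
  obtain ⟨h0, ξ, η, hli, hξ, hη⟩ := h
  refine ⟨fun h => h0 ?_, ξ, η, hli, ?_, ?_⟩
  · ext v w
    exact neg_eq_zero.1 (congrArg (fun f => f v w) h)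
  · rw [S.neg_form_apply, hξ, neg_zero]
  · rw [S.neg_form_apply, hη, neg_zero]

theorem IsBisector.neg {g : Metric M} {S : QuadraticField M} {x : M} {w : TangentSpace (𝓡 2) x}
    (h : IsBisector g S x w) : IsBisector g S.neg x w := by
  obtain ⟨ξ, η, hli, hξ, hη, h⟩ := h
  refine ⟨ξ, η, hli, ?_, ?_, h⟩
  · rw [S.neg_form_apply, hξ, neg_zero]
  · rw [S.neg_form_apply, hη, neg_zero]

theorem IsBisector.form_ne_zero {g : Metric M} {S : QuadraticField M} {x : M}
    {w : TangentSpace (𝓡 2) x} (h : IsBisector g S x w) (h0 : S.form x ≠ 0) :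
    S.form x w w ≠ 0 := by
  obtain ⟨ξ, η, hli, hξ, hη, -, rfl⟩ := h
  intro hw
  have h1 : S.form x ξ η = 0 := by
    simp only [map_add, add_apply, hξ, hη, S.symm x η ξ] at hw
    linarith
  apply h0
  ext v w
  obtain ⟨a, b, hv⟩ : ∃ a b : ℝ, v = a • ξ + b • η :=
    exists_smul_add_of_linearIndependent (ξ := ξ) (η := η) hli v
  obtain ⟨a', b', hw⟩ : ∃ a b : ℝ, w = a • ξ + b • η :=
    exists_smul_add_of_linearIndependent (ξ := ξ) (η := η) hli w
  rw [hv, hw]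
  simp only [map_add, map_smul, add_apply, smul_apply, smul_eq_mul, S.symm x η ξ, hξ, hη, h1]
  simp

/-- A bisector of the zero directions is an eigenvector. -/
theorem IsBisector.form_eq {g : Metric M} {S : QuadraticField M} {x : M}
    {w : TangentSpace (𝓡 2) x} (h : IsBisector g S x w) (hneg : S.form x w w < 0) :
    S.form x w w = eigen g S x * g.inner x w w := by
  obtain ⟨ξ, η, hli, hξ, hη, hG, rfl⟩ := h
  refine le_antisymm ?_ (eigen_mul_le g S x _)
  obtain ⟨v, hv0, hv⟩ := exists_eigen_eq g S x
  have hvpos := g.pos x v hv0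
  have hξ0 : ξ ≠ 0 := by simpa using hli.ne_zero 0
  have hξpos := g.pos x ξ hξ0
  obtain ⟨a, b, hab⟩ : ∃ a b : ℝ, v = a • ξ + b • η :=
    exists_smul_add_of_linearIndependent (ξ := ξ) (η := η) hli v
  rw [hab] at hv hvpos
  simp only [map_add, map_smul, add_apply, smul_apply, smul_eq_mul, hξ, hη, S.symm x η ξ,
    g.symm x η ξ, ← hG] at hv hvpos hneg ⊢
  generalize S.form x ξ η = σ at *
  generalize g.inner x ξ η = p at *
  generalize g.inner x ξ ξ = G at *
  generalize eigen g S x = m at *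
  have h1 : 0 ≤ -σ * (a - b) ^ 2 * G :=
    mul_nonneg (mul_nonneg (by linarith) (sq_nonneg _)) hξpos.le
  refine le_of_mul_le_mul_right ?_ hvpos
  have h2 := congrArg (· * (G + p + (p + G))) hv
  nlinarith

theorem continuousAt_form_vel (S : QuadraticField M) {γ : ℝ → M} {t : ℝ}
    (hγ : ContMDiffAt 𝓘(ℝ, ℝ) (𝓡 2) ∞ γ t) :
    ContinuousAt (fun τ => S.form (γ τ) (vel γ τ) (vel γ τ)) t := by
  have he := chartAt_mem (γ t)
  have hx : γ t ∈ (chartAt Plane (γ t)).source := mem_chart_source Plane (γ t)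
  generalize chartAt Plane (γ t) = e at he hx
  obtain ⟨h1, h2⟩ := hasDerivAt_deriv_chart he hγ hx
  refine (deriv_form_chart he S (e.map_source hx) h1 h2 h2).continuousAt.congr ?_
  have h6 : ∀ᶠ τ in nhds t, ContMDiffAt 𝓘(ℝ, ℝ) (𝓡 2) 1 γ τ :=
    contMDiffAt_iff_contMDiffAt_nhds (by simp) |>.1 (hγ.of_le (n := ∞) (by simp))
  filter_upwards [h6, hγ.continuousAt.preimage_mem_nhds (e.open_source.mem_nhds hx)] with τ hτ hτ'
  exact chartForm_deriv he S (hτ.mdifferentiableAt (by simp)) hτ'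

/-- The tangent vectors of a leaf of a bisector foliation are bisectors, up to scale. -/
theorem IsLeaf.exists_bisector {g : Metric M} {S : QuadraticField M} {Ω : Set M}
    {F : ∀ x : M, Submodule ℝ (TangentSpace (𝓡 2) x)} (hF : IsBisectorFoliation g S Ω F)
    {c : ℝ → M} (hleaf : IsLeaf F Ω c) (t : ℝ) :
    ∃ (a : ℝ) (w : TangentSpace (𝓡 2) (c t)), IsBisector g S (c t) w ∧ vel c t = a • w := by
  obtain ⟨hΩ, hv⟩ : c t ∈ Ω ∧ vel c t ∈ F (c t) := hleaf t
  obtain ⟨V, -, hV, -, X, -, hX⟩ := hF (c t) hΩ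
  obtain ⟨hb, hs⟩ := hX (c t) hV
  rw [hs] at hv
  obtain ⟨a, ha⟩ := Submodule.mem_span_singleton.1 hv
  exact ⟨a, X (c t), hb, ha.symm⟩

/-- A closed leaf of the bisector net is, for the integral or its opposite, a wall tangent to the
eigendirection of the lowest eigenvalue. -/
theorem IsLeaf.exists_isEigenWall {g : Metric M} {S : QuadraticField M} (hS : IsFirstIntegral g S)
    {Ω : Set M} (hΩ : IsOpen Ω) (hreal : ∀ x ∈ Ω, HasRealZeroDirections S x)
    {F : ∀ x : M, Submodule ℝ (TangentSpace (𝓡 2) x)} (hF : IsBisectorFoliation g S Ω F)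
    {c : ℝ → M} (hc : IsSimpleClosedCurve c) (hleaf : IsLeaf F Ω c)
    {ν : ∀ x : M, TangentSpace (𝓡 2) x} (hν : IsUnitNormal g c ν) :
    ∃ S' : QuadraticField M, IsFirstIntegral g S' ∧ IsEigenWall g S' c ν := by
  have hne : ∀ t, S.form (c t) (vel c t) (vel c t) ≠ 0 := by
    intro t
    obtain ⟨a, w, hw, ha⟩ := hleaf.exists_bisector hF t
    have ha0 : a ≠ 0 := by
      rintro rfl
      exact hc.regular t (ha.trans (zero_smul _ _))
    rw [ha]
    simp only [map_smul, smul_apply, smul_eq_mul]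
    exact mul_ne_zero ha0 (mul_ne_zero ha0 (hw.form_ne_zero (hreal _ (hleaf t).1).1))
  have key : ∀ S' : QuadraticField M, (∀ x ∈ Ω, HasRealZeroDirections S' x) →
      (∀ x w, IsBisector g S x w → IsBisector g S' x w) →
      (∀ t, S'.form (c t) (vel c t) (vel c t) < 0) → IsEigenWall g S' c ν := by
    intro S' hreal' hb hneg
    refine ⟨hc.smooth, hc.regular, fun t => ?_, hν.unit, hν.normal, fun t => ?_⟩
    · filter_upwards [hΩ.mem_nhds (hleaf t).1] with x hx using hreal' x hx
    · obtain ⟨a, w, hw, ha⟩ := hleaf.exists_bisector hF t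
      have h1 := hneg t
      rw [ha] at h1 ⊢
      simp only [map_smul, smul_apply, smul_eq_mul] at h1 ⊢
      rw [← mul_assoc] at h1
      rw [(hb _ w hw).form_eq (neg_of_mul_neg_right h1 (mul_self_nonneg a))]
      ring
  have hcont : Continuous fun t => S.form (c t) (vel c t) (vel c t) :=
    continuous_iff_continuousAt.2 fun t => continuousAt_form_vel S (hc.smooth t)
  rcases le_or_gt (S.form (c 0) (vel c 0) (vel c 0)) 0 with h0 | h0
  · refine ⟨S, hS, key S hreal (fun _ _ h => h) fun t => ?_⟩
    by_contra! ht
    obtain ⟨t', ht'⟩ := mem_range_of_exists_le_of_exists_ge hcont ⟨0, h0⟩ ⟨t, ht⟩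
    exact hne t' ht'
  · refine ⟨S.neg, hS.neg, key S.neg (fun x hx => (hreal x hx).neg) (fun _ _ h => h.neg) fun t => ?_⟩
    rw [S.neg_form_apply, neg_lt_zero]
    by_contra! ht
    obtain ⟨t', ht'⟩ := mem_range_of_exists_le_of_exists_ge hcont ⟨t, ht⟩ ⟨0, h0.le⟩
    exact hne t' ht'

end
end GeodesicBilliard

theorem theorem4 {M : Type*} [TopologicalSpace M] [ChartedSpace GeodesicBilliard.Plane M]
    [IsManifold (𝓡 2) ∞ M] [T2Space M] [SecondCountableTopology M]
    (g : GeodesicBilliard.Metric M)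
    (S : GeodesicBilliard.QuadraticField M) (hS : GeodesicBilliard.IsFirstIntegral g S)
    (Ω : Set M) (hΩ : IsOpen Ω) (hΩc : IsConnected Ω)
    (hreal : ∀ x ∈ Ω, GeodesicBilliard.HasRealZeroDirections S x)
    (E : ℝ → M) (hE : GeodesicBilliard.IsSimpleClosedCurve E)
    (hEnv : GeodesicBilliard.IsEnvelope g S Ω E)
    (F : ∀ x : M, Submodule ℝ (TangentSpace (𝓡 2) x))
    (hF : GeodesicBilliard.IsBisectorFoliation g S Ω F)
    (hFE : GeodesicBilliard.GoesAlong F Ω E)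
    (c : ℝ → M) (hc : GeodesicBilliard.IsSimpleClosedCurve c)
    (hleaf : GeodesicBilliard.IsLeaf F Ω c)
    (ν : ∀ x : M, TangentSpace (𝓡 2) x) (hν : GeodesicBilliard.IsUnitNormal g c ν)
    (hconv : GeodesicBilliard.IsConvexWall g c ν) :
    (∃ δ > 0, ∃ f : TangentBundle (𝓡 2) M → ℝ,
      GeodesicBilliard.IsIntegralOfMotion g c ν δ f) ∧
    GeodesicBilliard.IsFoliatedByCaustics g c ν := by
  obtain ⟨S', hS', h⟩ := hleaf.exists_isEigenWall hS hΩ hreal hF hc hν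
  exact ⟨⟨Real.pi / 2, by positivity, GeodesicBilliard.ratio g S', h.isIntegralOfMotion hS'⟩,
    h.isFoliatedByCaustics hS' hconv hc hν.continuous⟩
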